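/- Let $\mathbb D$ be the open unit disc, $\mathbb T$ the unit circle with normalized Haar measure $m$. Let $\Psi\colon[0,\infty)\to[0,\infty)$ be an Orlicz function, i.e. $\Psi$ is non-decreasing, strictly convex, continuous at $0$, $\Psi(0)=0$ and $\Psi(x)/x\to\infty$ as $x\to\infty$; put $\Psi(\infty)=\infty$, so that $\Psi$ has an inverse $\Psi^{-1}\colon[0,\infty]\to[0,\infty]$, and put $\chi_A(x)=\Psi(A\,\Psi^{-1}(x))$ for $A>0$. For measurable $f$ on $\mathbb T$ let $\|f\|_\Psi=\inf\{C>0:\int_{\mathbb T}\Psi(|f|/C)\,dm\le 1\}$, and let $M^\Psi(\mathbb T)$ be the space of measurable $f$ with $\int_{\mathbb T}\Psi(|f|/C)\,dm<\infty$ for every $C>0$. The Hardy--Orlicz space $H^\Psi$ is the space of analytic $f\colon\mathbb D\to\mathbb C$ with $\|f\|_\Psi:=\sup_{0\le r<1}\|f_r\|_\Psi<\infty$, where $f_r(e^{it})=f(re^{it})$; write $f^*(e^{it})=\lim_{r\to1^-}f(re^{it})$ for the boundary values, which exist $m$-a.e. For $a\in\mathbb T$ and $0\le r<1$ let $u_{a,r}(z)=\big(\frac{1-r}{1-\bar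 a r z}\big)^2$, $z\in\mathbb D$. Suppose that $\Psi$ satisfies the $\Delta^2$-condition: there is $\alpha>1$ such that $\Psi(x)^2\le\Psi(\alpha x)$ for all sufficiently large $x$. Let $\phi\colon\mathbb D\to\mathbb D$ be analytic. Then $C_\phi(f)=f\circ\phi$ defines a bounded operator $C_\phi\colon H^\Psi\to H^\Psi$, and the following assertions are equivalent: 1. $C_\phi$ is order bounded into $M^\Psi(\mathbb T)$: there is $g\in M^\Psi(\mathbb T)$ such that, for every $f\in H^\Psi$ with $\|f\|_\Psi\le1$, $|(C_\phi f)^*|\le g$ $m$-a.e.; 2. $C_\phi$ is compact; 3. $C_\phi$ is weakly compact; 4. $\Psi^{-1}\big(\frac{1}{1-|\phi^*|}\big)\in M^\Psi(\mathbb T)$; that is, $\chi_B\big(\frac1{1-|\phi^*|}\big)\in L^1(\mathbb T)$ for every $B>0$ (with $1/0=\infty$); 5. for every $A>0$, $m(1-|\phi^*|<\lambda)=O\big(1/\chi_A(1/\lambda)\big)$ as $\lambda\to0^+$; 6. $\sup_{a\in\mathbb T}\|C_\phi(u_{a,r})\|_\Psi=o\Big(\dfrac{1}{\Psi^{-1}\big(\frac1{1-r}\big)}\Big)$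 as $r\to1^-$. -/

import Mathlib

open Set Filter Topology MeasureTheory Asymptotics
open scoped ENNReal NNReal

noncomputable section

/-- A (finite-valued) Orlicz function `Ψ : [0, ∞) → [0, ∞)`: `Ψ 0 = 0`, non-decreasing, strictly
convex, continuous at `0`, with `Ψ x / x → ∞`. Only the values on `[0, ∞)` matter. -/
structure OrliczFunction where
  toFun : ℝ → ℝ
  map_zero : toFun 0 = 0
  monotoneOn : MonotoneOn toFun (Ici 0)
  strictConvexOn : StrictConvexOn ℝ (Ici 0) toFun
  continuousAt_zero : ContinuousWithinAt toFun (Ici 0) 0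
  tendsto_div : Tendsto (fun x => toFun x / x) atTop atTop

namespace OrliczFunction

variable (Ψ : OrliczFunction)

/-- The function `Ψ : [0, ∞] → [0, ∞]`, with `Ψ ∞ = ∞`. -/
def eval (x : ℝ≥0∞) : ℝ≥0∞ := if x = ⊤ then ⊤ else ENNReal.ofReal (Ψ.toFun x.toReal)

/-- The inverse `Ψ⁻¹ : [0, ∞] → [0, ∞]`; see `eval_inv` and `inv_eval`. -/
def inv (y : ℝ≥0∞) : ℝ≥0∞ := sSup {x | Ψ.eval x ≤ y}

/-- `χ_K(x) = Ψ(K Ψ⁻¹(x))`. -/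
def chi (K x : ℝ≥0∞) : ℝ≥0∞ := Ψ.eval (K * Ψ.inv x)

/-- The fast growth condition `Δ²`: for some `α > 1`, `Ψ(x)² ≤ Ψ(α x)` for `x` large enough. -/
def SatisfiesDelta2 : Prop := ∃ α : ℝ, 1 < α ∧ ∀ᶠ x in atTop, Ψ.toFun x ^ 2 ≤ Ψ.toFun (α * x)

theorem nonneg {x : ℝ} (hx : 0 ≤ x) : 0 ≤ Ψ.toFun x := by
  have := Ψ.monotoneOn (mem_Ici.2 le_rfl) (mem_Ici.2 hx) hx
  rwa [Ψ.map_zero] at this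

theorem strictMonoOn : StrictMonoOn Ψ.toFun (Ici 0) := by
  intro x hx y hy hxy
  refine lt_of_le_of_ne (Ψ.monotoneOn hx hy hxy.le) fun h => ?_
  obtain ⟨-, hc⟩ := Ψ.strictConvexOn
  have h1 := hc hx hy hxy.ne (a := 1 / 2) (b := 1 / 2) (by norm_num) (by norm_num) (by norm_num)
  simp only [smul_eq_mul] at h1
  have hx' : (0 : ℝ) ≤ x := hx
  have h2 := Ψ.monotoneOn hx (mem_Ici.2 (by linarith : (0 : ℝ) ≤ 1 / 2 * x + 1 / 2 * y))
    (by linarith)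
  linarith

theorem eval_zero : Ψ.eval 0 = 0 := by simp [eval, Ψ.map_zero]

theorem eval_strictMono : StrictMono Ψ.eval := by
  intro x y hxy
  have hx : x ≠ ⊤ := hxy.ne_top
  by_cases hy : y = ⊤
  · simp [eval, hx, hy]
  · simp only [eval, hx, hy, if_false]
    have hlt : x.toReal < y.toReal := (ENNReal.toReal_lt_toReal hx hy).2 hxy
    have h := Ψ.strictMonoOn (mem_Ici.2 ENNReal.toReal_nonneg)
      (mem_Ici.2 ENNReal.toReal_nonneg) hlt
    exact (ENNReal.ofReal_lt_ofReal_iff ((Ψ.nonneg ENNReal.toReal_nonneg).trans_lt h)).2 h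

theorem inv_eval (x : ℝ≥0∞) : Ψ.inv (Ψ.eval x) = x := by
  have : {x' | Ψ.eval x' ≤ Ψ.eval x} = Iic x := by
    ext x'; simp [Ψ.eval_strictMono.le_iff_le]
  rw [inv, this, csSup_Iic]

theorem continuousOn : ContinuousOn Ψ.toFun (Ici 0) := by
  intro x hx
  rcases eq_or_lt_of_le (mem_Ici.1 hx) with h | h
  · subst h; exact Ψ.continuousAt_zero
  · have h1 : ContinuousOn Ψ.toFun (interior (Ici 0)) :=
      Ψ.strictConvexOn.convexOn.continuousOn_interior
    rw [interior_Ici] at h1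
    exact (h1.continuousAt (Ioi_mem_nhds h)).continuousWithinAt

theorem tendsto_atTop : Tendsto Ψ.toFun atTop atTop := by
  have h := Ψ.tendsto_div.atTop_mul_atTop₀ tendsto_id
  refine h.congr' ?_
  filter_upwards [eventually_gt_atTop (0 : ℝ)] with x hx
  simp [hx.ne']

theorem eval_inv (y : ℝ≥0∞) : Ψ.eval (Ψ.inv y) = y := by
  obtain ⟨x, rfl⟩ : ∃ x, Ψ.eval x = y := by
    by_cases hy : y = ⊤
    · exact ⟨⊤, by simp [eval, hy]⟩
    obtain ⟨b, hb0, hb⟩ := ((eventually_ge_atTop (0 : ℝ)).and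
      (Ψ.tendsto_atTop.eventually_ge_atTop y.toReal)).exists
    obtain ⟨c, hc, hcy⟩ := intermediate_value_Icc hb0
      (Ψ.continuousOn.mono Icc_subset_Ici_self)
      ⟨by rw [Ψ.map_zero]; exact ENNReal.toReal_nonneg, hb⟩
    refine ⟨ENNReal.ofReal c, ?_⟩
    simp [eval, ENNReal.toReal_ofReal hc.1, hcy, ENNReal.ofReal_toReal hy]
  rw [Ψ.inv_eval]

theorem eval_convex {a b x y : ℝ≥0∞} (hab : a + b = 1) :
    Ψ.eval (a * x + b * y) ≤ a * Ψ.eval x + b * Ψ.eval y := by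
  by_cases ha : a = 0
  · simp only [ha, zero_add] at hab; simp [ha, hab]
  by_cases hb : b = 0
  · simp only [hb, add_zero] at hab; simp [hb, hab]
  by_cases hx : x = ⊤
  · simp [eval, hx, ENNReal.mul_top ha]
  by_cases hy : y = ⊤
  · simp [eval, hy, ENNReal.mul_top hb]
  have ha' : a ≠ ⊤ := ne_top_of_le_ne_top ENNReal.one_ne_top (hab ▸ le_self_add)
  have hb' : b ≠ ⊤ := ne_top_of_le_ne_top ENNReal.one_ne_top (hab ▸ le_add_self)
  have hax := ENNReal.mul_ne_top ha' hx
  have hby := ENNReal.mul_ne_top hb' hy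
  obtain ⟨-, hc⟩ := Ψ.strictConvexOn.convexOn
  have h := hc (x := x.toReal) (y := y.toReal)
    (mem_Ici.2 ENNReal.toReal_nonneg) (mem_Ici.2 ENNReal.toReal_nonneg)
    (a := a.toReal) (b := b.toReal) ENNReal.toReal_nonneg ENNReal.toReal_nonneg
    (by rw [← ENNReal.toReal_add ha' hb', hab]; simp)
  simp only [smul_eq_mul] at h
  have hne : a * x + b * y ≠ ⊤ := ENNReal.add_ne_top.2 ⟨hax, hby⟩
  simp only [eval, hx, hy, hne, if_false]
  rw [ENNReal.toReal_add hax hby, ENNReal.toReal_mul, ENNReal.toReal_mul]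
  refine (ENNReal.ofReal_le_ofReal h).trans ?_
  rw [ENNReal.ofReal_add
    (mul_nonneg ENNReal.toReal_nonneg (Ψ.nonneg ENNReal.toReal_nonneg))
    (mul_nonneg ENNReal.toReal_nonneg (Ψ.nonneg ENNReal.toReal_nonneg)),
    ENNReal.ofReal_mul ENNReal.toReal_nonneg, ENNReal.ofReal_mul ENNReal.toReal_nonneg,
    ENNReal.ofReal_toReal ha', ENNReal.ofReal_toReal hb']

end OrliczFunction

/-- The normalized Haar measure `m` of the unit circle, in the angular coordinate:
`dt / 2π` on `(0, 2π]`. Functions on the circle are functions of the angle `t`. -/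
def circleMeasure : Measure ℝ :=
  (ENNReal.ofReal (2 * Real.pi))⁻¹ • volume.restrict (Ioc 0 (2 * Real.pi))

/-- The Luxemburg norm `‖f‖_Ψ = inf {C > 0 | ∫ Ψ(|f| / C) dm ≤ 1}`. -/
def luxemburgNorm (Ψ : OrliczFunction) {ε : Type*} [ENorm ε] (f : ℝ → ε) : ℝ≥0∞ :=
  sInf {C | 0 < C ∧ ∫⁻ t, Ψ.eval (‖f t‖ₑ / C) ∂circleMeasure ≤ 1}

/-- Membership in the Morse–Transue space `M^Ψ(𝕋)`: measurable functions with
`∫ Ψ(|f| / C) dm < ∞` for all `C > 0`. As `Ψ ∞ = ∞`, a `[0, ∞]`-valued member is a.e. finite. -/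
def MemMorseTransue (Ψ : OrliczFunction) {ε : Type*} [TopologicalSpace ε] [ContinuousENorm ε]
    (f : ℝ → ε) : Prop :=
  AEStronglyMeasurable f circleMeasure ∧
    ∀ C : ℝ≥0, 0 < C → ∫⁻ t, Ψ.eval (‖f t‖ₑ / C) ∂circleMeasure < ⊤

/-- The boundary function `f*(t) = lim_{r → 1⁻} f(r e^{it})` (arbitrary where there is no limit). -/
def boundaryValue (f : ℂ → ℂ) (t : ℝ) : ℂ :=
  limUnder (𝓝[<] (1 : ℝ)) fun r => f (circleMap 0 r t)

/-- `sup_{0 ≤ r < 1} ‖f_r‖_Ψ`, where `f_r(t) = f(r e^{it})`. -/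
def hardyOrliczENorm (Ψ : OrliczFunction) (f : ℂ → ℂ) : ℝ≥0∞ :=
  ⨆ r ∈ Ico (0 : ℝ) 1, luxemburgNorm Ψ fun t => f (circleMap 0 r t)

section Luxemburg

variable (Ψ : OrliczFunction)

instance : IsProbabilityMeasure circleMeasure := by
  constructor
  have h : ENNReal.ofReal (2 * Real.pi) ≠ 0 := by
    simpa using Real.pi_pos
  simp only [circleMeasure, Measure.smul_apply, Measure.restrict_apply MeasurableSet.univ,
    univ_inter, Real.volume_Ioc, sub_zero, smul_eq_mul]
  exact ENNReal.inv_mul_cancel h ENNReal.ofReal_ne_top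

theorem luxemburgNorm_zero : luxemburgNorm Ψ (fun _ : ℝ => (0 : ℂ)) = 0 := by
  refine le_antisymm (le_of_forall_gt fun C hC => ?_) bot_le
  obtain ⟨D, hD, hDC⟩ := exists_between hC
  have hmem : luxemburgNorm Ψ (fun _ : ℝ => (0 : ℂ)) ≤ D := sInf_le ⟨hD, by simp [Ψ.eval_zero]⟩
  exact hmem.trans_lt hDC

theorem luxemburgNorm_add_le {f g : ℝ → ℂ} (hf : Measurable f) :
    luxemburgNorm Ψ (fun t => f t + g t) ≤ luxemburgNorm Ψ f + luxemburgNorm Ψ g := by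
  have key : ∀ C ∈ {C | 0 < C ∧ ∫⁻ t, Ψ.eval (‖f t‖ₑ / C) ∂circleMeasure ≤ 1},
      ∀ D ∈ {C | 0 < C ∧ ∫⁻ t, Ψ.eval (‖g t‖ₑ / C) ∂circleMeasure ≤ 1},
      luxemburgNorm Ψ (fun t => f t + g t) ≤ C + D := by
    rintro C ⟨hC, hCf⟩ D ⟨hD, hDg⟩
    by_cases hCt : C = ⊤
    · simp [hCt]
    by_cases hDt : D = ⊤
    · simp [hDt]
    have hS0 : C + D ≠ 0 := (hC.trans_le le_self_add).ne'
    have hSt : C + D ≠ ⊤ := ENNReal.add_ne_top.2 ⟨hCt, hDt⟩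
    have hab : C / (C + D) + D / (C + D) = 1 := by
      rw [← ENNReal.add_div, ENNReal.div_self hS0 hSt]
    refine sInf_le ⟨pos_iff_ne_zero.2 hS0, ?_⟩
    have hpt : ∀ t, Ψ.eval (‖f t + g t‖ₑ / (C + D)) ≤
        C / (C + D) * Ψ.eval (‖f t‖ₑ / C) + D / (C + D) * Ψ.eval (‖g t‖ₑ / D) := by
      intro t
      refine le_trans (Ψ.eval_strictMono.monotone ?_) (Ψ.eval_convex hab)
      have hcancel : ∀ {E x : ℝ≥0∞}, E ≠ 0 → E ≠ ⊤ → E / (C + D) * (x / E) = x / (C + D) := by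
        intro E x h0 ht
        calc E / (C + D) * (x / E) = E * E⁻¹ * (x * (C + D)⁻¹) := by
              simp only [div_eq_mul_inv]; ring
          _ = x / (C + D) := by rw [ENNReal.mul_inv_cancel h0 ht, one_mul, div_eq_mul_inv]
      rw [hcancel hC.ne' hCt, hcancel hD.ne' hDt, ← ENNReal.add_div]
      exact ENNReal.div_le_div_right (enorm_add_le _ _) _
    have hm : Measurable fun t => C / (C + D) * Ψ.eval (‖f t‖ₑ / C) :=
      (Ψ.eval_strictMono.monotone.measurable.comp (hf.enorm.div_const C)).const_mul _
    have hc1 : C / (C + D) ≠ ⊤ := ENNReal.div_ne_top hCt hS0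
    have hc2 : D / (C + D) ≠ ⊤ := ENNReal.div_ne_top hDt hS0
    calc ∫⁻ t, Ψ.eval (‖f t + g t‖ₑ / (C + D)) ∂circleMeasure
        ≤ ∫⁻ t, (C / (C + D) * Ψ.eval (‖f t‖ₑ / C) +
            D / (C + D) * Ψ.eval (‖g t‖ₑ / D)) ∂circleMeasure := lintegral_mono hpt
      _ = C / (C + D) * ∫⁻ t, Ψ.eval (‖f t‖ₑ / C) ∂circleMeasure +
            D / (C + D) * ∫⁻ t, Ψ.eval (‖g t‖ₑ / D) ∂circleMeasure := by
          rw [lintegral_add_left hm, lintegral_const_mul' _ _ hc1, lintegral_const_mul' _ _ hc2]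
      _ ≤ C / (C + D) * 1 + D / (C + D) * 1 := by gcongr
      _ = 1 := by rw [mul_one, mul_one, hab]
  conv_rhs => rw [luxemburgNorm, luxemburgNorm, ENNReal.sInf_add]
  refine le_iInf₂ fun C hC => ?_
  rw [add_comm, ENNReal.sInf_add]
  refine le_iInf₂ fun D hD => ?_
  rw [add_comm]
  exact key C hC D hD

theorem luxemburgNorm_smul_le (c : ℂ) (f : ℝ → ℂ) :
    luxemburgNorm Ψ (fun t => c * f t) ≤ ‖c‖ₑ * luxemburgNorm Ψ f := by
  by_cases hc : c = 0
  · simp [hc, luxemburgNorm_zero]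
  have hc0 : ‖c‖ₑ ≠ 0 := by simpa using hc
  have hct : ‖c‖ₑ ≠ ⊤ := enorm_ne_top
  rw [mul_comm, ← ENNReal.div_le_iff hc0 hct]
  refine le_sInf fun C ⟨hC, hCf⟩ => ?_
  rw [ENNReal.div_le_iff hc0 hct]
  refine sInf_le ⟨pos_iff_ne_zero.2 (mul_ne_zero hC.ne' hc0), ?_⟩
  refine le_trans (le_of_eq (lintegral_congr fun t => ?_)) hCf
  rw [enorm_mul, mul_comm C, ENNReal.mul_div_mul_left _ _ hc0 hct]

theorem luxemburgNorm_le_of_bound {f : ℝ → ℂ} {M : ℝ≥0∞} (hM : ∀ t, ‖f t‖ₑ ≤ M) (hMt : M ≠ ⊤) :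
    luxemburgNorm Ψ f ≤ M / Ψ.inv 1 := by
  have hi0 : Ψ.inv 1 ≠ 0 := fun h => by
    have := Ψ.eval_inv 1
    rw [h, Ψ.eval_zero] at this
    exact zero_ne_one this
  have hit : Ψ.inv 1 ≠ ⊤ := fun h => by
    have := Ψ.eval_inv 1
    rw [h] at this
    simp [OrliczFunction.eval] at this
  by_cases hM0 : M = 0
  · have : f = fun _ => 0 := by
      ext1 t
      simpa [hM0] using hM t
    rw [this, luxemburgNorm_zero]; exact bot_le
  refine sInf_le ⟨ENNReal.div_pos hM0 hit, ?_⟩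
  have : ∀ t, Ψ.eval (‖f t‖ₑ / (M / Ψ.inv 1)) ≤ 1 := by
    intro t
    rw [← Ψ.eval_inv 1]
    apply Ψ.eval_strictMono.monotone
    rw [Ψ.eval_inv 1]
    calc ‖f t‖ₑ / (M / Ψ.inv 1) ≤ M / (M / Ψ.inv 1) := ENNReal.div_le_div_right (hM t) _
      _ = Ψ.inv 1 := ENNReal.div_div_cancel hM0 hMt
  calc _ ≤ ∫⁻ _, 1 ∂circleMeasure := lintegral_mono this
    _ = 1 := by simp

theorem ae_eq_zero_of_luxemburgNorm {f : ℝ → ℂ} (hf : Measurable f)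
    (h : luxemburgNorm Ψ f = 0) : ∀ᵐ t ∂circleMeasure, f t = 0 := by
  -- `∫ Ψ(n |f|) dm ≤ 1` for every `n`, and `Ψ(n |f|) ≥ n Ψ(|f|)`
  have hn : ∀ n : ℕ, (n : ℝ≥0∞) * ∫⁻ t, Ψ.eval ‖f t‖ₑ ∂circleMeasure ≤ 1 := by
    intro n
    rcases Nat.eq_zero_or_pos n with h0 | h0
    · simp [h0]
    have hn0 : (n : ℝ≥0∞) ≠ 0 := by exact_mod_cast h0.ne'
    have hlt : luxemburgNorm Ψ f < (n : ℝ≥0∞)⁻¹ := by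
      rw [h]; simp
    obtain ⟨C, ⟨hC, hCf⟩, hCn⟩ := sInf_lt_iff.1 hlt
    refine le_trans ?_ hCf
    rw [← lintegral_const_mul' _ _ (ENNReal.natCast_ne_top n)]
    refine lintegral_mono fun t => ?_
    have hinv : (n : ℝ≥0∞)⁻¹ ≤ 1 := by
      rw [ENNReal.inv_le_one]; exact_mod_cast h0
    have h1 := Ψ.eval_convex (a := (n : ℝ≥0∞)⁻¹) (b := 1 - (n : ℝ≥0∞)⁻¹)
      (x := n * ‖f t‖ₑ) (y := 0) (add_tsub_cancel_of_le hinv)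
    rw [mul_zero, add_zero, Ψ.eval_zero, mul_zero, add_zero, ← mul_assoc,
      ENNReal.inv_mul_cancel hn0 (ENNReal.natCast_ne_top n), one_mul] at h1
    calc (n : ℝ≥0∞) * Ψ.eval ‖f t‖ₑ ≤ n * ((n : ℝ≥0∞)⁻¹ * Ψ.eval (n * ‖f t‖ₑ)) := by gcongr
      _ = Ψ.eval (n * ‖f t‖ₑ) := by
          rw [← mul_assoc, ENNReal.mul_inv_cancel hn0 (ENNReal.natCast_ne_top n), one_mul]
      _ ≤ Ψ.eval (‖f t‖ₑ / C) := by
          apply Ψ.eval_strictMono.monotone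
          rw [mul_comm, div_eq_mul_inv]
          gcongr
          rw [ENNReal.le_inv_iff_le_inv]
          exact hCn.le
  have hz : ∫⁻ t, Ψ.eval ‖f t‖ₑ ∂circleMeasure = 0 := by
    by_contra hne
    obtain ⟨n, hn'⟩ := ENNReal.exists_nat_mul_gt hne ENNReal.one_ne_top
    exact absurd (hn n) (not_le.2 hn')
  have hm : Measurable fun t => Ψ.eval ‖f t‖ₑ :=
    Ψ.eval_strictMono.monotone.measurable.comp hf.enorm
  rw [lintegral_eq_zero_iff hm] at hz
  filter_upwards [hz] with t ht
  have : ‖f t‖ₑ = 0 := Ψ.eval_strictMono.injective (by rw [Ψ.eval_zero]; exact ht)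
  simpa using this

theorem continuous_circle_slice {f : ℂ → ℂ} (hf : DifferentiableOn ℂ f (Metric.ball 0 1)) {r : ℝ}
    (hr : r ∈ Ico (0 : ℝ) 1) : Continuous fun t => f (circleMap 0 r t) := by
  refine hf.continuousOn.comp_continuous (continuous_circleMap 0 r) fun t => ?_
  simp [abs_of_nonneg hr.1, hr.2]

theorem hardyOrliczENorm_zero : hardyOrliczENorm Ψ 0 = 0 := by
  have := luxemburgNorm_zero Ψ
  simp [hardyOrliczENorm, this]

theorem hardyOrliczENorm_add_le {f g : ℂ → ℂ} (hf : DifferentiableOn ℂ f (Metric.ball 0 1)) :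
    hardyOrliczENorm Ψ (f + g) ≤ hardyOrliczENorm Ψ f + hardyOrliczENorm Ψ g :=
  iSup₂_le fun r hr => (luxemburgNorm_add_le Ψ (continuous_circle_slice hf hr).measurable).trans
    (add_le_add
      (le_iSup₂ (f := fun r (_ : r ∈ Ico (0 : ℝ) 1) =>
        luxemburgNorm Ψ fun t => f (circleMap 0 r t)) r hr)
      (le_iSup₂ (f := fun r (_ : r ∈ Ico (0 : ℝ) 1) =>
        luxemburgNorm Ψ fun t => g (circleMap 0 r t)) r hr))

theorem hardyOrliczENorm_smul_le (c : ℂ) (f : ℂ → ℂ) :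
    hardyOrliczENorm Ψ (c • f) ≤ ‖c‖ₑ * hardyOrliczENorm Ψ f :=
  iSup₂_le fun r hr => (luxemburgNorm_smul_le Ψ c _).trans
    (mul_le_mul_right (le_iSup₂ (f := fun r (_ : r ∈ Ico (0 : ℝ) 1) =>
        luxemburgNorm Ψ fun t => f (circleMap 0 r t)) r hr) _)

theorem eq_zero_of_hardyOrliczENorm {f : ℂ → ℂ} (hf : DifferentiableOn ℂ f (Metric.ball 0 1))
    (h : hardyOrliczENorm Ψ f = 0) {z : ℂ} (hz : z ∈ Metric.ball (0 : ℂ) 1) : f z = 0 := by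
  have hr : ‖z‖ ∈ Ico (0 : ℝ) 1 := ⟨norm_nonneg z, by simpa using hz⟩
  have h0 : luxemburgNorm Ψ (fun t => f (circleMap 0 ‖z‖ t)) = 0 := by
    refine le_antisymm ?_ bot_le
    rw [← h]
    exact le_iSup₂ (f := fun r (_ : r ∈ Ico (0 : ℝ) 1) =>
        luxemburgNorm Ψ fun t => f (circleMap 0 r t)) ‖z‖ hr
  have hc := continuous_circle_slice hf hr
  have hae := ae_eq_zero_of_luxemburgNorm Ψ hc.measurable h0
  have hae' : ∀ᵐ t ∂(volume.restrict (Ioc 0 (2 * Real.pi))), f (circleMap 0 ‖z‖ t) = 0 := by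
    rw [circleMeasure, ae_iff, Measure.smul_apply, smul_eq_mul, mul_eq_zero] at hae
    rcases hae with h | h
    · exact absurd h (ENNReal.inv_ne_zero.2 ENNReal.ofReal_ne_top)
    · exact ae_iff.2 h
  have hIoo : ∀ᵐ t ∂(volume.restrict (Ioo 0 (2 * Real.pi))), f (circleMap 0 ‖z‖ t) = 0 :=
    ae_restrict_of_ae_restrict_of_subset Ioo_subset_Ioc_self hae'
  have hEq : EqOn (fun t => f (circleMap 0 ‖z‖ t)) (fun _ => 0) (Ioo 0 (2 * Real.pi)) :=
    Measure.eqOn_open_of_ae_eq hIoo isOpen_Ioo hc.continuousOn continuousOn_const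
  have hcl := hEq.closure hc continuous_const
  rw [closure_Ioo Real.two_pi_pos.ne] at hcl
  obtain ⟨t, ht, htz⟩ : ∃ t ∈ Icc 0 (2 * Real.pi), circleMap 0 ‖z‖ t = z := by
    have hmem : z ∈ circleMap 0 ‖z‖ '' Ioc 0 (2 * Real.pi) := by
      rw [image_circleMap_Ioc]; simp
    obtain ⟨t, ht, htz⟩ := hmem
    exact ⟨t, Ioc_subset_Icc_self ht, htz⟩
  have := hcl ht
  simpa [htz] using this

/-- The underlying vector space of `H^Ψ`: analytic functions on the open unit disc with
`sup_{0 ≤ r < 1} ‖f_r‖_Ψ < ∞`. A function on the disc is represented by its extension by `0`. -/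
def hardyOrliczSubmodule : Submodule ℂ (ℂ → ℂ) where
  carrier := {f | DifferentiableOn ℂ f (Metric.ball 0 1) ∧ (∀ z ∉ Metric.ball (0 : ℂ) 1, f z = 0) ∧
    hardyOrliczENorm Ψ f < ⊤}
  zero_mem' := ⟨differentiableOn_const 0, fun _ _ => rfl, by simp [hardyOrliczENorm_zero]⟩
  add_mem' := fun {f g} hf hg => ⟨hf.1.add hg.1,
    fun z hz => by simp [hf.2.1 z hz, hg.2.1 z hz],
    (hardyOrliczENorm_add_le Ψ hf.1).trans_lt (ENNReal.add_lt_top.2 ⟨hf.2.2, hg.2.2⟩)⟩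
  smul_mem' := fun c f hf => ⟨hf.1.const_smul c, fun z hz => by simp [hf.2.1 z hz],
    (hardyOrliczENorm_smul_le Ψ c f).trans_lt (ENNReal.mul_lt_top enorm_lt_top hf.2.2)⟩

/-- The Hardy–Orlicz space `H^Ψ`, with the norm `‖f‖_Ψ = sup_{0 ≤ r < 1} ‖f_r‖_Ψ`. -/
def HardyOrlicz : Type := hardyOrliczSubmodule Ψ

end Luxemburg

namespace HardyOrlicz

variable {Ψ : OrliczFunction}

instance : AddCommGroup (HardyOrlicz Ψ) := inferInstanceAs (AddCommGroup (hardyOrliczSubmodule Ψ))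

instance : Module ℂ (HardyOrlicz Ψ) := inferInstanceAs (Module ℂ (hardyOrliczSubmodule Ψ))

instance : CoeFun (HardyOrlicz Ψ) fun _ => ℂ → ℂ := ⟨fun f => f.1⟩

/-- The norm of `H^Ψ`, with its axioms. -/
def addGroupNorm : AddGroupNorm (HardyOrlicz Ψ) where
  toFun f := (hardyOrliczENorm Ψ f).toReal
  map_zero' := by
    change (hardyOrliczENorm Ψ 0).toReal = 0
    simp [hardyOrliczENorm_zero]
  add_le' f g := by
    rw [← ENNReal.toReal_add f.2.2.2.ne g.2.2.2.ne]
    exact ENNReal.toReal_mono (ENNReal.add_ne_top.2 ⟨f.2.2.2.ne, g.2.2.2.ne⟩)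
      (hardyOrliczENorm_add_le Ψ f.2.1)
  neg' f := by
    have key : ∀ g : HardyOrlicz Ψ, hardyOrliczENorm Ψ (-g : HardyOrlicz Ψ) ≤
        hardyOrliczENorm Ψ g := fun g => by
      have h := hardyOrliczENorm_smul_le Ψ (-1) g
      rw [neg_one_smul] at h
      rw [enorm_neg, enorm_one, one_mul] at h
      exact h
    have h2 := key (-f)
    rw [neg_neg] at h2
    rw [le_antisymm (key f) h2]
  eq_zero_of_map_eq_zero' f hf := by
    have h0 : hardyOrliczENorm Ψ f = 0 := by
      rcases (ENNReal.toReal_eq_zero_iff _).1 hf with h | h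
      · exact h
      · exact absurd h f.2.2.2.ne
    apply Subtype.ext
    funext z
    by_cases hz : z ∈ Metric.ball (0 : ℂ) 1
    · exact eq_zero_of_hardyOrliczENorm Ψ f.2.1 h0 hz
    · exact f.2.2.1 z hz

instance : NormedAddCommGroup (HardyOrlicz Ψ) := addGroupNorm.toNormedAddCommGroup

theorem norm_def (f : HardyOrlicz Ψ) : ‖f‖ = (hardyOrliczENorm Ψ f).toReal := rfl

instance : NormedSpace ℂ (HardyOrlicz Ψ) where
  norm_smul_le c f := by
    rw [norm_def, norm_def, ← toReal_enorm, ← ENNReal.toReal_mul]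
    exact ENNReal.toReal_mono (ENNReal.mul_ne_top enorm_ne_top f.2.2.2.ne)
      (hardyOrliczENorm_smul_le Ψ c f)

/-- A bounded analytic function on the disc, as an element of `H^Ψ`. -/
def ofBounded (Ψ : OrliczFunction) (f : ℂ → ℂ) (hf : DifferentiableOn ℂ f (Metric.ball 0 1))
    (M : ℝ) (hM : ∀ z ∈ Metric.ball (0 : ℂ) 1, ‖f z‖ ≤ M) : HardyOrlicz Ψ :=
  ⟨(Metric.ball (0 : ℂ) 1).indicator f, hf.congr fun z hz => indicator_of_mem hz f,
    fun z hz => indicator_of_notMem hz f, by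
      have hb : hardyOrliczENorm Ψ ((Metric.ball (0 : ℂ) 1).indicator f) ≤
          ENNReal.ofReal M / Ψ.inv 1 := by
        refine iSup₂_le fun r hr => luxemburgNorm_le_of_bound Ψ (fun t => ?_) ENNReal.ofReal_ne_top
        have hmem : circleMap 0 r t ∈ Metric.ball (0 : ℂ) 1 := by
          simp [abs_of_nonneg hr.1, hr.2]
        rw [indicator_of_mem hmem, ← ofReal_norm]
        exact ENNReal.ofReal_le_ofReal (hM _ hmem)
      refine hb.trans_lt (ENNReal.div_lt_top ENNReal.ofReal_ne_top fun h => ?_)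
      have h1 := Ψ.eval_inv 1
      rw [h, Ψ.eval_zero] at h1
      exact zero_ne_one h1⟩

end HardyOrlicz

/-- `u_{a,r}(z) = ((1 - r) / (1 - \bar a r z))²`. -/
def uFun (a : Circle) (r : ℝ) (z : ℂ) : ℂ :=
  ((1 - r) / (1 - (starRingEnd ℂ) (a : ℂ) * r * z)) ^ 2

theorem uFun_denom {a : Circle} {r : ℝ} (hr : r ∈ Ico (0 : ℝ) 1) {z : ℂ}
    (hz : z ∈ Metric.ball (0 : ℂ) 1) : 1 - r ≤ ‖1 - (starRingEnd ℂ) (a : ℂ) * r * z‖ := by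
  have hz' : ‖z‖ ≤ 1 := by simpa using (mem_ball_zero_iff.1 hz).le
  have h1 : ‖(starRingEnd ℂ) (a : ℂ) * r * z‖ ≤ r := by
    simp only [norm_mul, RCLike.norm_conj, Circle.norm_coe, one_mul, Complex.norm_real,
      Real.norm_eq_abs, abs_of_nonneg hr.1]
    exact mul_le_of_le_one_right hr.1 hz'
  have h2 := norm_sub_norm_le (1 : ℂ) ((starRingEnd ℂ) (a : ℂ) * r * z)
  rw [norm_one] at h2
  linarith

open Classical in
/-- The function `u_{a,r}` as an element of `H^Ψ`, for `0 ≤ r < 1` (and `0` for other `r`). -/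
def uElem (Ψ : OrliczFunction) (a : Circle) (r : ℝ) : HardyOrlicz Ψ :=
  if hr : r ∈ Ico (0 : ℝ) 1 then
    HardyOrlicz.ofBounded Ψ (uFun a r)
      (by
        have hd : ∀ z ∈ Metric.ball (0 : ℂ) 1, 1 - (starRingEnd ℂ) (a : ℂ) * r * z ≠ 0 :=
          fun z hz h => by
            have h1 := uFun_denom (a := a) hr hz
            rw [h, norm_zero] at h1
            linarith [hr.2]
        exact DifferentiableOn.pow (DifferentiableOn.div (by fun_prop) (by fun_prop) hd) 2)
      1
      (by
        intro z hz
        have h1 := uFun_denom (a := a) hr hz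
        have h2 : ‖(1 - r : ℂ)‖ = 1 - r := by
          rw [← Complex.ofReal_one, ← Complex.ofReal_sub, Complex.norm_real, Real.norm_eq_abs,
            abs_of_pos (by linarith [hr.2])]
        rw [uFun, norm_pow, norm_div, h2]
        refine pow_le_one₀ (div_nonneg (by linarith [hr.2]) (norm_nonneg _)) ?_
        exact div_le_one_of_le₀ h1 (norm_nonneg _))
  else 0

/-- `T : H^Ψ → H^Ψ` is order bounded into `M^Ψ(𝕋)`: there is `g ∈ M^Ψ(𝕋)` such that `|T f| ≤ g`
a.e. on the circle for every `f` in the unit ball. -/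
def OrderBoundedIntoMorseTransue {Ψ : OrliczFunction} (T : HardyOrlicz Ψ →L[ℂ] HardyOrlicz Ψ) :
    Prop :=
  ∃ g : ℝ → ℝ, MemMorseTransue Ψ g ∧
    ∀ f : HardyOrlicz Ψ, ‖f‖ ≤ 1 → ∀ᵐ t ∂circleMeasure, ‖boundaryValue (T f) t‖ ≤ g t

/-- Weak compactness of an operator: the image of the unit ball is relatively weakly compact. -/
def IsWeaklyCompactOperator {E F : Type*} [NormedAddCommGroup E] [NormedSpace ℂ E]
    [NormedAddCommGroup F] [NormedSpace ℂ F] (T : E →L[ℂ] F) : Prop :=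
  IsCompact (closure (toWeakSpace ℂ F '' (T '' Metric.closedBall 0 1)))

end

/-! ### Poisson integrals on the disc. -/

noncomputable section

/-! Put R = 1/(1 - |φ*|). The hub is `ChiFiniteIntegral`: χ_B(R) is integrable for every B.
Everything rests on the fact that evaluation at z has norm comparable to Ψ⁻¹(1/(1 - |z|)). The upper
bound is Jensen's inequality for the Poisson kernel (`HardyOrlicz.enorm_apply_le`); the lower bound
comes from the functions u_{a,r}, whose norm is at most 1/Ψ⁻¹(1/(1 - r)) (`norm_uElem_le`) and which
are at least 1/9 in modulus on a window of size 1 - r at a. So the least majorant of the functions f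
∘ φ* over the unit ball is comparable to Ψ⁻¹(R), and order boundedness into M^Ψ amounts to
integrability of all χ_B(R).

Boundedness of C_φ is Littlewood subordination: the Poisson–Jensen bound is composed with φ and
averaged by the mean value property. Boundary values come from Fatou's theorem, proved here through
a Lipschitz primitive.

Integrability implies the operator properties through `ChiFiniteIntegral.norm_compCLM_le`: where
|φ*| is near 1 the modular of f ∘ φ* is dominated by a tail of the integral of χ_B(R), and elsewhere
only the size of f on a compact disc matters. The unit ball is totally bounded for uniform
convergence on compact discs, whence compactness; the normalized u_{a,r} tend to 0 there, whence the
little-o condition.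

The return implications use Δ² in the form χ_A² ≤ χ_{αA} near infinity. From tail bounds to
integrability, the square makes a dyadic layer-cake sum geometric. From windows to tails, the
annulus is covered by O(1/h) windows, and the square absorbs the factor 1/h. The little-o condition
gives the window bound by Chebyshev's inequality.

Weak compactness gives the window bound by contradiction. If it fails, choose bumps Ψ⁻¹(1/(1 - r_k))
v_{a_k,r_k} on bad windows, with v² = u and Re v ≥ |v|² ≥ 0. Under Δ² their modulars at a fixed
scale tend to 0 as r → 1, so a sparse choice has partial sums bounded in H^Ψ. A weak cluster point g
of the images of the normalized sums lies in every closed convex set that eventually contains them.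
Hence Re g dominates a fixed multiple of every bump composed with φ, while g is a norm limit of
bounded functions. Approximating g by a bounded function bounds its modular at an arbitrarily small
scale, and Chebyshev's inequality contradicts the choice of the windows. -/

theorem integral_circleMeasure {E : Type*} [NormedAddCommGroup E] [NormedSpace ℝ E] (g : ℝ → E) :
    ∫ t, g t ∂circleMeasure = (2 * Real.pi)⁻¹ • ∫ t in (0)..(2 * Real.pi), g t := by
  rw [circleMeasure, integral_smul_measure, intervalIntegral.integral_of_le Real.two_pi_pos.le,
    ENNReal.toReal_inv, ENNReal.toReal_ofReal Real.two_pi_pos.le]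

theorem ae_circleMeasure_of_ae {p : ℝ → Prop} (h : ∀ᵐ t, p t) : ∀ᵐ t ∂circleMeasure, p t :=
  Measure.ae_smul_measure (ae_restrict_of_ae h) _

theorem integrable_circleMeasure_of_continuous {E : Type*} [NormedAddCommGroup E] {g : ℝ → E}
    (hg : Continuous g) : Integrable g circleMeasure := by
  rw [circleMeasure]
  refine Integrable.smul_measure ?_ (by simp [Real.pi_pos])
  exact (hg.integrableOn_Icc (a := 0) (b := 2 * Real.pi)).mono_set Ioc_subset_Icc_self

theorem circleMap_mem_unitBall {r : ℝ} (hr : r ∈ Ico (0 : ℝ) 1) (t : ℝ) :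
    circleMap 0 r t ∈ Metric.ball (0 : ℂ) 1 := by
  simp [abs_of_nonneg hr.1, hr.2]

/-- The Poisson kernel of the unit disc in the angular coordinate. -/
def discPoisson (z : ℂ) (t : ℝ) : ℝ := poissonKernel 0 z (circleMap 0 1 t)

section DiscPoisson

variable {z : ℂ}

theorem discPoisson_eq (z : ℂ) (t : ℝ) :
    discPoisson z t = (1 - ‖z‖ ^ 2) / ‖circleMap 0 1 t - z‖ ^ 2 := by
  simp [discPoisson, poissonKernel_def]

theorem one_sub_norm_le_norm_circleMap_sub (z : ℂ) (t : ℝ) :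
    1 - ‖z‖ ≤ ‖circleMap 0 1 t - z‖ := by
  have h := norm_sub_norm_le (circleMap 0 1 t) z
  simpa using h

theorem circleMap_sub_ne_zero (hz : z ∈ Metric.ball (0 : ℂ) 1) (t : ℝ) :
    circleMap 0 1 t - z ≠ 0 := by
  have h1 := one_sub_norm_le_norm_circleMap_sub z t
  have h2 : ‖z‖ < 1 := by simpa using hz
  exact norm_pos_iff.1 (by linarith)

theorem discPoisson_nonneg (hz : z ∈ Metric.ball (0 : ℂ) 1) (t : ℝ) : 0 ≤ discPoisson z t := by
  have h2 : ‖z‖ < 1 := by simpa using hz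
  rw [discPoisson_eq]
  have := norm_nonneg z
  exact div_nonneg (by nlinarith) (by positivity)

/-- Harnack's upper bound. It is uniform in t, and at z = φ(0) it becomes the norm bound for C_φ. -/
theorem discPoisson_le (hz : z ∈ Metric.ball (0 : ℂ) 1) (t : ℝ) :
    discPoisson z t ≤ (1 + ‖z‖) / (1 - ‖z‖) := by
  have h := re_herglotzRieszKernel_le (R := 1) (c := 0) (z := circleMap 0 1 t) (w := z)
    (by simp) hz
  simp only [sub_zero] at h
  rw [discPoisson, poissonKernel_eq_re_herglotzRieszKernel]
  simpa [herglotzRieszKernel_def] using h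

theorem discPoisson_eq_re (z : ℂ) (t : ℝ) :
    discPoisson z t = ((circleMap 0 1 t + z) / (circleMap 0 1 t - z)).re := by
  rw [discPoisson, poissonKernel_eq_re_herglotzRieszKernel]
  simp [herglotzRieszKernel_def]

theorem continuous_discPoisson (hz : z ∈ Metric.ball (0 : ℂ) 1) : Continuous (discPoisson z) := by
  have : discPoisson z = fun t => (1 - ‖z‖ ^ 2) / ‖circleMap 0 1 t - z‖ ^ 2 :=
    funext (discPoisson_eq z)
  rw [this]
  refine Continuous.div continuous_const
    (((continuous_circleMap 0 1).sub continuous_const).norm.pow 2) fun t => ?_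
  exact pow_ne_zero _ (norm_ne_zero_iff.2 (circleMap_sub_ne_zero hz t))

theorem integral_discPoisson_smul {f : ℂ → ℂ} (hf : DiffContOnCl ℂ f (Metric.ball 0 1))
    (hz : z ∈ Metric.ball (0 : ℂ) 1) :
    ∫ t, discPoisson z t • f (circleMap 0 1 t) ∂circleMeasure = f z := by
  rw [integral_circleMeasure, ← hf.circleAverage_poissonKernel_smul hz, Real.circleAverage_def]
  rfl

theorem integral_discPoisson (hz : z ∈ Metric.ball (0 : ℂ) 1) :
    ∫ t, discPoisson z t ∂circleMeasure = 1 := by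
  have h := integral_discPoisson_smul (f := fun _ => 1) diffContOnCl_const hz
  simp only [Complex.real_smul, mul_one] at h
  rw [integral_complex_ofReal] at h
  exact_mod_cast h

theorem diffContOnCl_comp_mul {f : ℂ → ℂ} (hf : DifferentiableOn ℂ f (Metric.ball 0 1)) {R : ℝ}
    (hR : R ∈ Ico (0 : ℝ) 1) : DiffContOnCl ℂ (fun w => f (R * w)) (Metric.ball 0 1) := by
  refine DifferentiableOn.diffContOnCl (hf.comp (by fun_prop) fun w hw => ?_)
  rw [closure_ball _ one_ne_zero] at hw
  have hw' : ‖w‖ ≤ 1 := by simpa using hw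
  simp only [mem_ball_zero_iff, norm_mul, Complex.norm_real, Real.norm_eq_abs, abs_of_nonneg hR.1]
  exact (mul_le_of_le_one_right hR.1 hw').trans_lt hR.2

theorem mul_circleMap_one (R t : ℝ) : (R : ℂ) * circleMap 0 1 t = circleMap 0 R t := by
  simp [circleMap]

/-- A dilate by R < 1 is continuous up to the circle, so Poisson's formula applies to it before any
boundary values are available. -/
theorem integral_discPoisson_smul_slice {f : ℂ → ℂ}
    (hf : DifferentiableOn ℂ f (Metric.ball 0 1)) {R : ℝ} (hR : R ∈ Ico (0 : ℝ) 1)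
    (hz : z ∈ Metric.ball (0 : ℂ) 1) :
    ∫ t, discPoisson z t • f (circleMap 0 R t) ∂circleMeasure = f (R * z) := by
  rw [← integral_discPoisson_smul (diffContOnCl_comp_mul hf hR) hz]
  simp_rw [mul_circleMap_one]

/-- For fixed t the kernel is the real part of a function analytic in z. Its composition with q is
therefore harmonic and has the mean value property. -/
theorem integral_discPoisson_comp {q : ℂ → ℂ} (hq : DifferentiableOn ℂ q (Metric.ball 0 1))
    (hmaps : MapsTo q (Metric.ball 0 1) (Metric.ball 0 1)) {r : ℝ} (hr : r ∈ Ico (0 : ℝ) 1)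
    (t : ℝ) :
    ∫ s, discPoisson (q (circleMap 0 r s)) t ∂circleMeasure = discPoisson (q 0) t := by
  set H : ℂ → ℂ := fun w => (circleMap 0 1 t + q w) / (circleMap 0 1 t - q w) with hH
  have hd : DifferentiableOn ℂ H (Metric.ball 0 1) :=
    ((differentiableOn_const _).add hq).div ((differentiableOn_const _).sub hq)
      fun w hw => circleMap_sub_ne_zero (hmaps hw) t
  have h1 : ∫ s, H (circleMap 0 r s) ∂circleMeasure = H 0 := by
    have hsub : closure (Metric.ball (0 : ℂ) |r|) ⊆ Metric.ball 0 1 := by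
      refine Metric.closure_ball_subset_closedBall.trans fun w hw => ?_
      have : ‖w‖ ≤ r := by simpa [abs_of_nonneg hr.1] using hw
      simpa using this.trans_lt hr.2
    have h2 := (hd.mono hsub).diffContOnCl.circleAverage
    rw [Real.circleAverage_def] at h2
    rw [integral_circleMeasure, h2]
  have h3 : Integrable (fun s => H (circleMap 0 r s)) circleMeasure :=
    integrable_circleMeasure_of_continuous (continuous_circle_slice hd hr)
  simp_rw [discPoisson_eq_re]
  have h4 := integral_re (𝕜 := ℂ) h3
  rw [h1] at h4
  exact h4

end DiscPoisson

/-! ### Jensen's inequality and subordination. -/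

namespace OrliczFunction

variable (Ψ : OrliczFunction)

theorem measurable_eval : Measurable Ψ.eval := Ψ.eval_strictMono.monotone.measurable

theorem eval_ofReal {x : ℝ} (hx : 0 ≤ x) : Ψ.eval (ENNReal.ofReal x) = ENNReal.ofReal (Ψ.toFun x) := by
  simp [eval, ENNReal.toReal_ofReal hx]

/-- Jensen's inequality for the Poisson measures. -/
theorem eval_poisson_le {z : ℂ} (hz : z ∈ Metric.ball (0 : ℂ) 1) {k : ℝ → ℂ}
    (hk : Integrable k circleMeasure) {C : ℝ≥0∞} (hC0 : C ≠ 0) (hC : C ≠ ⊤) :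
    Ψ.eval (‖∫ t, discPoisson z t • k t ∂circleMeasure‖ₑ / C) ≤
      ∫⁻ t, ENNReal.ofReal (discPoisson z t) * Ψ.eval (‖k t‖ₑ / C) ∂circleMeasure := by
  -- Jensen's inequality needs Ψ(|k|/C) integrable for the Poisson measure; when it is not, the
  -- right side is infinite.
  by_cases htop : ∫⁻ t, ENNReal.ofReal (discPoisson z t) * Ψ.eval (‖k t‖ₑ / C) ∂circleMeasure = ⊤
  · rw [htop]; exact le_top
  have hc : 0 < C.toReal := ENNReal.toReal_pos hC0 hC
  have hP := continuous_discPoisson hz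
  have hPm : Measurable fun t => ENNReal.ofReal (discPoisson z t) := hP.measurable.ennreal_ofReal
  set ν := circleMeasure.withDensity fun t => ENNReal.ofReal (discPoisson z t) with hν
  have hPint : Integrable (discPoisson z) circleMeasure := integrable_circleMeasure_of_continuous hP
  have hprob : IsProbabilityMeasure ν := by
    constructor
    rw [hν, withDensity_apply _ MeasurableSet.univ, Measure.restrict_univ,
      ← ofReal_integral_eq_lintegral_ofReal hPint (ae_of_all _ (discPoisson_nonneg hz)),
      integral_discPoisson hz, ENNReal.ofReal_one]
  set F : ℝ → ℝ := fun t => ‖k t‖ / C.toReal with hF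
  have hF0 : ∀ t, 0 ≤ F t := fun t => div_nonneg (norm_nonneg _) hc.le
  have hac : ν ≪ circleMeasure := withDensity_absolutelyContinuous _ _
  have heF : ∀ t, ‖k t‖ₑ / C = ENNReal.ofReal (F t) := fun t => by
    rw [hF, ENNReal.ofReal_div_of_pos hc, ENNReal.ofReal_toReal hC, ofReal_norm]
  have hev : ∀ t, Ψ.eval (‖k t‖ₑ / C) = ENNReal.ofReal (Ψ.toFun (F t)) := fun t => by
    rw [heF, Ψ.eval_ofReal (hF0 t)]
  have hkm : AEStronglyMeasurable k ν := hk.1.mono_ac hac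
  have hconv : ∀ G : ℝ → ℝ, ∫ t, G t ∂ν = ∫ t, discPoisson z t * G t ∂circleMeasure := fun G => by
    rw [hν, integral_withDensity_eq_integral_toReal_smul hPm (by simp)]
    simp [ENNReal.toReal_ofReal (discPoisson_nonneg hz _)]
  have hFi : Integrable F ν := by
    rw [hν, integrable_withDensity_iff_integrable_smul' hPm (by simp)]
    have : Integrable (fun t => discPoisson z t * F t) circleMeasure := by
      refine (hk.norm.div_const _).bdd_mul (c := (1 + ‖z‖) / (1 - ‖z‖)) hP.aestronglyMeasurable
        (ae_of_all _ fun t => ?_)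
      rw [Real.norm_of_nonneg (discPoisson_nonneg hz t)]
      exact discPoisson_le hz t
    simpa [ENNReal.toReal_ofReal (discPoisson_nonneg hz _)] using this
  have hΨFm : AEStronglyMeasurable (fun t => Ψ.toFun (F t)) ν := by
    have h1 : AEMeasurable (fun t => (Ψ.eval (‖k t‖ₑ / C)).toReal) ν :=
      (Ψ.measurable_eval.comp_aemeasurable (hkm.enorm.div_const C)).ennreal_toReal
    refine h1.aestronglyMeasurable.congr (ae_of_all _ fun t => ?_)
    simp only [hev, ENNReal.toReal_ofReal (Ψ.nonneg (hF0 t))]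
  have hlin : ∫⁻ t, ENNReal.ofReal (Ψ.toFun (F t)) ∂ν =
      ∫⁻ t, ENNReal.ofReal (discPoisson z t) * Ψ.eval (‖k t‖ₑ / C) ∂circleMeasure := by
    rw [hν, lintegral_withDensity_eq_lintegral_mul₀ hPm.aemeasurable]
    · simp [hev]
    · have := Ψ.measurable_eval.comp_aemeasurable (hk.1.enorm.div_const C)
      exact this.congr (ae_of_all _ hev)
  have hΨi : Integrable (fun t => Ψ.toFun (F t)) ν := by
    refine ⟨hΨFm, ?_⟩
    rw [hasFiniteIntegral_iff_ofReal (ae_of_all _ fun t => Ψ.nonneg (hF0 t)), hlin]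
    exact lt_top_iff_ne_top.2 htop
  have hJ := Ψ.strictConvexOn.convexOn.map_integral_le Ψ.continuousOn isClosed_Ici
    (ae_of_all ν fun t => mem_Ici.2 (hF0 t)) hFi hΨi
  have hnorm : ‖∫ t, discPoisson z t • k t ∂circleMeasure‖ₑ / C ≤ ENNReal.ofReal (∫ t, F t ∂ν) := by
    rw [← ofReal_norm, ← ENNReal.ofReal_toReal hC, ← ENNReal.ofReal_div_of_pos hc]
    refine ENNReal.ofReal_le_ofReal ?_
    rw [hconv, div_le_iff₀ hc, ← integral_mul_const]
    refine (norm_integral_le_integral_norm _).trans (le_of_eq (integral_congr_ae ?_))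
    refine ae_of_all _ fun t => ?_
    simp only [hF, norm_smul, Real.norm_of_nonneg (discPoisson_nonneg hz t)]
    field_simp
  calc _ ≤ Ψ.eval (ENNReal.ofReal (∫ t, F t ∂ν)) := Ψ.eval_strictMono.monotone hnorm
    _ = ENNReal.ofReal (Ψ.toFun (∫ t, F t ∂ν)) := Ψ.eval_ofReal (integral_nonneg hF0)
    _ ≤ ENNReal.ofReal (∫ t, Ψ.toFun (F t) ∂ν) := ENNReal.ofReal_le_ofReal hJ
    _ = _ := by
      rw [ofReal_integral_eq_lintegral_ofReal hΨi (ae_of_all _ fun t => Ψ.nonneg (hF0 t)), hlin]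

/-- The harmonic-majorant bound behind Littlewood's subordination principle. -/
theorem lintegral_eval_comp_le {h q : ℂ → ℂ} {k : ℝ → ℂ} (hk : Integrable k circleMeasure)
    (hrep : ∀ z ∈ Metric.ball (0 : ℂ) 1, ∫ t, discPoisson z t • k t ∂circleMeasure = h z)
    (hq : DifferentiableOn ℂ q (Metric.ball 0 1))
    (hmaps : MapsTo q (Metric.ball 0 1) (Metric.ball 0 1)) {r : ℝ} (hr : r ∈ Ico (0 : ℝ) 1)
    {C : ℝ≥0∞} (hC0 : C ≠ 0) (hC : C ≠ ⊤) :
    ∫⁻ s, Ψ.eval (‖h (q (circleMap 0 r s))‖ₑ / C) ∂circleMeasure ≤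
      ENNReal.ofReal ((1 + ‖q 0‖) / (1 - ‖q 0‖)) * ∫⁻ t, Ψ.eval (‖k t‖ₑ / C) ∂circleMeasure := by
  have hqb : ∀ s, q (circleMap 0 r s) ∈ Metric.ball (0 : ℂ) 1 :=
    fun s => hmaps (circleMap_mem_unitBall hr s)
  have hq0 : q 0 ∈ Metric.ball (0 : ℂ) 1 := hmaps (by simp)
  have hqc := continuous_circle_slice hq hr
  have hjc : Continuous fun p : ℝ × ℝ => discPoisson (q (circleMap 0 r p.1)) p.2 := by
    simp_rw [discPoisson_eq]
    refine Continuous.div ?_ ?_ fun p =>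
      pow_ne_zero _ (norm_ne_zero_iff.2 (circleMap_sub_ne_zero (hqb _) _))
    · exact continuous_const.sub ((hqc.comp continuous_fst).norm.pow 2)
    · exact (((continuous_circleMap 0 1).comp continuous_snd).sub
        (hqc.comp continuous_fst)).norm.pow 2
  have hkm : AEMeasurable (fun t => Ψ.eval (‖k t‖ₑ / C)) circleMeasure :=
    Ψ.measurable_eval.comp_aemeasurable (hk.1.enorm.div_const C)
  calc ∫⁻ s, Ψ.eval (‖h (q (circleMap 0 r s))‖ₑ / C) ∂circleMeasure
      ≤ ∫⁻ s, ∫⁻ t, ENNReal.ofReal (discPoisson (q (circleMap 0 r s)) t) *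
          Ψ.eval (‖k t‖ₑ / C) ∂circleMeasure ∂circleMeasure := by
        refine lintegral_mono fun s => ?_
        rw [← hrep _ (hqb s)]
        exact Ψ.eval_poisson_le (hqb s) hk hC0 hC
    _ = ∫⁻ t, ∫⁻ s, ENNReal.ofReal (discPoisson (q (circleMap 0 r s)) t) *
          Ψ.eval (‖k t‖ₑ / C) ∂circleMeasure ∂circleMeasure := by
        refine lintegral_lintegral_swap ?_
        have h1 : AEMeasurable (fun p : ℝ × ℝ => Ψ.eval (‖k p.2‖ₑ / C))
            (circleMeasure.prod circleMeasure) := hkm.comp_snd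
        have h2 : Measurable fun p : ℝ × ℝ =>
            ENNReal.ofReal (discPoisson (q (circleMap 0 r p.1)) p.2) :=
          hjc.measurable.ennreal_ofReal
        exact h2.aemeasurable.mul h1
    -- After Tonelli the inner average over the circle of radius r is a mean value of a harmonic
    -- function, so only q(0) remains.
    _ = ∫⁻ t, ENNReal.ofReal (discPoisson (q 0) t) * Ψ.eval (‖k t‖ₑ / C) ∂circleMeasure := by
        refine lintegral_congr fun t => ?_
        have hct : Continuous fun s => discPoisson (q (circleMap 0 r s)) t :=
          hjc.comp₂ continuous_id continuous_const
        rw [lintegral_mul_const _ hct.measurable.ennreal_ofReal,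
          ← ofReal_integral_eq_lintegral_ofReal (integrable_circleMeasure_of_continuous hct)
            (ae_of_all _ fun s => discPoisson_nonneg (hqb s) t),
          integral_discPoisson_comp hq hmaps hr]
    _ ≤ ∫⁻ t, ENNReal.ofReal ((1 + ‖q 0‖) / (1 - ‖q 0‖)) *
          Ψ.eval (‖k t‖ₑ / C) ∂circleMeasure := by
        refine lintegral_mono fun t => ?_
        gcongr
        exact discPoisson_le hq0 t
    _ = _ := lintegral_const_mul' _ _ ENNReal.ofReal_ne_top

end OrliczFunction
end

/-! ### Fatou's theorem on radial limits. -/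

noncomputable section

/-- The Poisson kernel of the unit disc in polar coordinates. -/
def polarPoisson (r s : ℝ) : ℝ := (1 - r ^ 2) / (1 - 2 * r * Real.cos s + r ^ 2)

/-- The angular derivative of the Poisson kernel. -/
def polarPoissonDeriv (r s : ℝ) : ℝ :=
  -(2 * r * Real.sin s * (1 - r ^ 2)) / (1 - 2 * r * Real.cos s + r ^ 2) ^ 2

theorem polarPoisson_denom_pos {r : ℝ} (hr : r ∈ Ico (0 : ℝ) 1) (s : ℝ) :
    0 < 1 - 2 * r * Real.cos s + r ^ 2 := by
  have h1 := Real.cos_le_one s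
  have h2 : 2 * r * Real.cos s ≤ 2 * r := mul_le_of_le_one_right (by linarith [hr.1]) h1
  nlinarith [hr.2]

theorem hasDerivAt_polarPoisson {r : ℝ} (hr : r ∈ Ico (0 : ℝ) 1) (s : ℝ) :
    HasDerivAt (polarPoisson r) (polarPoissonDeriv r s) s := by
  have hd := (polarPoisson_denom_pos hr s).ne'
  have h1 : HasDerivAt (fun s => 1 - 2 * r * Real.cos s + r ^ 2) (2 * r * Real.sin s) s := by
    have := (((Real.hasDerivAt_cos s).const_mul (2 * r)).const_sub 1).add_const (r ^ 2)
    exact this.congr_deriv (by ring)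
  have h2 := (hasDerivAt_const s (1 - r ^ 2)).div h1 hd
  exact h2.congr_deriv (by rw [polarPoissonDeriv]; ring)

theorem continuous_polarPoissonDeriv {r : ℝ} (hr : r ∈ Ico (0 : ℝ) 1) :
    Continuous (polarPoissonDeriv r) := by
  unfold polarPoissonDeriv
  exact Continuous.div (by fun_prop) (by fun_prop)
    fun s => pow_ne_zero _ (polarPoisson_denom_pos hr s).ne'

theorem discPoisson_circleMap (r θ s : ℝ) :
    discPoisson (circleMap 0 r θ) (θ + s) = polarPoisson r s := by
  have h : ‖circleMap 0 1 (θ + s) - circleMap 0 r θ‖ ^ 2 = 1 - 2 * r * Real.cos s + r ^ 2 := by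
    have e : circleMap 0 1 (θ + s) - circleMap 0 r θ =
        circleMap 0 1 θ * (Complex.exp (s * Complex.I) - r) := by
      simp only [circleMap, Complex.ofReal_add, add_mul, Complex.exp_add]
      push_cast
      ring
    rw [e, norm_mul, norm_circleMap_zero, abs_one, one_mul]
    rw [← Complex.normSq_eq_norm_sq, Complex.normSq_apply]
    simp only [Complex.sub_re, Complex.exp_ofReal_mul_I_re, Complex.ofReal_re, Complex.sub_im,
      Complex.exp_ofReal_mul_I_im, Complex.ofReal_im, sub_zero]
    nlinarith [Real.sin_sq_add_cos_sq s]
  rw [discPoisson_eq, h, polarPoisson]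
  simp

/-- Along a circle the angular derivative of F is i w φ(w). So this is Poisson's formula for w φ(w),
integrated by parts over a full period, where the end terms cancel. -/
theorem integral_polarPoissonDeriv_slice {F φ : ℂ → ℂ}
    (hφ : DifferentiableOn ℂ φ (Metric.ball 0 1))
    (hF : ∀ z ∈ Metric.ball (0 : ℂ) 1, HasDerivAt F (φ z) z) {r : ℝ} (hr : r ∈ Ico (0 : ℝ) 1)
    (θ : ℝ) {R : ℝ} (hR : R ∈ Ico (0 : ℝ) 1) :
    ∫ s in (-Real.pi)..Real.pi, (polarPoissonDeriv r s : ℂ) * F (circleMap 0 R (θ + s)) =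
      -(2 * Real.pi) * (Complex.I * (R * circleMap 0 r θ * φ (R * circleMap 0 r θ))) := by
  set z := circleMap 0 r θ with hz
  have hzb : z ∈ Metric.ball (0 : ℂ) 1 := circleMap_mem_unitBall hr θ
  set ψ : ℂ → ℂ := fun w => w * φ w with hψ
  have hψd : DifferentiableOn ℂ ψ (Metric.ball 0 1) := differentiableOn_id.mul hφ
  have hψc : Continuous fun t => ψ (circleMap 0 R t) := continuous_circle_slice hψd hR
  have hP := integral_discPoisson_smul_slice hψd hR hzb
  rw [integral_circleMeasure] at hP
  have hper : Function.Periodic (fun t => discPoisson z t • ψ (circleMap 0 R t))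
      (2 * Real.pi) := fun t => by
    simp only [discPoisson, periodic_circleMap 0 1 t, periodic_circleMap 0 R t]
  -- The period is recentred at θ, so that the kernel depends on s alone.
  have hshift : ∫ t in (0)..(2 * Real.pi), discPoisson z t • ψ (circleMap 0 R t) =
      ∫ s in (-Real.pi)..Real.pi, (polarPoisson r s : ℂ) * ψ (circleMap 0 R (θ + s)) := by
    have h1 := hper.intervalIntegral_add_eq 0 (θ - Real.pi)
    rw [zero_add] at h1
    rw [h1]
    have h2 := intervalIntegral.integral_comp_add_left (a := -Real.pi) (b := Real.pi)
      (fun t => discPoisson z t • ψ (circleMap 0 R t)) θ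
    rw [show θ - Real.pi = θ + -Real.pi by ring,
      show θ + -Real.pi + 2 * Real.pi = θ + Real.pi by ring, ← h2]
    refine intervalIntegral.integral_congr fun s _ => ?_
    simp only [hz, discPoisson_circleMap, Complex.real_smul]
  rw [hshift] at hP
  have hu : ∀ s ∈ uIcc (-Real.pi) Real.pi,
      HasDerivAt (fun s => (polarPoisson r s : ℂ)) (polarPoissonDeriv r s : ℂ) s :=
    fun s _ => (hasDerivAt_polarPoisson hr s).ofReal_comp
  have hv : ∀ s ∈ uIcc (-Real.pi) Real.pi, HasDerivAt (fun s => F (circleMap 0 R (θ + s)))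
      (Complex.I * ψ (circleMap 0 R (θ + s))) s := fun s _ => by
    have h1 := (hasDerivAt_circleMap 0 R (θ + s)).comp_const_add θ s
    have h2 := (hF _ (circleMap_mem_unitBall hR (θ + s))).comp s h1
    exact h2.congr_deriv (by simp only [hψ]; ring)
  have hparts := intervalIntegral.integral_mul_deriv_eq_deriv_mul hu hv
    ((Complex.continuous_ofReal.comp (continuous_polarPoissonDeriv hr)).intervalIntegrable _ _)
    ((continuous_const.mul (hψc.comp (continuous_const.add continuous_id))).intervalIntegrable _ _)
  have hend : circleMap 0 R (θ + Real.pi) = circleMap 0 R (θ + -Real.pi) := by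
    rw [← periodic_circleMap 0 R (θ + -Real.pi)]
    congr 1
    ring
  have hpend : polarPoisson r Real.pi = polarPoisson r (-Real.pi) := by simp [polarPoisson]
  rw [hend, hpend, sub_self, zero_sub] at hparts
  have h3 : ∫ s in (-Real.pi)..Real.pi,
      (polarPoisson r s : ℂ) * (Complex.I * ψ (circleMap 0 R (θ + s))) =
      Complex.I * ∫ s in (-Real.pi)..Real.pi,
        (polarPoisson r s : ℂ) * ψ (circleMap 0 R (θ + s)) := by
    rw [← intervalIntegral.integral_const_mul]
    refine intervalIntegral.integral_congr fun s _ => ?_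
    ring
  rw [h3] at hparts
  have h4 : ∫ s in (-Real.pi)..Real.pi, (polarPoisson r s : ℂ) * ψ (circleMap 0 R (θ + s)) =
      2 * Real.pi * ψ (R * z) := by
    rw [← hP, Complex.real_smul]
    push_cast
    rw [← mul_assoc, mul_inv_cancel₀, one_mul]
    exact_mod_cast Real.two_pi_pos.ne'
  rw [h4] at hparts
  simp only [hψ] at hparts
  linear_combination hparts

/-- Let R → 1 in the slice identity: F is continuous in the plane, and the point where φ is
evaluated stays inside the open disc. -/
theorem integral_polarPoissonDeriv {F φ : ℂ → ℂ} (hFc : Continuous F)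
    (hφ : DifferentiableOn ℂ φ (Metric.ball 0 1))
    (hF : ∀ z ∈ Metric.ball (0 : ℂ) 1, HasDerivAt F (φ z) z) {r : ℝ} (hr : r ∈ Ico (0 : ℝ) 1)
    (θ : ℝ) :
    ∫ s in (-Real.pi)..Real.pi, (polarPoissonDeriv r s : ℂ) * F (circleMap 0 1 (θ + s)) =
      -(2 * Real.pi) * (Complex.I * (circleMap 0 r θ * φ (circleMap 0 r θ))) := by
  have hzb : circleMap 0 r θ ∈ Metric.ball (0 : ℂ) 1 := circleMap_mem_unitBall hr θ
  have hpc := continuous_polarPoissonDeriv hr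
  have h1 : Continuous fun R : ℝ => ∫ s in (-Real.pi)..Real.pi,
      (polarPoissonDeriv r s : ℂ) * F (circleMap 0 R (θ + s)) := by
    refine intervalIntegral.continuous_parametric_intervalIntegral_of_continuous' ?_ _ _
    refine (Complex.continuous_ofReal.comp (hpc.comp continuous_snd)).mul (hFc.comp ?_)
    simp only [circleMap]
    fun_prop
  have h2 : ContinuousAt (fun R : ℝ => -(2 * Real.pi) *
      (Complex.I * (R * circleMap 0 r θ * φ (R * circleMap 0 r θ)))) 1 := by
    have h3 : ContinuousAt (fun R : ℝ => φ (R * circleMap 0 r θ)) 1 := by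
      refine ContinuousAt.comp (f := fun R : ℝ => (R : ℂ) * circleMap 0 r θ) (g := φ) ?_
        (Complex.continuous_ofReal.mul continuous_const).continuousAt
      simp only [Complex.ofReal_one, one_mul]
      exact hφ.continuousOn.continuousAt (Metric.isOpen_ball.mem_nhds hzb)
    have h4 : ContinuousAt (fun R : ℝ => (R : ℂ)) 1 := Complex.continuous_ofReal.continuousAt
    exact continuousAt_const.mul (continuousAt_const.mul ((h4.mul continuousAt_const).mul h3))
  have h4 := (h1.tendsto 1).mono_left (nhdsWithin_le_nhds (s := Iio 1))
  have h5 := h2.tendsto.mono_left (nhdsWithin_le_nhds (s := Iio 1))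
  have h6 := tendsto_nhds_unique (h4.congr' ?_) h5
  · simpa using h6
  · filter_upwards [Ioo_mem_nhdsLT (zero_lt_one' ℝ)] with R hR
    exact integral_polarPoissonDeriv_slice hφ hF hr θ ⟨hR.1.le, hR.2⟩

/-- The kernel has the sign opposite to sin s, so the absolute value only changes a sign and the
integral is read off from the identity for F = id. It says that sin s times the kernel has mass
bounded uniformly in r, although the kernel itself does not. -/
theorem integral_abs_polarPoissonDeriv_mul_sin {r : ℝ} (hr : r ∈ Ico (0 : ℝ) 1) :
    ∫ s in (-Real.pi)..Real.pi, |polarPoissonDeriv r s * Real.sin s| = 2 * Real.pi * r := by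
  have h := integral_polarPoissonDeriv (F := id) (φ := fun _ => 1) continuous_id
    (differentiableOn_const _) (fun z _ => hasDerivAt_id z) hr 0
  have hc := continuous_polarPoissonDeriv hr
  have hi : IntervalIntegrable (fun s => (polarPoissonDeriv r s : ℂ) * id (circleMap 0 1 (0 + s)))
      volume (-Real.pi) Real.pi := by
    refine Continuous.intervalIntegrable ?_ _ _
    exact (Complex.continuous_ofReal.comp hc).mul
      ((continuous_circleMap 0 1).comp (continuous_const.add continuous_id))
  have him := Complex.imCLM.intervalIntegral_comp_comm hi
  rw [h] at him
  have e1 : ∀ s : ℝ, Complex.imCLM ((polarPoissonDeriv r s : ℂ) * id (circleMap 0 1 (0 + s))) =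
      -|polarPoissonDeriv r s * Real.sin s| := fun s => by
    have hneg : polarPoissonDeriv r s * Real.sin s ≤ 0 := by
      rw [polarPoissonDeriv, div_mul_eq_mul_div]
      refine div_nonpos_of_nonpos_of_nonneg ?_ (by positivity)
      have h1 : 0 ≤ r * (1 - r ^ 2) := mul_nonneg hr.1 (by nlinarith [hr.1, hr.2])
      nlinarith [mul_nonneg h1 (sq_nonneg (Real.sin s))]
    rw [abs_of_nonpos hneg]
    simp [circleMap, Complex.exp_ofReal_mul_I_im]
  simp_rw [e1] at him
  rw [intervalIntegral.integral_neg] at him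
  have e2 : Complex.imCLM (-(2 * Real.pi) * (Complex.I * (circleMap 0 r 0 * 1))) =
      -(2 * Real.pi * r) := by
    simp [circleMap]
  rw [e2] at him
  linarith

/-- The denominator is (1 - r)² + 2r(1 - cos s), hence at least κ when r ≥ 1/2. Away from s = 0 the
kernel is thus O(1 - r). -/
theorem abs_polarPoissonDeriv_le {r : ℝ} (hr : r ∈ Ico (1 / 2 : ℝ) 1) {s κ : ℝ} (hκ : 0 < κ)
    (hs : κ ≤ 1 - Real.cos s) : |polarPoissonDeriv r s| ≤ 4 * (1 - r) / κ ^ 2 := by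
  have hd : κ ≤ 1 - 2 * r * Real.cos s + r ^ 2 := by
    nlinarith [hr.1, hr.2, sq_nonneg (1 - r)]
  have h1 : |-(2 * r * Real.sin s * (1 - r ^ 2))| ≤ 4 * (1 - r) := by
    rw [abs_neg, abs_mul, abs_mul, abs_of_nonneg (by linarith [hr.1] : 0 ≤ 2 * r),
      abs_of_nonneg (by nlinarith [hr.1, hr.2] : 0 ≤ 1 - r ^ 2)]
    have h2 := Real.abs_sin_le_one s
    have h3 : 2 * r * |Real.sin s| ≤ 2 * 1 := by
      have := abs_nonneg (Real.sin s)
      nlinarith [hr.1, hr.2]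
    have h4 : 1 - r ^ 2 ≤ 2 * (1 - r) := by nlinarith [hr.1, hr.2]
    calc _ ≤ 2 * 1 * (2 * (1 - r)) :=
          mul_le_mul h3 h4 (by nlinarith [hr.1, hr.2]) (by norm_num)
      _ = _ := by ring
  rw [polarPoissonDeriv, abs_div, abs_of_nonneg (by positivity :
    0 ≤ (1 - 2 * r * Real.cos s + r ^ 2) ^ 2)]
  exact div_le_div₀ (by linarith [hr.2]) h1 (by positivity) (by gcongr)

/-- If `F` has bounded derivative `φ` in the disc and its boundary function is differentiable at
the angle `θ`, then `φ` has a radial limit there. -/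
theorem tendsto_radial_of_hasDerivAt {F φ : ℂ → ℂ} (hFc : Continuous F)
    (hφ : DifferentiableOn ℂ φ (Metric.ball 0 1))
    (hF : ∀ z ∈ Metric.ball (0 : ℂ) 1, HasDerivAt F (φ z) z) {θ : ℝ} {lam : ℂ}
    (hd : HasDerivAt (fun t => F (circleMap 0 1 t)) (circleMap 0 1 θ * Complex.I * lam) θ) :
    Tendsto (fun r => φ (circleMap 0 r θ)) (𝓝[<] 1) (𝓝 lam) := by
  set ζ := circleMap 0 1 θ with hζ
  -- Subtracting the affine part reduces the claim to derivative 0 at ζ: E(ζe^{is}) = o(s), while E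
  -- has derivative φ - λ inside, to which the integral identity applies.
  set E : ℂ → ℂ := fun w => F w - F ζ - lam * (w - ζ) with hE
  have hEc : Continuous E := by fun_prop
  have hEd : ∀ z ∈ Metric.ball (0 : ℂ) 1, HasDerivAt E (φ z - lam) z := fun z hz => by
    have := ((hF z hz).sub_const (F ζ)).sub (((hasDerivAt_id z).sub_const ζ).const_mul lam)
    exact this.congr_deriv (by ring)
  have hφ' : DifferentiableOn ℂ (fun z => φ z - lam) (Metric.ball 0 1) := hφ.sub_const lam
  have hEb : HasDerivAt (fun t => E (circleMap 0 1 t)) 0 θ := by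
    have h1 := (hd.sub_const (F ζ)).sub
      (((hasDerivAt_circleMap 0 1 θ).sub_const ζ).const_mul lam)
    exact h1.congr_deriv (by rw [← hζ]; ring)
  have hEζ : E (circleMap 0 1 θ) = 0 := by simp [hE, ← hζ]
  obtain ⟨M, hM⟩ : ∃ M, ∀ t, ‖E (circleMap 0 1 t)‖ ≤ M := by
    obtain ⟨M, hM⟩ := (isCompact_sphere (0 : ℂ) 1).exists_bound_of_continuousOn hEc.continuousOn
    exact ⟨M, fun t => hM _ (by simp)⟩
  have hM0 : 0 ≤ M := (norm_nonneg _).trans (hM 0)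
  rw [Metric.tendsto_nhdsWithin_nhds]
  intro ε hε
  -- The factor 2/π anticipates Jordan's inequality |sin s| ≥ 2|s|/π, which turns the o(s) bound
  -- into (ε/8)|sin s| near 0.
  have hlo := (hasDerivAt_iff_isLittleO_nhds_zero.1 hEb).bound
    (show (0 : ℝ) < ε / 8 * (2 / Real.pi) by have := Real.pi_pos; positivity)
  obtain ⟨δ₀, hδ₀, hδ₀'⟩ := Metric.eventually_nhds_iff.1 hlo
  set δ := min δ₀ (Real.pi / 2) with hδdef
  have hδ : 0 < δ := lt_min hδ₀ (by linarith [Real.pi_pos])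
  have hδπ : δ ≤ Real.pi / 2 := min_le_right _ _
  set κ := 1 - Real.cos δ with hκdef
  have hκ : 0 < κ := by
    have := Real.cos_lt_cos_of_nonneg_of_le_pi le_rfl (by linarith [Real.pi_pos]) hδ
    rw [Real.cos_zero] at this
    linarith
  have hnear : ∀ s : ℝ, |s| < δ → ‖E (circleMap 0 1 (θ + s))‖ ≤ ε / 8 * |Real.sin s| := by
    intro s hs
    have h1 := hδ₀' (y := s) (by simpa using hs.trans_le (min_le_left _ _))
    simp only [hEζ, sub_zero, smul_zero, Real.norm_eq_abs] at h1
    refine h1.trans ?_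
    have h2 := Real.mul_abs_le_abs_sin (hs.le.trans hδπ)
    rw [mul_assoc]
    exact mul_le_mul_of_nonneg_left h2 (by linarith)
  -- The first entry forces r ≥ 1/2; the second makes the far part of the integrand at most ε/8.
  set η := min (1 / 2) (ε * κ ^ 2 / (32 * (M + 1))) with hη
  have hη0 : 0 < η := lt_min (by norm_num) (by positivity)
  refine ⟨η, hη0, fun r hr1 hrη => ?_⟩
  have hr1' : r < 1 := hr1
  have hrd : 1 - r < η := by
    rw [Real.dist_eq, abs_sub_comm, abs_of_pos (by linarith)] at hrη
    exact hrη
  have hrh : r ∈ Ico (1 / 2 : ℝ) 1 := ⟨by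
    have := hrd.trans_le (min_le_left _ _)
    linarith, hr1'⟩
  have hr : r ∈ Ico (0 : ℝ) 1 := ⟨by linarith [hrh.1], hr1'⟩
  have hpt : ∀ s ∈ Icc (-Real.pi) Real.pi,
      ‖(polarPoissonDeriv r s : ℂ) * E (circleMap 0 1 (θ + s))‖ ≤
        ε / 8 * |polarPoissonDeriv r s * Real.sin s| + ε / 8 := by
    intro s hs
    rw [norm_mul, Complex.norm_real, Real.norm_eq_abs]
    by_cases hsδ : |s| < δ
    · calc _ ≤ |polarPoissonDeriv r s| * (ε / 8 * |Real.sin s|) := by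
            gcongr; exact hnear s hsδ
        _ = ε / 8 * |polarPoissonDeriv r s * Real.sin s| := by rw [abs_mul]; ring
        _ ≤ _ := by linarith
    · have hcos : κ ≤ 1 - Real.cos s := by
        have h1 : Real.cos |s| ≤ Real.cos δ :=
          Real.cos_le_cos_of_nonneg_of_le_pi hδ.le (abs_le.2 hs) (not_lt.1 hsδ)
        rw [Real.cos_abs] at h1
        linarith
      have h2 := abs_polarPoissonDeriv_le hrh hκ hcos
      have h3 : 4 * (1 - r) / κ ^ 2 * M ≤ ε / 8 := by
        have h4 : 1 - r ≤ ε * κ ^ 2 / (32 * (M + 1)) := hrd.le.trans (min_le_right _ _)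
        rw [le_div_iff₀ (by positivity)] at h4
        rw [div_mul_eq_mul_div, div_le_iff₀ (by positivity)]
        nlinarith
      calc _ ≤ 4 * (1 - r) / κ ^ 2 * M :=
            mul_le_mul h2 (hM _) (norm_nonneg _) ((abs_nonneg _).trans h2)
        _ ≤ ε / 8 := h3
        _ ≤ _ := le_add_of_nonneg_left (by positivity)
  have hc := continuous_polarPoissonDeriv hr
  have hnormint : ‖∫ s in (-Real.pi)..Real.pi,
      (polarPoissonDeriv r s : ℂ) * E (circleMap 0 1 (θ + s))‖ ≤
      ε / 8 * (2 * Real.pi * r) + 2 * Real.pi * (ε / 8) := by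
    have hpi : -Real.pi ≤ Real.pi := by linarith [Real.pi_pos]
    have hci : Continuous fun s => ε / 8 * |polarPoissonDeriv r s * Real.sin s| := by fun_prop
    refine (intervalIntegral.norm_integral_le_of_norm_le hpi
      (g := fun s => ε / 8 * |polarPoissonDeriv r s * Real.sin s| + ε / 8)
      (ae_of_all _ fun s hs => hpt s (Ioc_subset_Icc_self hs)) ?_).trans (le_of_eq ?_)
    · exact (hci.add continuous_const).intervalIntegrable _ _
    · rw [intervalIntegral.integral_add (hci.intervalIntegrable _ _)
        (continuous_const.intervalIntegrable _ _), intervalIntegral.integral_const_mul,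
        integral_abs_polarPoissonDeriv_mul_sin hr, intervalIntegral.integral_const]
      simp only [smul_eq_mul]
      ring
  rw [integral_polarPoissonDeriv hEc hφ' hEd hr θ] at hnormint
  simp only [norm_mul, norm_neg, Complex.norm_I, one_mul, norm_circleMap_zero, Complex.norm_real,
    Real.norm_eq_abs, abs_of_pos Real.pi_pos, abs_of_nonneg hr.1] at hnormint
  rw [Complex.norm_ofNat] at hnormint
  rw [dist_eq_norm]
  have hn := norm_nonneg (φ (circleMap 0 r θ) - lam)
  have h6 : r * ‖φ (circleMap 0 r θ) - lam‖ ≤ ε / 4 := by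
    have h7 : 2 * Real.pi * (r * ‖φ (circleMap 0 r θ) - lam‖) ≤ 2 * Real.pi * (ε / 4) := by
      have : ε / 8 * (2 * Real.pi * r) ≤ ε / 8 * (2 * Real.pi * 1) := by
        have := Real.pi_pos
        gcongr
      linarith
    exact le_of_mul_le_mul_left h7 Real.two_pi_pos
  -- Dividing by r ≥ 1/2 leaves at most ε/2.
  nlinarith [hrh.1]

/-- **Fatou's theorem** for bounded analytic functions. -/
theorem ae_exists_radial_limit {φ : ℂ → ℂ} (hφ : DifferentiableOn ℂ φ (Metric.ball 0 1)) {M : ℝ≥0}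
    (hM : ∀ z ∈ Metric.ball (0 : ℂ) 1, ‖φ z‖₊ ≤ M) :
    ∀ᵐ t ∂circleMeasure, ∃ l, Tendsto (fun r => φ (circleMap 0 r t)) (𝓝[<] 1) (𝓝 l) := by
  -- A primitive of a bounded function is Lipschitz on the convex disc. Extended to a Lipschitz
  -- function on the plane, it has a Lipschitz boundary function, which is differentiable almost
  -- everywhere.
  obtain ⟨F₀, hF₀⟩ := hφ.isExactOn_ball
  have hlip : LipschitzOnWith M F₀ (Metric.ball 0 1) :=
    (convex_ball (0 : ℂ) 1).lipschitzOnWith_of_nnnorm_hasDerivWithin_le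
      (fun z hz => (hF₀ z hz).hasDerivWithinAt) hM
  obtain ⟨F, hF, hEq⟩ := hlip.extend_finite_dimension
  have hFd : ∀ z ∈ Metric.ball (0 : ℂ) 1, HasDerivAt F (φ z) z := fun z hz =>
    (hF₀ z hz).congr_of_eventuallyEq
      (eventually_of_mem (Metric.isOpen_ball.mem_nhds hz) fun w hw => (hEq hw).symm)
  have hG := (hF.comp (lipschitzWith_circleMap 0 1)).ae_differentiableAt_real
  refine ae_circleMeasure_of_ae (hG.mono fun θ hθ => ?_)
  have hne : circleMap 0 1 θ * Complex.I ≠ 0 := by simp [circleMap]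
  refine ⟨deriv (F ∘ circleMap 0 1) θ / (circleMap 0 1 θ * Complex.I), ?_⟩
  refine tendsto_radial_of_hasDerivAt hF.continuous hφ hFd ?_
  rw [mul_div_cancel₀ _ hne]
  exact hθ.hasDerivAt

end

/-! ### Growth of functions in H^Ψ and boundedness of composition operators. -/

noncomputable section

namespace OrliczFunction

variable (Ψ : OrliczFunction)

/-- `Ψ` as an order automorphism of `[0, ∞]`. -/
def evalIso : ℝ≥0∞ ≃o ℝ≥0∞ where
  toFun := Ψ.eval
  invFun := Ψ.inv
  left_inv := Ψ.inv_eval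
  right_inv := Ψ.eval_inv
  map_rel_iff' := Ψ.eval_strictMono.le_iff_le

theorem continuous_eval : Continuous Ψ.eval := Ψ.evalIso.continuous

theorem eval_mono : Monotone Ψ.eval := Ψ.eval_strictMono.monotone

theorem inv_strictMono : StrictMono Ψ.inv := Ψ.evalIso.symm.strictMono

theorem inv_mono : Monotone Ψ.inv := Ψ.inv_strictMono.monotone

theorem eval_le_iff_le_inv {x y : ℝ≥0∞} : Ψ.eval x ≤ y ↔ x ≤ Ψ.inv y :=
  Ψ.evalIso.le_symm_apply.symm

theorem eval_top : Ψ.eval ⊤ = ⊤ := by simp [eval]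

theorem inv_zero : Ψ.inv 0 = 0 := by
  have := Ψ.inv_eval 0
  rwa [Ψ.eval_zero] at this

theorem inv_top : Ψ.inv ⊤ = ⊤ := by
  have := Ψ.inv_eval ⊤
  rwa [Ψ.eval_top] at this

theorem eval_ne_top {x : ℝ≥0∞} (hx : x ≠ ⊤) : Ψ.eval x ≠ ⊤ := by
  rw [← Ψ.eval_top]; exact Ψ.eval_strictMono.injective.ne hx

theorem eval_ne_zero {x : ℝ≥0∞} (hx : x ≠ 0) : Ψ.eval x ≠ 0 := by
  rw [← Ψ.eval_zero]; exact Ψ.eval_strictMono.injective.ne hx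

theorem inv_ne_top {x : ℝ≥0∞} (hx : x ≠ ⊤) : Ψ.inv x ≠ ⊤ := by
  rw [← Ψ.inv_top]; exact Ψ.inv_strictMono.injective.ne hx

theorem inv_ne_zero {x : ℝ≥0∞} (hx : x ≠ 0) : Ψ.inv x ≠ 0 := by
  rw [← Ψ.inv_zero]; exact Ψ.inv_strictMono.injective.ne hx

theorem eval_mul_le {a : ℝ≥0∞} (ha : a ≤ 1) (x : ℝ≥0∞) : Ψ.eval (a * x) ≤ a * Ψ.eval x := by
  have h := Ψ.eval_convex (x := x) (y := 0) (add_tsub_cancel_of_le ha)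
  simpa [Ψ.eval_zero] using h

/-- Concavity of Ψ⁻¹: convexity and Ψ(0) = 0 give Ψ(c x) ≥ c Ψ(x) for c ≥ 1. -/
theorem inv_mul_le {c : ℝ≥0∞} (hc : 1 ≤ c) (hct : c ≠ ⊤) (y : ℝ≥0∞) :
    Ψ.inv (c * y) ≤ c * Ψ.inv y := by
  have h0 : c ≠ 0 := (zero_lt_one.trans_le hc).ne'
  rw [← Ψ.eval_strictMono.le_iff_le, Ψ.eval_inv]
  have h := Ψ.eval_mul_le (ENNReal.inv_le_one.2 hc) (c * Ψ.inv y)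
  rw [← mul_assoc, ENNReal.inv_mul_cancel h0 hct, one_mul, Ψ.eval_inv] at h
  calc c * y ≤ c * (c⁻¹ * Ψ.eval (c * Ψ.inv y)) := by gcongr
    _ = _ := by rw [← mul_assoc, ENNReal.mul_inv_cancel h0 hct, one_mul]

theorem eval_add_le (x y : ℝ≥0∞) : Ψ.eval (x + y) ≤ Ψ.eval (2 * x) + Ψ.eval (2 * y) := by
  have h := Ψ.eval_convex (a := 2⁻¹) (b := 2⁻¹) (x := 2 * x) (y := 2 * y)
    (ENNReal.inv_two_add_inv_two)
  rw [← mul_assoc, ← mul_assoc, ENNReal.inv_mul_cancel two_ne_zero ENNReal.ofNat_ne_top, one_mul,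
    one_mul] at h
  refine h.trans (add_le_add ?_ ?_) <;> exact mul_le_of_le_one_left' (by simp)

/-- Fatou's lemma for the modular. -/
theorem lintegral_eval_le_of_tendsto {k : ℕ → ℝ → ℂ} {l : ℝ → ℂ} {C K : ℝ≥0∞} (hC : C ≠ 0)
    (hk : ∀ n, AEStronglyMeasurable (k n) circleMeasure)
    (hl : ∀ᵐ t ∂circleMeasure, Tendsto (fun n => k n t) atTop (𝓝 (l t)))
    (hK : ∀ n, ∫⁻ t, Ψ.eval (‖k n t‖ₑ / C) ∂circleMeasure ≤ K) :
    ∫⁻ t, Ψ.eval (‖l t‖ₑ / C) ∂circleMeasure ≤ K := by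
  have hcont : Continuous fun x : ℂ => Ψ.eval (‖x‖ₑ / C) :=
    Ψ.continuous_eval.comp ((ENNReal.continuous_div_const C hC).comp continuous_enorm)
  calc ∫⁻ t, Ψ.eval (‖l t‖ₑ / C) ∂circleMeasure
      = ∫⁻ t, liminf (fun n => Ψ.eval (‖k n t‖ₑ / C)) atTop ∂circleMeasure := by
        refine lintegral_congr_ae (hl.mono fun t ht => ?_)
        exact ((hcont.tendsto _).comp ht).liminf_eq.symm
    _ ≤ liminf (fun n => ∫⁻ t, Ψ.eval (‖k n t‖ₑ / C) ∂circleMeasure) atTop :=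
        lintegral_liminf_le' fun n =>
          Ψ.measurable_eval.comp_aemeasurable ((hk n).enorm.div_const C)
    _ ≤ K := liminf_le_of_frequently_le' (Frequently.of_forall hK)

end OrliczFunction

/-- A sequence of radii increasing to `1`. -/
def radSeq (n : ℕ) : ℝ := 1 - 1 / (n + 1)

theorem radSeq_mem (n : ℕ) : radSeq n ∈ Ico (0 : ℝ) 1 := by
  have h : (0 : ℝ) < n + 1 := by positivity
  have h1 : 1 / ((n : ℝ) + 1) ≤ 1 := by
    rw [div_le_one h]
    linarith [(Nat.cast_nonneg n : (0 : ℝ) ≤ n)]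
  have h2 : 0 < 1 / ((n : ℝ) + 1) := by positivity
  exact ⟨by unfold radSeq; linarith, by unfold radSeq; linarith⟩

theorem tendsto_radSeq : Tendsto radSeq atTop (𝓝[<] 1) := by
  refine tendsto_nhdsWithin_iff.2 ⟨?_, Eventually.of_forall fun n => (radSeq_mem n).2⟩
  have h := (tendsto_one_div_add_atTop_nhds_zero_nat (𝕜 := ℝ)).const_sub 1
  rwa [sub_zero] at h

section Luxemburg

variable {Ψ : OrliczFunction} {f : ℝ → ℂ} {C : ℝ≥0∞}

theorem lintegral_eval_le_one_of_luxemburgNorm_lt (h : luxemburgNorm Ψ f < C) :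
    ∫⁻ t, Ψ.eval (‖f t‖ₑ / C) ∂circleMeasure ≤ 1 := by
  obtain ⟨D, ⟨-, hD⟩, hDC⟩ := sInf_lt_iff.1 h
  refine le_trans (lintegral_mono fun t => Ψ.eval_mono ?_) hD
  exact ENNReal.div_le_div_left hDC.le _

/-- Since Ψ(x/K) ≤ Ψ(x)/K for K ≥ 1, a modular bound K costs only a factor K in the norm. -/
theorem luxemburgNorm_le_of_lintegral_le {K : ℝ≥0∞} (hC : C ≠ 0) (hK : 1 ≤ K)
    (hKt : K ≠ ⊤) (h : ∫⁻ t, Ψ.eval (‖f t‖ₑ / C) ∂circleMeasure ≤ K) :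
    luxemburgNorm Ψ f ≤ K * C := by
  have hK0 : K ≠ 0 := (zero_lt_one.trans_le hK).ne'
  refine sInf_le ⟨pos_iff_ne_zero.2 (mul_ne_zero hK0 hC), ?_⟩
  calc ∫⁻ t, Ψ.eval (‖f t‖ₑ / (K * C)) ∂circleMeasure
      ≤ ∫⁻ t, K⁻¹ * Ψ.eval (‖f t‖ₑ / C) ∂circleMeasure := by
        refine lintegral_mono fun t => ?_
        have h1 := Ψ.eval_mul_le (ENNReal.inv_le_one.2 hK) (‖f t‖ₑ / C)
        convert h1 using 2
        rw [div_eq_mul_inv, div_eq_mul_inv, ENNReal.mul_inv (Or.inl hK0) (Or.inl hKt)]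
        ring
    _ = K⁻¹ * ∫⁻ t, Ψ.eval (‖f t‖ₑ / C) ∂circleMeasure :=
        lintegral_const_mul' _ _ (ENNReal.inv_ne_top.2 hK0)
    _ ≤ K⁻¹ * K := by gcongr
    _ = 1 := ENNReal.inv_mul_cancel hK0 hKt

end Luxemburg

namespace HardyOrlicz

variable {Ψ : OrliczFunction}

theorem differentiableOn (f : HardyOrlicz Ψ) : DifferentiableOn ℂ f (Metric.ball 0 1) := f.2.1

theorem hardyOrliczENorm_eq (f : HardyOrlicz Ψ) :
    hardyOrliczENorm Ψ f = ENNReal.ofReal ‖f‖ := by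
  rw [norm_def, ENNReal.ofReal_toReal f.2.2.2.ne]

theorem lintegral_eval_slice_le_one {f : HardyOrlicz Ψ} {c : ℝ} (hc : ‖f‖ < c) {r : ℝ}
    (hr : r ∈ Ico (0 : ℝ) 1) :
    ∫⁻ t, Ψ.eval (‖f (circleMap 0 r t)‖ₑ / ENNReal.ofReal c) ∂circleMeasure ≤ 1 := by
  refine lintegral_eval_le_one_of_luxemburgNorm_lt ?_
  calc luxemburgNorm Ψ (fun t => f (circleMap 0 r t)) ≤ hardyOrliczENorm Ψ f :=
        le_iSup₂ (f := fun r (_ : r ∈ Ico (0 : ℝ) 1) =>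
          luxemburgNorm Ψ fun t => f (circleMap 0 r t)) r hr
    _ < ENNReal.ofReal c := by
        rw [hardyOrliczENorm_eq]
        exact (ENNReal.ofReal_lt_ofReal_iff ((norm_nonneg f).trans_lt hc)).2 hc

theorem norm_le_of_lintegral_le {f : HardyOrlicz Ψ} {c K : ℝ} (hc : 0 < c) (hK : 1 ≤ K)
    (h : ∀ r ∈ Ico (0 : ℝ) 1, ∫⁻ t, Ψ.eval (‖f (circleMap 0 r t)‖ₑ / ENNReal.ofReal c)
      ∂circleMeasure ≤ ENNReal.ofReal K) : ‖f‖ ≤ K * c := by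
  rw [norm_def]
  refine ENNReal.toReal_le_of_le_ofReal (by positivity) ?_
  rw [ENNReal.ofReal_mul (by positivity)]
  refine iSup₂_le fun r hr => luxemburgNorm_le_of_lintegral_le (by simpa using hc)
    (by simpa using hK) ENNReal.ofReal_ne_top (h r hr)

theorem integrable_slice (f : HardyOrlicz Ψ) {r : ℝ} (hr : r ∈ Ico (0 : ℝ) 1) :
    Integrable (fun t => f (circleMap 0 r t)) circleMeasure :=
  integrable_circleMeasure_of_continuous (continuous_circle_slice f.differentiableOn hr)

/-- Radial continuity inside the disc. -/
theorem tendsto_apply_radSeq_mul (f : HardyOrlicz Ψ) {z : ℂ} (hz : z ∈ Metric.ball (0 : ℂ) 1) :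
    Tendsto (fun n => f (radSeq n * z)) atTop (𝓝 (f z)) := by
  have h1 : ContinuousAt f z :=
    f.differentiableOn.continuousOn.continuousAt (Metric.isOpen_ball.mem_nhds hz)
  refine h1.tendsto.comp ?_
  have h2 : Tendsto (fun n => (radSeq n : ℂ)) atTop (𝓝 1) := by
    have := (tendsto_nhds_of_tendsto_nhdsWithin tendsto_radSeq)
    exact_mod_cast (Complex.continuous_ofReal.tendsto 1).comp this
  simpa using h2.mul_const z

/-- Subordination is applied to dilates of f, whose boundary functions are slices of modular at most
1, and Fatou's lemma removes the dilation. -/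
theorem lintegral_eval_comp_le {q : ℂ → ℂ} (hq : DifferentiableOn ℂ q (Metric.ball 0 1))
    (hmaps : MapsTo q (Metric.ball 0 1) (Metric.ball 0 1)) {f : HardyOrlicz Ψ} {c : ℝ}
    (hc : ‖f‖ < c) {r : ℝ} (hr : r ∈ Ico (0 : ℝ) 1) :
    ∫⁻ t, Ψ.eval (‖f (q (circleMap 0 r t))‖ₑ / ENNReal.ofReal c) ∂circleMeasure ≤
      ENNReal.ofReal ((1 + ‖q 0‖) / (1 - ‖q 0‖)) := by
  have hc0 : ENNReal.ofReal c ≠ 0 := by simpa using (norm_nonneg f).trans_lt hc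
  refine Ψ.lintegral_eval_le_of_tendsto
    (k := fun n t => f (radSeq n * q (circleMap 0 r t))) hc0 (fun n => ?_) (ae_of_all _ fun t =>
      f.tendsto_apply_radSeq_mul (hmaps (circleMap_mem_unitBall hr t))) fun n => ?_
  · have hd : DifferentiableOn ℂ (fun w => f (radSeq n * q w)) (Metric.ball 0 1) :=
      (diffContOnCl_comp_mul f.differentiableOn (radSeq_mem n)).differentiableOn.comp hq hmaps
    exact (continuous_circle_slice hd hr).aestronglyMeasurable
  · refine (Ψ.lintegral_eval_comp_le (h := fun w => f (radSeq n * w))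
      (f.integrable_slice (radSeq_mem n))
      (fun z hz => integral_discPoisson_smul_slice f.differentiableOn (radSeq_mem n) hz)
      hq hmaps hr hc0 ENNReal.ofReal_ne_top).trans ?_
    exact mul_le_of_le_one_right' (lintegral_eval_slice_le_one hc (radSeq_mem n))

end HardyOrlicz

theorem one_div_one_sub_enorm {z : ℂ} (hz : z ∈ Metric.ball (0 : ℂ) 1) :
    1 / (1 - ‖z‖ₑ) = ENNReal.ofReal (1 / (1 - ‖z‖)) := by
  have h : ‖z‖ < 1 := by simpa using hz
  rw [ENNReal.ofReal_div_of_pos (by linarith), ENNReal.ofReal_one,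
    ENNReal.ofReal_sub _ (norm_nonneg z), ENNReal.ofReal_one, ofReal_norm]

theorem one_div_one_sub_enorm_ne_top {z : ℂ} (hz : z ∈ Metric.ball (0 : ℂ) 1) :
    1 / (1 - ‖z‖ₑ) ≠ ⊤ := by
  rw [one_div_one_sub_enorm hz]; exact ENNReal.ofReal_ne_top

namespace HardyOrlicz

variable {Ψ : OrliczFunction}

/-- The growth bound for point evaluations. -/
theorem enorm_apply_le (f : HardyOrlicz Ψ) {z : ℂ} (hz : z ∈ Metric.ball (0 : ℂ) 1) :
    ‖f z‖ₑ ≤ ENNReal.ofReal (4 * ‖f‖) * Ψ.inv (1 / (1 - ‖z‖ₑ)) := by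
  rcases eq_or_ne f 0 with rfl | hf
  · have : (0 : HardyOrlicz Ψ) z = 0 := rfl
    rw [this]
    simp
  have hf0 : 0 < ‖f‖ := norm_pos_iff.2 hf
  have hz1 : ‖z‖ < 1 := by simpa using hz
  -- Any c > ‖f‖ makes the slice modulars at most 1. This factor 2, and the 2 from 1 + |z| ≤ 2, make
  -- up the final 4.
  set c := 2 * ‖f‖ with hc
  have hcf : ‖f‖ < c := by linarith
  have hc0 : ENNReal.ofReal c ≠ 0 := by simpa [hc] using hf
  set Q := ENNReal.ofReal ((1 + ‖z‖) / (1 - ‖z‖)) with hQ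
  have hn : ∀ n, ‖f (radSeq n * z)‖ₑ ≤ ENNReal.ofReal c * Ψ.inv Q := fun n => by
    have h1 := Ψ.eval_poisson_le hz (f.integrable_slice (radSeq_mem n)) hc0 ENNReal.ofReal_ne_top
    rw [integral_discPoisson_smul_slice f.differentiableOn (radSeq_mem n) hz] at h1
    have h2 : Ψ.eval (‖f (radSeq n * z)‖ₑ / ENNReal.ofReal c) ≤ Q := by
      refine h1.trans ?_
      calc _ ≤ ∫⁻ t, Q * Ψ.eval (‖f (circleMap 0 (radSeq n) t)‖ₑ / ENNReal.ofReal c)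
            ∂circleMeasure := by
            refine lintegral_mono fun t => ?_
            exact mul_le_mul_left (ENNReal.ofReal_le_ofReal (discPoisson_le hz t)) _
        _ = Q * ∫⁻ t, Ψ.eval (‖f (circleMap 0 (radSeq n) t)‖ₑ / ENNReal.ofReal c)
            ∂circleMeasure := lintegral_const_mul' _ _ ENNReal.ofReal_ne_top
        _ ≤ Q := mul_le_of_le_one_right' (lintegral_eval_slice_le_one hcf (radSeq_mem n))
    rw [Ψ.eval_le_iff_le_inv] at h2
    exact (ENNReal.div_le_iff' hc0 ENNReal.ofReal_ne_top).1 h2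
  have hlim : ‖f z‖ₑ ≤ ENNReal.ofReal c * Ψ.inv Q :=
    le_of_tendsto ((continuous_enorm.tendsto _).comp (f.tendsto_apply_radSeq_mul hz))
      (Eventually.of_forall hn)
  have hQ2 : Q ≤ 2 * (1 / (1 - ‖z‖ₑ)) := by
    rw [one_div_one_sub_enorm hz, ← ENNReal.ofReal_ofNat, ← ENNReal.ofReal_mul (by norm_num), hQ]
    refine ENNReal.ofReal_le_ofReal ?_
    rw [mul_one_div]
    exact div_le_div_of_nonneg_right (by linarith) (by linarith)
  calc ‖f z‖ₑ ≤ ENNReal.ofReal c * Ψ.inv Q := hlim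
    _ ≤ ENNReal.ofReal c * (2 * Ψ.inv (1 / (1 - ‖z‖ₑ))) := by
        gcongr
        exact (Ψ.inv_mono hQ2).trans (Ψ.inv_mul_le (by norm_num) (by norm_num) _)
    _ = _ := by
        rw [← mul_assoc, ← ENNReal.ofReal_ofNat, ← ENNReal.ofReal_mul (by positivity), hc]
        congr 2
        ring

/-- The growth rate `Ψ⁻¹(1 / (1 - R))` as a real number. -/
def growth (Ψ : OrliczFunction) (R : ℝ) : ℝ := (Ψ.inv (ENNReal.ofReal (1 / (1 - R)))).toReal

theorem growth_nonneg (Ψ : OrliczFunction) (R : ℝ) : 0 ≤ growth Ψ R := ENNReal.toReal_nonneg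

theorem norm_apply_le (f : HardyOrlicz Ψ) {z : ℂ} {R : ℝ} (hR : R < 1) (hz : ‖z‖ ≤ R) :
    ‖f z‖ ≤ 4 * growth Ψ R * ‖f‖ := by
  have hzb : z ∈ Metric.ball (0 : ℂ) 1 := by simpa using hz.trans_lt hR
  have h1 := f.enorm_apply_le hzb
  rw [one_div_one_sub_enorm hzb] at h1
  have hmono : ENNReal.ofReal (1 / (1 - ‖z‖)) ≤ ENNReal.ofReal (1 / (1 - R)) :=
    ENNReal.ofReal_le_ofReal (one_div_le_one_div_of_le (by linarith) (by linarith))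
  have h2 := h1.trans (mul_le_mul_right (Ψ.inv_mono hmono) _)
  have hne : Ψ.inv (ENNReal.ofReal (1 / (1 - R))) ≠ ⊤ := Ψ.inv_ne_top ENNReal.ofReal_ne_top
  rw [← ENNReal.ofReal_toReal hne, ← ENNReal.ofReal_mul (by positivity), ← ofReal_norm] at h2
  have h3 := (ENNReal.ofReal_le_ofReal_iff (by positivity)).1 h2
  rw [growth]
  linarith

/-- Point evaluation as a continuous functional. -/
def evalCLM (Ψ : OrliczFunction) (z : ℂ) (hz : z ∈ Metric.ball (0 : ℂ) 1) : HardyOrlicz Ψ →L[ℂ] ℂ :=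
  LinearMap.mkContinuous
    { toFun := fun f => f z
      map_add' := fun _ _ => rfl
      map_smul' := fun _ _ => rfl }
    (4 * growth Ψ ‖z‖) fun f => f.norm_apply_le (by simpa using hz) le_rfl

theorem sub_apply (f g : HardyOrlicz Ψ) (z : ℂ) : (f - g) z = f z - g z := rfl

theorem smul_apply (c : ℂ) (f : HardyOrlicz Ψ) (z : ℂ) : (c • f) z = c * f z := rfl

/-- An analytic function with a modular bound on every slice, as an element of `H^Ψ`. -/
def ofModular (Ψ : OrliczFunction) (f : ℂ → ℂ) (hf : DifferentiableOn ℂ f (Metric.ball 0 1))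
    {c K : ℝ} (hc : 0 < c) (hK : 1 ≤ K) (h : ∀ r ∈ Ico (0 : ℝ) 1,
      ∫⁻ t, Ψ.eval (‖f (circleMap 0 r t)‖ₑ / ENNReal.ofReal c) ∂circleMeasure ≤ ENNReal.ofReal K) :
    HardyOrlicz Ψ :=
  ⟨(Metric.ball (0 : ℂ) 1).indicator f, hf.congr fun _ hz => indicator_of_mem hz f,
    fun _ hz => indicator_of_notMem hz f, by
      refine lt_of_le_of_lt (b := ENNReal.ofReal K * ENNReal.ofReal c) ?_
        (ENNReal.mul_lt_top ENNReal.ofReal_lt_top ENNReal.ofReal_lt_top)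
      refine iSup₂_le fun r hr => luxemburgNorm_le_of_lintegral_le (by simpa using hc)
        (by simpa using hK) ENNReal.ofReal_ne_top ?_
      refine le_trans (le_of_eq (lintegral_congr fun t => ?_)) (h r hr)
      rw [indicator_of_mem (circleMap_mem_unitBall hr t)]⟩

theorem ofModular_apply {f : ℂ → ℂ} (hf : DifferentiableOn ℂ f (Metric.ball 0 1))
    {c K : ℝ} (hc : 0 < c) (hK : 1 ≤ K) (h : ∀ r ∈ Ico (0 : ℝ) 1,
      ∫⁻ t, Ψ.eval (‖f (circleMap 0 r t)‖ₑ / ENNReal.ofReal c) ∂circleMeasure ≤ ENNReal.ofReal K)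
    {z : ℂ} (hz : z ∈ Metric.ball (0 : ℂ) 1) : ofModular Ψ f hf hc hK h z = f z :=
  indicator_of_mem hz f

theorem one_le_distortion {w : ℂ} (hw : w ∈ Metric.ball (0 : ℂ) 1) :
    1 ≤ (1 + ‖w‖) / (1 - ‖w‖) := by
  have h : ‖w‖ < 1 := by simpa using hw
  rw [le_div_iff₀ (by linarith)]
  linarith [norm_nonneg w]

theorem ext_on_ball {f g : HardyOrlicz Ψ} (h : ∀ z ∈ Metric.ball (0 : ℂ) 1, f z = g z) : f = g := by
  apply Subtype.ext
  funext z
  by_cases hz : z ∈ Metric.ball (0 : ℂ) 1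
  · exact h z hz
  · exact (f.2.2.1 z hz).trans (g.2.2.1 z hz).symm

section Composition

variable {φ : ℂ → ℂ} (hφ : DifferentiableOn ℂ φ (Metric.ball 0 1))
  (hmaps : MapsTo φ (Metric.ball 0 1) (Metric.ball 0 1))

/-- `f ∘ φ` as an element of `H^Ψ`. -/
def comp (f : HardyOrlicz Ψ) : HardyOrlicz Ψ :=
  -- Only c > ‖f‖ is needed; adding 1 covers f = 0.
  ofModular Ψ (fun z => f (φ z)) (f.differentiableOn.comp hφ hmaps)
    (c := ‖f‖ + 1) (by positivity) (one_le_distortion (hmaps (by simp : (0 : ℂ) ∈ _)))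
    fun _ hr => lintegral_eval_comp_le hφ hmaps (by linarith) hr

theorem comp_apply (f : HardyOrlicz Ψ) {z : ℂ} (hz : z ∈ Metric.ball (0 : ℂ) 1) :
    comp hφ hmaps f z = f (φ z) := ofModular_apply _ _ _ _ hz

/-- The composition operator `C_φ` on `H^Ψ`. -/
def compCLM : HardyOrlicz Ψ →L[ℂ] HardyOrlicz Ψ :=
  LinearMap.mkContinuous
    { toFun := comp hφ hmaps
      map_add' := fun f g => ext_on_ball fun z hz => by
        rw [comp_apply hφ hmaps _ hz]
        change f (φ z) + g (φ z) = comp hφ hmaps f z + comp hφ hmaps g z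
        rw [comp_apply hφ hmaps _ hz, comp_apply hφ hmaps _ hz]
      map_smul' := fun c f => ext_on_ball fun z hz => by
        rw [comp_apply hφ hmaps _ hz]
        change c * f (φ z) = c * comp hφ hmaps f z
        rw [comp_apply hφ hmaps _ hz] }
    ((1 + ‖φ 0‖) / (1 - ‖φ 0‖)) fun f => by
      have hK := one_le_distortion (hmaps (by simp : (0 : ℂ) ∈ Metric.ball (0 : ℂ) 1))
      -- For each d above the claimed bound, the modular estimate is used at scale d divided by the
      -- distortion constant, because it needs a scale strictly larger than ‖f‖.
      refine le_of_forall_gt_imp_ge_of_dense fun d hd => ?_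
      have hK0 : 0 < (1 + ‖φ 0‖) / (1 - ‖φ 0‖) := by linarith
      have hc : ‖f‖ < d / ((1 + ‖φ 0‖) / (1 - ‖φ 0‖)) := by
        rw [lt_div_iff₀ hK0, mul_comm]; exact hd
      have h := norm_le_of_lintegral_le (f := comp hφ hmaps f) ((norm_nonneg f).trans_lt hc) hK
        fun r hr => by
          refine le_trans (le_of_eq (lintegral_congr fun t => ?_))
            (lintegral_eval_comp_le hφ hmaps hc hr)
          rw [comp_apply hφ hmaps f (circleMap_mem_unitBall hr t)]
      rwa [mul_div_cancel₀ _ hK0.ne'] at h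

theorem compCLM_apply (f : HardyOrlicz Ψ) {z : ℂ} (hz : z ∈ Metric.ball (0 : ℂ) 1) :
    compCLM hφ hmaps f z = f (φ z) := comp_apply hφ hmaps f hz

end Composition

end HardyOrlicz
end

/-! ### Condition Δ² and the distribution of |φ*|. -/

noncomputable section

namespace OrliczFunction

variable (Ψ : OrliczFunction)

theorem chi_mono_right (K : ℝ≥0∞) : Monotone (Ψ.chi K) := fun _ _ h =>
  Ψ.eval_mono (mul_le_mul_right (Ψ.inv_mono h) _)

theorem chi_mono_left (x : ℝ≥0∞) : Monotone fun K => Ψ.chi K x := fun _ _ h =>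
  Ψ.eval_mono (mul_le_mul_left h _)

theorem measurable_chi (K : ℝ≥0∞) : Measurable (Ψ.chi K) := (Ψ.chi_mono_right K).measurable

theorem chi_ne_top {K : ℝ≥0} {x : ℝ≥0∞} (hx : x ≠ ⊤) : Ψ.chi K x ≠ ⊤ :=
  Ψ.eval_ne_top (ENNReal.mul_ne_top ENNReal.coe_ne_top (Ψ.inv_ne_top hx))

theorem chi_ne_zero {K : ℝ≥0} (hK : 0 < K) {x : ℝ≥0∞} (hx : x ≠ 0) : Ψ.chi K x ≠ 0 :=
  Ψ.eval_ne_zero (mul_ne_zero (by simpa using hK.ne') (Ψ.inv_ne_zero hx))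

theorem chi_top {K : ℝ≥0} (hK : 0 < K) : Ψ.chi K ⊤ = ⊤ := by
  rw [chi, Ψ.inv_top, ENNReal.mul_top (by simpa using hK.ne'), Ψ.eval_top]

theorem chi_one (x : ℝ≥0∞) : Ψ.chi 1 x = x := by rw [chi, one_mul, Ψ.eval_inv]

/-- The preimage of `y` under `χ_K`. -/
theorem chi_preimage {K : ℝ≥0} (hK : 0 < K) (y : ℝ≥0∞) :
    Ψ.chi K (Ψ.eval ((K : ℝ≥0∞)⁻¹ * Ψ.inv y)) = y := by
  rw [chi, Ψ.inv_eval, ← mul_assoc, ENNReal.mul_inv_cancel (by simpa using hK.ne')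
    ENNReal.coe_ne_top, one_mul, Ψ.eval_inv]

theorem chi_strictMono {K : ℝ≥0} (hK : 0 < K) : StrictMono (Ψ.chi K) := fun x y h =>
  Ψ.eval_strictMono ((ENNReal.mul_lt_mul_iff_right (by simpa using hK.ne')
    ENNReal.coe_ne_top).2 (Ψ.inv_strictMono h))

variable {Ψ}

theorem SatisfiesDelta2.eval_sq_le (hΨ : Ψ.SatisfiesDelta2) :
    ∃ α : ℝ≥0, 1 < α ∧ ∃ x₀ : ℝ≥0∞, x₀ ≠ ⊤ ∧ ∀ x, x₀ ≤ x → Ψ.eval x ^ 2 ≤ Ψ.eval (α * x) := by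
  obtain ⟨α, hα, h⟩ := hΨ
  obtain ⟨x₀, hx₀⟩ := eventually_atTop.1 h
  lift α to ℝ≥0 using by linarith
  have hα0 : (α : ℝ≥0∞) ≠ 0 := by
    rw [ENNReal.coe_ne_zero]
    rintro rfl
    simp at hα
    linarith
  refine ⟨α, by exact_mod_cast hα, ENNReal.ofReal x₀, ENNReal.ofReal_ne_top, fun x hx => ?_⟩
  by_cases hxt : x = ⊤
  · rw [hxt, ENNReal.mul_top hα0, Ψ.eval_top]
    exact le_top
  · have hx' : x₀ ≤ x.toReal := (ENNReal.ofReal_le_iff_le_toReal hxt).1 hx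
    have h1 := hx₀ _ hx'
    have e : (α : ℝ≥0∞) * x = ENNReal.ofReal (α * x.toReal) := by
      rw [ENNReal.ofReal_mul α.coe_nonneg, ENNReal.ofReal_toReal hxt, ENNReal.ofReal_coe_nnreal]
    rw [e, Ψ.eval_ofReal (mul_nonneg α.coe_nonneg ENNReal.toReal_nonneg)]
    conv_lhs => rw [← ENNReal.ofReal_toReal hxt]
    rw [Ψ.eval_ofReal ENNReal.toReal_nonneg,
      ← ENNReal.ofReal_pow (Ψ.nonneg ENNReal.toReal_nonneg)]
    exact ENNReal.ofReal_le_ofReal h1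

/-- This is Δ² read at the point A Ψ⁻¹(x). Squaring χ_A costs a dilation α that does not depend on
A. -/
theorem SatisfiesDelta2.chi_sq_le (hΨ : Ψ.SatisfiesDelta2) :
    ∃ α : ℝ≥0, 1 < α ∧ ∀ A : ℝ≥0, 0 < A →
      ∃ x₀ : ℝ≥0∞, x₀ ≠ ⊤ ∧ ∀ x, x₀ ≤ x → Ψ.chi A x ^ 2 ≤ Ψ.chi (α * A : ℝ≥0) x := by
  obtain ⟨α, hα, x₀, hx₀, h⟩ := hΨ.eval_sq_le
  refine ⟨α, hα, fun A hA => ⟨Ψ.eval ((A : ℝ≥0∞)⁻¹ * x₀), ?_, fun x hx => ?_⟩⟩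
  · exact Ψ.eval_ne_top (ENNReal.mul_ne_top (ENNReal.inv_ne_top.2 (by simpa using hA.ne')) hx₀)
  · have h1 : x₀ ≤ A * Ψ.inv x := by
      have h2 := Ψ.inv_mono hx
      rw [Ψ.inv_eval] at h2
      calc x₀ = A * ((A : ℝ≥0∞)⁻¹ * x₀) := by
            rw [← mul_assoc, ENNReal.mul_inv_cancel (by simpa using hA.ne') ENNReal.coe_ne_top,
              one_mul]
        _ ≤ _ := by gcongr
    rw [chi, chi, ENNReal.coe_mul, mul_assoc]
    exact h _ h1

end OrliczFunction

section Boundary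

variable {φ : ℂ → ℂ}

theorem boundaryValue_eq {h : ℂ → ℂ} {t : ℝ} {l : ℂ}
    (hl : Tendsto (fun r => h (circleMap 0 r t)) (𝓝[<] 1) (𝓝 l)) : boundaryValue h t = l :=
  hl.limUnder_eq

theorem ae_tendsto_boundaryValue (hφ : DifferentiableOn ℂ φ (Metric.ball 0 1))
    (hmaps : MapsTo φ (Metric.ball 0 1) (Metric.ball 0 1)) :
    ∀ᵐ t ∂circleMeasure,
      Tendsto (fun r => φ (circleMap 0 r t)) (𝓝[<] 1) (𝓝 (boundaryValue φ t)) := by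
  filter_upwards [ae_exists_radial_limit hφ (M := 1) fun z hz => by
    have h : ‖φ z‖ < 1 := by simpa using hmaps hz
    exact_mod_cast h.le] with t ht
  obtain ⟨l, hl⟩ := ht
  rwa [boundaryValue_eq hl]

theorem aestronglyMeasurable_boundaryValue (hφ : DifferentiableOn ℂ φ (Metric.ball 0 1))
    (hmaps : MapsTo φ (Metric.ball 0 1) (Metric.ball 0 1)) :
    AEStronglyMeasurable (boundaryValue φ) circleMeasure :=
  aestronglyMeasurable_of_tendsto_ae atTop
    (f := fun n t => φ (circleMap 0 (radSeq n) t))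
    (fun n => (continuous_circle_slice hφ (radSeq_mem n)).aestronglyMeasurable)
    ((ae_tendsto_boundaryValue hφ hmaps).mono fun _ ht => ht.comp tendsto_radSeq)

theorem ae_norm_boundaryValue_le (hφ : DifferentiableOn ℂ φ (Metric.ball 0 1))
    (hmaps : MapsTo φ (Metric.ball 0 1) (Metric.ball 0 1)) :
    ∀ᵐ t ∂circleMeasure, ‖boundaryValue φ t‖ ≤ 1 := by
  filter_upwards [ae_tendsto_boundaryValue hφ hmaps] with t ht
  refine le_of_tendsto (ht.norm.comp tendsto_radSeq) (Eventually.of_forall fun n => ?_)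
  have h : ‖φ (circleMap 0 (radSeq n) t)‖ < 1 := by
    simpa using hmaps (circleMap_mem_unitBall (radSeq_mem n) t)
  exact h.le

theorem aemeasurable_one_div (hφ : DifferentiableOn ℂ φ (Metric.ball 0 1))
    (hmaps : MapsTo φ (Metric.ball 0 1) (Metric.ball 0 1)) :
    AEMeasurable (fun t => 1 / (1 - ‖boundaryValue φ t‖ₑ)) circleMeasure :=
  ((aestronglyMeasurable_boundaryValue hφ hmaps).enorm.const_sub 1).const_div 1

/-- All the functions `χ_B(1 / (1 - |φ*|))` have a finite integral. -/
def ChiFiniteIntegral (Ψ : OrliczFunction) (φ : ℂ → ℂ) : Prop :=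
  ∀ B : ℝ≥0, 0 < B → ∫⁻ t, Ψ.chi B (1 / (1 - ‖boundaryValue φ t‖ₑ)) ∂circleMeasure < ⊤

/-- The distribution of `1 - |φ*|` is dominated by every `1 / χ_A`. -/
def ChiTail (Ψ : OrliczFunction) (φ : ℂ → ℂ) : Prop :=
  ∀ A : ℝ≥0, 0 < A → ∃ K : ℝ≥0, ∃ δ : ℝ, 0 < δ ∧ ∀ s ∈ Ioo 0 δ,
    circleMeasure {t | 1 - ‖boundaryValue φ t‖ < s} * Ψ.chi A (ENNReal.ofReal (1 / s)) ≤ K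

variable {Ψ : OrliczFunction}

/-- Dividing by C inside Ψ is the same as taking χ with index 1/C, so the two families of integrals
coincide. -/
theorem memMorseTransue_iff (hφ : DifferentiableOn ℂ φ (Metric.ball 0 1))
    (hmaps : MapsTo φ (Metric.ball 0 1) (Metric.ball 0 1)) :
    MemMorseTransue Ψ (fun t => Ψ.inv (1 / (1 - ‖boundaryValue φ t‖ₑ))) ↔
      ChiFiniteIntegral Ψ φ := by
  have key : ∀ C : ℝ≥0, 0 < C → ∀ x : ℝ≥0∞,
      Ψ.eval (‖Ψ.inv x‖ₑ / C) = Ψ.chi (C⁻¹ : ℝ≥0) x := fun C hC x => by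
    rw [enorm_eq_self, OrliczFunction.chi, ENNReal.coe_inv hC.ne', div_eq_mul_inv, mul_comm]
  constructor
  · rintro ⟨-, h⟩ B hB
    have h1 := h B⁻¹ (inv_pos.2 hB)
    simp_rw [key B⁻¹ (inv_pos.2 hB), inv_inv] at h1
    exact h1
  · intro h
    refine ⟨(Ψ.inv_mono.measurable.comp_aemeasurable
      (aemeasurable_one_div hφ hmaps)).aestronglyMeasurable, fun C hC => ?_⟩
    simp_rw [key C hC]
    exact h _ (inv_pos.2 hC)

theorem integrable_chi_iff (hφ : DifferentiableOn ℂ φ (Metric.ball 0 1))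
    (hmaps : MapsTo φ (Metric.ball 0 1) (Metric.ball 0 1)) :
    (∀ B : ℝ≥0, 0 < B →
      Integrable (fun t => Ψ.chi B (1 / (1 - ‖boundaryValue φ t‖ₑ))) circleMeasure) ↔
      ChiFiniteIntegral Ψ φ := by
  refine forall₂_congr fun B hB => ⟨fun h => ?_, fun h => ⟨?_, ?_⟩⟩
  · simpa [HasFiniteIntegral] using h.2
  · exact ((Ψ.measurable_chi B).comp_aemeasurable
      (aemeasurable_one_div hφ hmaps)).aestronglyMeasurable
  · simpa [HasFiniteIntegral] using h

theorem isBigO_tail_iff :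
    (∀ A : ℝ≥0, 0 < A →
      (fun s : ℝ => circleMeasure.real {t | 1 - ‖boundaryValue φ t‖ < s}) =O[𝓝[>] 0]
        fun s : ℝ => 1 / (Ψ.chi A (ENNReal.ofReal (1 / s))).toReal) ↔ ChiTail Ψ φ := by
  refine forall₂_congr fun A hA => ?_
  have key : ∀ s : ℝ, 0 < s → ∀ K : ℝ, 0 ≤ K →
      (‖circleMeasure.real {t | 1 - ‖boundaryValue φ t‖ < s}‖ ≤
        K * ‖1 / (Ψ.chi A (ENNReal.ofReal (1 / s))).toReal‖ ↔
      circleMeasure {t | 1 - ‖boundaryValue φ t‖ < s} * Ψ.chi A (ENNReal.ofReal (1 / s)) ≤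
        ENNReal.ofReal K) := fun s hs K hK => by
    have h0 : Ψ.chi A (ENNReal.ofReal (1 / s)) ≠ 0 := Ψ.chi_ne_zero hA (by simpa using hs)
    have ht : Ψ.chi A (ENNReal.ofReal (1 / s)) ≠ ⊤ := Ψ.chi_ne_top ENNReal.ofReal_ne_top
    have hp := ENNReal.toReal_pos h0 ht
    rw [Real.norm_of_nonneg measureReal_nonneg, Real.norm_of_nonneg (by positivity),
      mul_one_div, le_div_iff₀ hp, Measure.real, ← ENNReal.toReal_mul]
    exact (ENNReal.le_ofReal_iff_toReal_le (ENNReal.mul_ne_top (measure_ne_top _ _) ht) hK).symm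
  constructor
  · intro h
    obtain ⟨K, hK0, hK⟩ := h.exists_nonneg
    obtain ⟨δ, hδ, hsub⟩ := mem_nhdsGT_iff_exists_Ioo_subset.1 hK.bound
    refine ⟨K.toNNReal, δ, hδ, fun s hs => ?_⟩
    exact (key s hs.1 K hK0).1 (hsub hs)
  · rintro ⟨K, δ, hδ, h⟩
    refine IsBigO.of_bound K ?_
    filter_upwards [Ioo_mem_nhdsGT hδ] with s hs
    rw [key s hs.1 K K.2, ENNReal.ofReal_coe_nnreal]
    exact h s hs

/-- Markov's inequality at level χ_A(1/s); the constant is the integral itself. -/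
theorem ChiFiniteIntegral.chiTail (hφ : DifferentiableOn ℂ φ (Metric.ball 0 1))
    (hmaps : MapsTo φ (Metric.ball 0 1) (Metric.ball 0 1)) (h : ChiFiniteIntegral Ψ φ) :
    ChiTail Ψ φ := by
  intro A hA
  refine ⟨(∫⁻ t, Ψ.chi A (1 / (1 - ‖boundaryValue φ t‖ₑ)) ∂circleMeasure).toNNReal, 1, one_pos,
    fun s hs => ?_⟩
  rw [ENNReal.coe_toNNReal (h A hA).ne]
  have hm := (Ψ.measurable_chi A).comp_aemeasurable (aemeasurable_one_div hφ hmaps)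
  refine le_trans ?_ (mul_meas_ge_le_lintegral₀ hm (Ψ.chi A (ENNReal.ofReal (1 / s))))
  rw [mul_comm]
  refine mul_le_mul_right (measure_mono fun t ht => ?_) _
  have ht' : 1 - ‖boundaryValue φ t‖ < s := ht
  refine Ψ.chi_mono_right A ?_
  rw [ENNReal.ofReal_div_of_pos hs.1, ENNReal.ofReal_one]
  refine ENNReal.div_le_div_left ?_ 1
  rw [← ofReal_norm, ← ENNReal.ofReal_one, ← ENNReal.ofReal_sub _ (norm_nonneg _)]
  exact ENNReal.ofReal_le_ofReal ht'.le

/-- Dyadic layer-cake bound. -/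
theorem le_add_tsum_dyadic_indicator (n₀ : ℕ) (y : ℝ≥0∞) :
    y ≤ 2 ^ n₀ + ∑' k : ℕ, 2 ^ (n₀ + k + 1) * (Ioi (2 ^ (n₀ + k))).indicator 1 y := by
  -- Working with finite c < y treats y = ∞ together with the rest; one dyadic term, at the last
  -- power of 2 below c, already suffices.
  refine ENNReal.le_of_forall_nnreal_lt fun c hc => ?_
  by_cases hc0 : (c : ℝ≥0∞) ≤ 2 ^ n₀
  · exact hc0.trans le_self_add
  have hex : ∃ k : ℕ, (c : ℝ≥0∞) ≤ 2 ^ (n₀ + k) := by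
    obtain ⟨k, hk⟩ := pow_unbounded_of_one_lt c (one_lt_two : (1 : ℝ≥0) < 2)
    refine ⟨k, ?_⟩
    have h2 : c ≤ 2 ^ (n₀ + k) :=
      hk.le.trans (pow_le_pow_right₀ one_le_two (Nat.le_add_left _ _))
    exact_mod_cast h2
  classical
  have hspec := Nat.find_spec hex
  obtain ⟨k, hk⟩ : ∃ k, Nat.find hex = k + 1 := by
    refine Nat.exists_eq_succ_of_ne_zero fun h0 => hc0 ?_
    rw [h0, add_zero] at hspec
    exact hspec
  have hlt : (2 : ℝ≥0∞) ^ (n₀ + k) < c := not_le.1 (Nat.find_min hex (by rw [hk]; exact k.lt_succ_self))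
  rw [hk] at hspec
  refine le_trans ?_ le_add_self
  refine le_trans ?_ (ENNReal.le_tsum k)
  rw [indicator_of_mem (mem_Ioi.2 (hlt.trans hc))]
  simpa [add_assoc] using hspec

/-- Where χ_B takes the value 2^n, Δ² makes χ_{αB} at least 4^n. The tail hypothesis for αB thus
gives {χ_B(R) > 2^n} measure at most K 4^{-n}, and the layer-cake sum is geometric. -/
theorem ChiTail.chiFiniteIntegral (hΨ : Ψ.SatisfiesDelta2)
    (hφ : DifferentiableOn ℂ φ (Metric.ball 0 1))
    (hmaps : MapsTo φ (Metric.ball 0 1) (Metric.ball 0 1)) (h : ChiTail Ψ φ) :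
    ChiFiniteIntegral Ψ φ := by
  intro B hB
  obtain ⟨α, hα, hχ⟩ := hΨ.chi_sq_le
  obtain ⟨x₀, hx₀, hsq⟩ := hχ B hB
  obtain ⟨K, δ, hδ, hK⟩ := h (α * B) (mul_pos (zero_lt_one.trans hα) hB)
  set R : ℝ → ℝ≥0∞ := fun t => 1 / (1 - ‖boundaryValue φ t‖ₑ) with hR
  have hRm : AEMeasurable R circleMeasure := aemeasurable_one_div hφ hmaps
  set Y : ℝ → ℝ≥0∞ := fun t => Ψ.chi B (R t) with hY
  have hYm : AEMeasurable Y circleMeasure := (Ψ.measurable_chi B).comp_aemeasurable hRm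
  -- From level 2^{n₀} on, the χ_B-preimage exceeds both the Δ² threshold x₀ and 1/δ, the range of
  -- the tail bound.
  obtain ⟨n₀, hn₀⟩ : ∃ n₀ : ℕ, Ψ.chi B (max x₀ (ENNReal.ofReal (1 / δ))) < 2 ^ n₀ := by
    have hne : Ψ.chi B (max x₀ (ENNReal.ofReal (1 / δ))) ≠ ⊤ :=
      Ψ.chi_ne_top (max_lt hx₀.lt_top ENNReal.ofReal_lt_top).ne
    obtain ⟨n, hn⟩ := pow_unbounded_of_one_lt
      (Ψ.chi B (max x₀ (ENNReal.ofReal (1 / δ)))).toNNReal (one_lt_two : (1 : ℝ≥0) < 2)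
    refine ⟨n, ?_⟩
    rw [← ENNReal.coe_toNNReal hne]
    exact_mod_cast hn
  have htail : ∀ k : ℕ, 2 ^ (n₀ + k + 1) * circleMeasure {t | 2 ^ (n₀ + k) < Y t} ≤
      2 * K * 2⁻¹ ^ (n₀ + k) := by
    intro k
    set n := n₀ + k with hn
    have hpt : (2 : ℝ≥0∞) ^ n ≠ ⊤ := ENNReal.pow_ne_top ENNReal.ofNat_ne_top
    have hp0 : (2 : ℝ≥0∞) ^ n ≠ 0 := pow_ne_zero _ two_ne_zero
    set x := Ψ.eval ((B : ℝ≥0∞)⁻¹ * Ψ.inv (2 ^ n)) with hx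
    have hχx : Ψ.chi B x = 2 ^ n := Ψ.chi_preimage hB _
    have hxt : x ≠ ⊤ := fun h => by
      rw [h, Ψ.chi_top hB] at hχx
      exact hpt hχx.symm
    have hxlt : max x₀ (ENNReal.ofReal (1 / δ)) < x := by
      rw [← (Ψ.chi_strictMono hB).lt_iff_lt, hχx]
      exact hn₀.trans_le (pow_le_pow_right₀ one_le_two (Nat.le_add_right _ _))
    have hxpos : 0 < x.toReal := ENNReal.toReal_pos (bot_le.trans_lt hxlt).ne' hxt
    have hxδ : 1 / δ < x.toReal :=
      (ENNReal.ofReal_lt_iff_lt_toReal (by positivity) hxt).1 ((le_max_right _ _).trans_lt hxlt)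
    have hs : 1 / x.toReal ∈ Ioo 0 δ := by
      refine ⟨by positivity, ?_⟩
      rw [div_lt_iff₀ hxpos]
      rwa [div_lt_iff₀ hδ, mul_comm] at hxδ
    have h1 := hK _ hs
    rw [one_div_one_div, ENNReal.ofReal_toReal hxt] at h1
    have h2 : (2 : ℝ≥0∞) ^ n * 2 ^ n ≤ Ψ.chi (α * B : ℝ≥0) x := by
      rw [← sq, ← hχx]
      exact hsq x ((le_max_left _ _).trans hxlt.le)
    have hsub : {t | 2 ^ n < Y t} ⊆ {t | 1 - ‖boundaryValue φ t‖ < 1 / x.toReal} := by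
      intro t ht
      have ht' : Ψ.chi B x < Ψ.chi B (R t) := by rw [hχx]; exact ht
      have h3 : x < R t := (Ψ.chi_strictMono hB).lt_iff_lt.1 ht'
      by_contra hcon
      have h4 : 1 / x.toReal ≤ 1 - ‖boundaryValue φ t‖ := not_lt.1 hcon
      refine absurd h3 (not_lt.2 ?_)
      have h5 : (0 : ℝ) < 1 - ‖boundaryValue φ t‖ := lt_of_lt_of_le (by positivity) h4
      have hb : boundaryValue φ t ∈ Metric.ball (0 : ℂ) 1 := by simp; linarith
      rw [hR]
      simp only
      rw [one_div_one_sub_enorm hb]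
      refine ENNReal.ofReal_le_of_le_toReal ?_
      rw [div_le_iff₀ h5]
      rw [div_le_iff₀ hxpos] at h4
      linarith
    have h6 : circleMeasure {t | 2 ^ n < Y t} * (2 ^ n * 2 ^ n) ≤ K :=
      (mul_le_mul' (measure_mono hsub) h2).trans h1
    calc 2 ^ (n + 1) * circleMeasure {t | 2 ^ n < Y t}
        = 2 * (circleMeasure {t | 2 ^ n < Y t} * (2 ^ n * 2 ^ n)) * 2⁻¹ ^ n := by
          have h7 : (2 : ℝ≥0∞) ^ n * 2⁻¹ ^ n = 1 := by
            rw [← mul_pow, ENNReal.mul_inv_cancel two_ne_zero ENNReal.ofNat_ne_top, one_pow]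
          calc _ = 2 * (circleMeasure {t | 2 ^ n < Y t} * 2 ^ n) * 1 := by ring
            _ = _ := by rw [← h7]; ring
      _ ≤ _ := by gcongr
  calc ∫⁻ t, Y t ∂circleMeasure
      ≤ ∫⁻ t, (2 ^ n₀ + ∑' k : ℕ, 2 ^ (n₀ + k + 1) *
          (Ioi (2 ^ (n₀ + k))).indicator 1 (Y t)) ∂circleMeasure :=
        lintegral_mono fun t => le_add_tsum_dyadic_indicator n₀ (Y t)
    _ = 2 ^ n₀ + ∑' k : ℕ, 2 ^ (n₀ + k + 1) * circleMeasure {t | 2 ^ (n₀ + k) < Y t} := by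
        have hind : ∀ k : ℕ, AEMeasurable (fun t =>
            (Ioi (2 ^ (n₀ + k))).indicator (1 : ℝ≥0∞ → ℝ≥0∞) (Y t)) circleMeasure := fun k =>
          (measurable_one.indicator measurableSet_Ioi).comp_aemeasurable hYm
        rw [lintegral_add_left' aemeasurable_const, lintegral_tsum fun k => (hind k).const_mul _]
        simp only [lintegral_const, measure_univ, mul_one]
        congr 2
        funext k
        rw [lintegral_const_mul'' _ (hind k)]
        congr 1
        have : (fun t => (Ioi (2 ^ (n₀ + k))).indicator (1 : ℝ≥0∞ → ℝ≥0∞) (Y t)) =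
            {t | 2 ^ (n₀ + k) < Y t}.indicator 1 := rfl
        rw [this, lintegral_indicator_one₀]
        exact hYm.nullMeasurableSet_preimage measurableSet_Ioi
    _ ≤ 2 ^ n₀ + ∑' k : ℕ, 2 * (K : ℝ≥0∞) * 2⁻¹ ^ (n₀ + k) :=
        add_le_add le_rfl (ENNReal.tsum_le_tsum htail)
    _ < ⊤ := by
        refine ENNReal.add_lt_top.2 ⟨ENNReal.pow_lt_top ENNReal.ofNat_lt_top, ?_⟩
        simp_rw [pow_add]
        rw [ENNReal.tsum_mul_left, ENNReal.tsum_mul_left, ENNReal.tsum_geometric]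
        refine ENNReal.mul_lt_top (by finiteness) (ENNReal.mul_lt_top
          (ENNReal.pow_lt_top (by simp)) ?_)
        rw [ENNReal.one_sub_inv_two, inv_inv]
        simp

/-- Since χ_1 is the identity, B = 1 makes R integrable, hence finite almost everywhere. -/
theorem ChiFiniteIntegral.ae_mem_ball (hφ : DifferentiableOn ℂ φ (Metric.ball 0 1))
    (hmaps : MapsTo φ (Metric.ball 0 1) (Metric.ball 0 1)) (h : ChiFiniteIntegral Ψ φ) :
    ∀ᵐ t ∂circleMeasure, boundaryValue φ t ∈ Metric.ball (0 : ℂ) 1 := by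
  have h1 := h 1 one_pos
  simp only [ENNReal.coe_one, Ψ.chi_one] at h1
  filter_upwards [ae_lt_top' (aemeasurable_one_div hφ hmaps) h1.ne] with t ht
  by_contra hcon
  have hn : 1 ≤ ‖boundaryValue φ t‖ := by simpa using hcon
  have : 1 - ‖boundaryValue φ t‖ₑ = 0 := by
    rw [tsub_eq_zero_iff_le, ← ofReal_norm]
    exact ENNReal.one_le_ofReal.2 hn
  rw [this] at ht
  simp at ht

end Boundary
end

/-! ### The test functions u and v. -/

noncomputable section

/-- `v_{a,r}(z) = (1 - r) / (1 - \bar a r z)`, a square root of `u_{a,r}` with positive real part. -/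
def vFun (a : Circle) (r : ℝ) (z : ℂ) : ℂ := (1 - r) / (1 - (starRingEnd ℂ) (a : ℂ) * r * z)

section Kernels

variable {a : Circle} {r : ℝ} {z : ℂ}

theorem uFun_eq_sq (a : Circle) (r : ℝ) (z : ℂ) : uFun a r z = vFun a r z ^ 2 := rfl

theorem norm_one_sub_ofReal (hr : r ∈ Ico (0 : ℝ) 1) : ‖(1 - r : ℂ)‖ = 1 - r := by
  rw [← Complex.ofReal_one, ← Complex.ofReal_sub, Complex.norm_real, Real.norm_eq_abs,
    abs_of_pos (by linarith [hr.2])]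

theorem one_sub_le_re_denom (a : Circle) (hr : r ∈ Ico (0 : ℝ) 1) (hz : ‖z‖ ≤ 1) :
    1 - r ≤ (1 - (starRingEnd ℂ) (a : ℂ) * r * z).re := by
  have h1 : ‖(starRingEnd ℂ) (a : ℂ) * r * z‖ ≤ r := by
    simp only [norm_mul, RCLike.norm_conj, Circle.norm_coe, one_mul, Complex.norm_real,
      Real.norm_eq_abs, abs_of_nonneg hr.1]
    exact mul_le_of_le_one_right hr.1 hz
  have h2 := (Complex.re_le_norm ((starRingEnd ℂ) (a : ℂ) * r * z)).trans h1
  rw [Complex.sub_re, Complex.one_re]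
  linarith

theorem denom_ne_zero (a : Circle) (hr : r ∈ Ico (0 : ℝ) 1) (hz : ‖z‖ ≤ 1) :
    1 - (starRingEnd ℂ) (a : ℂ) * r * z ≠ 0 := fun h => by
  have h1 := one_sub_le_re_denom a hr hz
  rw [h, Complex.zero_re] at h1
  linarith [hr.2]

theorem norm_vFun (a : Circle) (hr : r ∈ Ico (0 : ℝ) 1) (z : ℂ) :
    ‖vFun a r z‖ = (1 - r) / ‖1 - (starRingEnd ℂ) (a : ℂ) * r * z‖ := by
  rw [vFun, norm_div, norm_one_sub_ofReal hr]

theorem norm_vFun_le_one (a : Circle) (hr : r ∈ Ico (0 : ℝ) 1) (hz : ‖z‖ ≤ 1) :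
    ‖vFun a r z‖ ≤ 1 := by
  rw [norm_vFun a hr]
  exact div_le_one_of_le₀ ((one_sub_le_re_denom a hr hz).trans (Complex.re_le_norm _))
    (norm_nonneg _)

theorem norm_vFun_le (a : Circle) (hr : r ∈ Ico (0 : ℝ) 1) {R : ℝ} (hR : R < 1) (hz : ‖z‖ ≤ R) :
    ‖vFun a r z‖ ≤ (1 - r) / (1 - R) := by
  rw [norm_vFun a hr]
  refine div_le_div_of_nonneg_left (by linarith [hr.2]) (by linarith) ?_
  have h1 : ‖(starRingEnd ℂ) (a : ℂ) * r * z‖ ≤ R := by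
    simp only [norm_mul, RCLike.norm_conj, Circle.norm_coe, one_mul, Complex.norm_real,
      Real.norm_eq_abs, abs_of_nonneg hr.1]
    exact (mul_le_of_le_one_left (norm_nonneg z) hr.2.le).trans hz
  have h2 := norm_sub_norm_le (1 : ℂ) ((starRingEnd ℂ) (a : ℂ) * r * z)
  rw [norm_one] at h2
  linarith

/-- With d the denominator, Re v = (1 - r) Re d / |d|² and Re d ≥ 1 - r. Positivity prevents
cancellation in sums of bumps, and the square keeps the lower bound on windows. -/
theorem sq_norm_vFun_le_re (a : Circle) (hr : r ∈ Ico (0 : ℝ) 1) (hz : ‖z‖ ≤ 1) :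
    ‖vFun a r z‖ ^ 2 ≤ (vFun a r z).re := by
  have h1 := one_sub_le_re_denom a hr hz
  have h0 := denom_ne_zero a hr hz
  rw [norm_vFun a hr, vFun]
  set d := 1 - (starRingEnd ℂ) (a : ℂ) * r * z
  have hd : 0 < ‖d‖ := norm_pos_iff.2 h0
  have e : ((1 - r : ℂ) / d).re = (1 - r) * d.re / ‖d‖ ^ 2 := by
    rw [Complex.div_re, Complex.normSq_eq_norm_sq]
    simp
  rw [e, div_pow]
  refine div_le_div_of_nonneg_right ?_ (by positivity)
  nlinarith [hr.2]

theorem re_vFun_nonneg (a : Circle) (hr : r ∈ Ico (0 : ℝ) 1) (hz : ‖z‖ ≤ 1) :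
    0 ≤ (vFun a r z).re := (sq_nonneg _).trans (sq_norm_vFun_le_re a hr hz)

/-- `|v_{a,r}|²` is bounded below on the window of size `1 - r` at `a`. -/
theorem one_ninth_le_sq_norm_vFun (hr : r ∈ Ico (0 : ℝ) 1) (hz : ‖z‖ ≤ 1)
    (hw : ‖z - a‖ ≤ 2 * (1 - r)) : 1 / 9 ≤ ‖vFun a r z‖ ^ 2 := by
  have h0 := denom_ne_zero a hr hz
  have haa : (starRingEnd ℂ) (a : ℂ) * a = 1 := by
    rw [mul_comm, Complex.mul_conj, Circle.normSq_coe, Complex.ofReal_one]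
  have e : 1 - (starRingEnd ℂ) (a : ℂ) * r * z =
      (1 - r : ℂ) - (starRingEnd ℂ) (a : ℂ) * r * (z - a) := by
    linear_combination -(r : ℂ) * haa
  have h1 : ‖1 - (starRingEnd ℂ) (a : ℂ) * r * z‖ ≤ 3 * (1 - r) := by
    rw [e]
    refine (norm_sub_le _ _).trans ?_
    rw [norm_one_sub_ofReal hr]
    simp only [norm_mul, RCLike.norm_conj, Circle.norm_coe, one_mul, Complex.norm_real,
      Real.norm_eq_abs, abs_of_nonneg hr.1]
    have := mul_le_of_le_one_left (norm_nonneg (z - a)) hr.2.le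
    linarith
  rw [norm_vFun a hr]
  have hd : 0 < ‖1 - (starRingEnd ℂ) (a : ℂ) * r * z‖ := norm_pos_iff.2 h0
  have h2 : 1 / 3 ≤ (1 - r) / ‖1 - (starRingEnd ℂ) (a : ℂ) * r * z‖ := by
    rw [le_div_iff₀ hd]
    linarith
  calc (1 / 9 : ℝ) = (1 / 3) ^ 2 := by norm_num
    _ ≤ _ := by gcongr

theorem continuousAt_vFun (a : Circle) (hr : r ∈ Ico (0 : ℝ) 1) (hz : ‖z‖ ≤ 1) :
    ContinuousAt (vFun a r) z := by
  unfold vFun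
  exact continuousAt_const.div (by fun_prop) (denom_ne_zero a hr hz)

theorem differentiableOn_vFun (a : Circle) (hr : r ∈ Ico (0 : ℝ) 1) :
    DifferentiableOn ℂ (vFun a r) (Metric.ball 0 1) := by
  unfold vFun
  refine DifferentiableOn.div (by fun_prop) (by fun_prop) fun z hz => denom_ne_zero a hr ?_
  have h : ‖z‖ < 1 := by simpa using hz
  exact h.le

/-- With b = a r ρ the denominator has modulus |e^{it} - b|, so |v|² is (1 - r)²/(1 - |b|²) times
the Poisson kernel at b, and 1 - r ≤ 1 - |b|². -/
theorem sq_norm_vFun_circleMap_le (a : Circle) (hr : r ∈ Ico (0 : ℝ) 1) {ρ : ℝ}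
    (hρ : ρ ∈ Ico (0 : ℝ) 1) (t : ℝ) :
    ‖vFun a r (circleMap 0 ρ t)‖ ^ 2 ≤ (1 - r) * discPoisson (a * (r * ρ : ℝ)) t := by
  set b : ℂ := a * (r * ρ : ℝ) with hb
  have hbn : ‖b‖ = r * ρ := by
    rw [hb, norm_mul, Circle.norm_coe, one_mul, Complex.norm_real, Real.norm_eq_abs,
      abs_of_nonneg (mul_nonneg hr.1 hρ.1)]
  have he : ‖1 - (starRingEnd ℂ) (a : ℂ) * r * circleMap 0 ρ t‖ = ‖circleMap 0 1 t - b‖ := by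
    have h1 : (starRingEnd ℂ) (circleMap 0 1 t) * circleMap 0 1 t = 1 := by
      rw [mul_comm, Complex.mul_conj, Complex.normSq_eq_norm_sq]
      simp
    have h2 : 1 - (starRingEnd ℂ) (a : ℂ) * r * circleMap 0 ρ t =
        (starRingEnd ℂ) (circleMap 0 1 t - b) * circleMap 0 1 t := by
      rw [map_sub, sub_mul, h1, hb, map_mul, Complex.conj_ofReal, ← mul_circleMap_one ρ t]
      push_cast
      ring
    rw [h2, norm_mul, RCLike.norm_conj]
    simp
  rw [norm_vFun a hr, he, discPoisson_eq, hbn, div_pow, ← mul_div_assoc]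
  refine div_le_div_of_nonneg_right ?_ (by positivity)
  rw [sq (1 - r)]
  have h3 : r * ρ ≤ r := mul_le_of_le_one_right hr.1 hρ.2.le
  have h4 : (r * ρ) ^ 2 ≤ r := by nlinarith [hr.1, hr.2, mul_nonneg hr.1 hρ.1]
  exact mul_le_mul_of_nonneg_left (by linarith) (by linarith [hr.2])

theorem lintegral_sq_enorm_vFun_le (a : Circle) (hr : r ∈ Ico (0 : ℝ) 1) {ρ : ℝ}
    (hρ : ρ ∈ Ico (0 : ℝ) 1) :
    ∫⁻ t, ‖vFun a r (circleMap 0 ρ t)‖ₑ ^ 2 ∂circleMeasure ≤ ENNReal.ofReal (1 - r) := by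
  have hb : (a * (r * ρ : ℝ) : ℂ) ∈ Metric.ball (0 : ℂ) 1 := by
    rw [mem_ball_zero_iff, norm_mul, Circle.norm_coe, one_mul, Complex.norm_real,
      Real.norm_eq_abs, abs_of_nonneg (mul_nonneg hr.1 hρ.1)]
    exact (mul_le_of_le_one_right hr.1 hρ.2.le).trans_lt hr.2
  calc ∫⁻ t, ‖vFun a r (circleMap 0 ρ t)‖ₑ ^ 2 ∂circleMeasure
      ≤ ∫⁻ t, ENNReal.ofReal (1 - r) * ENNReal.ofReal (discPoisson (a * (r * ρ : ℝ)) t)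
          ∂circleMeasure := by
        refine lintegral_mono fun t => ?_
        rw [← ENNReal.ofReal_mul (by linarith [hr.2]), ← ofReal_norm,
          ← ENNReal.ofReal_pow (norm_nonneg _)]
        exact ENNReal.ofReal_le_ofReal (sq_norm_vFun_circleMap_le a hr hρ t)
    _ = ENNReal.ofReal (1 - r) := by
        rw [lintegral_const_mul' _ _ ENNReal.ofReal_ne_top, ← ofReal_integral_eq_lintegral_ofReal
          (integrable_circleMeasure_of_continuous (continuous_discPoisson hb))
          (ae_of_all _ (discPoisson_nonneg hb)), integral_discPoisson hb, ENNReal.ofReal_one,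
          mul_one]

end Kernels

namespace HardyOrlicz

variable {Ψ : OrliczFunction} {r : ℝ}

theorem uElem_apply (a : Circle) (hr : r ∈ Ico (0 : ℝ) 1) {z : ℂ}
    (hz : z ∈ Metric.ball (0 : ℂ) 1) : uElem Ψ a r z = uFun a r z := by
  rw [uElem, dif_pos hr]
  exact indicator_of_mem hz _

theorem growth_pos (Ψ : OrliczFunction) (hr : r < 1) : 0 < growth Ψ r :=
  ENNReal.toReal_pos (Ψ.inv_ne_zero (by simpa using hr)) (Ψ.inv_ne_top ENNReal.ofReal_ne_top)

theorem ofReal_growth (Ψ : OrliczFunction) (r : ℝ) :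
    ENNReal.ofReal (growth Ψ r) = Ψ.inv (ENNReal.ofReal (1 / (1 - r))) :=
  ENNReal.ofReal_toReal (Ψ.inv_ne_top ENNReal.ofReal_ne_top)

theorem enorm_div_ofReal_inv {c : ℝ} (hc : 0 < c) (x : ℝ≥0∞) :
    x / ENNReal.ofReal (1 / c) = x * ENNReal.ofReal c := by
  rw [one_div, ENNReal.ofReal_inv_of_pos hc, div_eq_mul_inv, inv_inv]

/-- Write X = Ψ⁻¹(1/(1 - r)). As |u| ≤ 1, convexity gives Ψ(X|u|) ≤ |u| Ψ(X) = |u|/(1 - r), and |u|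
= |v|² has mean at most 1 - r on each circle. -/
theorem norm_uElem_le (a : Circle) (hr : r ∈ Ico (0 : ℝ) 1) :
    ‖uElem Ψ a r‖ ≤ 1 / growth Ψ r := by
  have hg := growth_pos Ψ hr.2
  have h := norm_le_of_lintegral_le (f := uElem Ψ a r) (c := 1 / growth Ψ r) (by positivity)
    le_rfl fun ρ hρ => ?_
  · simpa using h
  have h1r : (0 : ℝ) < 1 - r := by linarith [hr.2]
  calc ∫⁻ t, Ψ.eval (‖uElem Ψ a r (circleMap 0 ρ t)‖ₑ / ENNReal.ofReal (1 / growth Ψ r))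
        ∂circleMeasure
      ≤ ∫⁻ t, ENNReal.ofReal (1 / (1 - r)) * ‖vFun a r (circleMap 0 ρ t)‖ₑ ^ 2
          ∂circleMeasure := by
        refine lintegral_mono fun t => ?_
        have hb := circleMap_mem_unitBall hρ t
        have hn : ‖circleMap 0 ρ t‖ ≤ 1 := by simpa [abs_of_nonneg hρ.1] using hρ.2.le
        rw [uElem_apply a hr hb, uFun_eq_sq, enorm_pow, enorm_div_ofReal_inv hg, ofReal_growth]
        refine (Ψ.eval_mul_le ?_ _).trans ?_
        · refine pow_le_one₀ zero_le ?_
          rw [← ofReal_norm]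
          exact ENNReal.ofReal_le_one.2 (norm_vFun_le_one a hr hn)
        · rw [Ψ.eval_inv, mul_comm]
    _ = ENNReal.ofReal (1 / (1 - r)) * ∫⁻ t, ‖vFun a r (circleMap 0 ρ t)‖ₑ ^ 2 ∂circleMeasure :=
        lintegral_const_mul' _ _ ENNReal.ofReal_ne_top
    _ ≤ ENNReal.ofReal (1 / (1 - r)) * ENNReal.ofReal (1 - r) :=
        mul_le_mul_right (lintegral_sq_enorm_vFun_le a hr hρ) _
    _ = ENNReal.ofReal 1 := by
        rw [← ENNReal.ofReal_mul (by positivity), one_div_mul_cancel h1r.ne']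

end HardyOrlicz

/-! ### Window conditions. -/

section Window

variable {φ : ℂ → ℂ} {Ψ : OrliczFunction}

/-- The distribution of `φ*` on small windows is dominated by every `1 / χ_A`. -/
def ChiWindow (Ψ : OrliczFunction) (φ : ℂ → ℂ) : Prop :=
  ∀ A : ℝ≥0, 0 < A → ∃ K : ℝ≥0, ∃ δ : ℝ, 0 < δ ∧ ∀ h ∈ Ioo 0 δ, ∀ a : Circle,
    circleMeasure {t | ‖boundaryValue φ t - a‖ ≤ 2 * h} * Ψ.chi A (ENNReal.ofReal (1 / h)) ≤ K

/-- A Chebyshev bound for `φ*` from bounds on the slices of `φ`. -/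
theorem measure_boundaryValue_mul_le (hφ : DifferentiableOn ℂ φ (Metric.ball 0 1))
    (hmaps : MapsTo φ (Metric.ball 0 1) (Metric.ball 0 1)) {g : ℂ → ℝ≥0∞}
    (hg : ∀ w, ‖w‖ ≤ 1 → ContinuousAt g w) {K y : ℝ≥0∞}
    (hK : ∀ n, ∫⁻ t, g (φ (circleMap 0 (radSeq n) t)) ∂circleMeasure ≤ K) {E : Set ℂ}
    (hE : MeasurableSet E) (hy : ∀ w ∈ E, ‖w‖ ≤ 1 → y ≤ g w) :
    circleMeasure {t | boundaryValue φ t ∈ E} * y ≤ K := by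
  have hbm := (aestronglyMeasurable_boundaryValue hφ hmaps).aemeasurable
  have hnull : NullMeasurableSet {t | boundaryValue φ t ∈ E} circleMeasure :=
    hbm.nullMeasurableSet_preimage hE
  have hle : ∀ n t, ‖φ (circleMap 0 (radSeq n) t)‖ ≤ 1 := fun n t => by
    have h : ‖φ (circleMap 0 (radSeq n) t)‖ < 1 := by
      simpa using hmaps (circleMap_mem_unitBall (radSeq_mem n) t)
    exact h.le
  calc circleMeasure {t | boundaryValue φ t ∈ E} * y
      = ∫⁻ t, {t | boundaryValue φ t ∈ E}.indicator (fun _ => y) t ∂circleMeasure := by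
        rw [lintegral_indicator_const₀ hnull, mul_comm]
    -- Wherever the radial limit exists, g(φ*) is the limit of g along the radii, so Fatou's lemma
    -- transfers the slice bounds.
    _ ≤ ∫⁻ t, liminf (fun n => g (φ (circleMap 0 (radSeq n) t))) atTop ∂circleMeasure := by
        refine lintegral_mono_ae ?_
        filter_upwards [ae_tendsto_boundaryValue hφ hmaps, ae_norm_boundaryValue_le hφ hmaps]
          with t ht ht1
        have hlim : Tendsto (fun n => g (φ (circleMap 0 (radSeq n) t))) atTop
            (𝓝 (g (boundaryValue φ t))) :=
          (hg _ ht1).tendsto.comp (ht.comp tendsto_radSeq)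
        rw [hlim.liminf_eq]
        by_cases hmem : t ∈ {t | boundaryValue φ t ∈ E}
        · rw [indicator_of_mem hmem]
          exact hy _ hmem ht1
        · rw [indicator_of_notMem hmem]
          exact zero_le
    _ ≤ liminf (fun n => ∫⁻ t, g (φ (circleMap 0 (radSeq n) t)) ∂circleMeasure) atTop := by
        refine lintegral_liminf_le fun n => Continuous.measurable ?_
        refine continuous_iff_continuousAt.2 fun t => ?_
        exact ContinuousAt.comp (g := g) (f := fun t => φ (circleMap 0 (radSeq n) t))
          (hg _ (hle n t)) (continuous_circle_slice hφ (radSeq_mem n)).continuousAt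
    _ ≤ K := liminf_le_of_frequently_le' (Frequently.of_forall hK)

open HardyOrlicz in
-- On the window at a the modulus of u_{a,r} is at least 1/9. Smallness of C_φ u_{a,r} against 1/(9A
-- Ψ⁻¹(1/(1 - r))) and Chebyshev's inequality give the window bound with constant 1.
theorem ChiWindow.of_isLittleO (hφ : DifferentiableOn ℂ φ (Metric.ball 0 1))
    (hmaps : MapsTo φ (Metric.ball 0 1) (Metric.ball 0 1))
    (h : (fun r : ℝ => ⨆ a : Circle, ‖compCLM (Ψ := Ψ) hφ hmaps (uElem Ψ a r)‖) =o[𝓝[<] 1]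
      fun r : ℝ => 1 / (Ψ.inv (ENNReal.ofReal (1 / (1 - r)))).toReal) : ChiWindow Ψ φ := by
  intro A hA
  have hA' : (0 : ℝ) < A := hA
  -- Half of 1/(9A), so that the norm bound obtained below is strict.
  have hb := h.def (show (0 : ℝ) < 1 / (18 * A) by positivity)
  obtain ⟨l, hl, hsub⟩ := mem_nhdsLT_iff_exists_Ioo_subset.1 hb
  have hl' : l < 1 := hl
  refine ⟨1, min (1 - l) 1, lt_min (by linarith) one_pos, fun s hs a => ?_⟩
  have hs1 : s < 1 - l := hs.2.trans_le (min_le_left _ _)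
  have hs2 : s < 1 := hs.2.trans_le (min_le_right _ _)
  set r := 1 - s with hrdef
  have hr : r ∈ Ico (0 : ℝ) 1 := ⟨by linarith, by linarith [hs.1]⟩
  have hX := growth_pos Ψ hr.2
  have h1 : ‖⨆ a : Circle, ‖compCLM (Ψ := Ψ) hφ hmaps (uElem Ψ a r)‖‖ ≤
      1 / (18 * A) * ‖1 / growth Ψ r‖ := hsub (show r ∈ Ioo l 1 from ⟨by linarith, hr.2⟩)
  -- A real supremum over an unbounded family would be 0, so boundedness must be checked before
  -- comparing it with a single term.
  have hbdd : BddAbove (range fun a : Circle => ‖compCLM (Ψ := Ψ) hφ hmaps (uElem Ψ a r)‖) := by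
    refine ⟨‖compCLM (Ψ := Ψ) hφ hmaps‖ * (1 / growth Ψ r), ?_⟩
    rintro _ ⟨b, rfl⟩
    exact ((compCLM hφ hmaps).le_opNorm _).trans
      (mul_le_mul_of_nonneg_left (norm_uElem_le b hr) (norm_nonneg _))
  have h2 : ‖compCLM (Ψ := Ψ) hφ hmaps (uElem Ψ a r)‖ < 1 / (9 * A * growth Ψ r) := by
    calc _ ≤ _ := le_ciSup hbdd a
      _ ≤ _ := (le_abs_self _).trans h1
      _ < _ := by
        rw [Real.norm_of_nonneg (by positivity), div_mul_div_comm, mul_one]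
        exact one_div_lt_one_div_of_lt (by positivity) (by nlinarith [mul_pos hA' hX])
  set D := 9 * A * growth Ψ r with hD
  have hD0 : 0 < D := by positivity
  have hcD : ENNReal.ofReal (1 / D) ≠ 0 := by simpa using hD0
  have hK : ∀ n, ∫⁻ t, Ψ.eval (‖uFun a r (φ (circleMap 0 (radSeq n) t))‖ₑ / ENNReal.ofReal (1 / D))
      ∂circleMeasure ≤ 1 := fun n => by
    refine le_trans (le_of_eq (lintegral_congr fun t => ?_))
      (lintegral_eval_slice_le_one h2 (radSeq_mem n))
    have hm := circleMap_mem_unitBall (radSeq_mem n) t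
    rw [compCLM_apply hφ hmaps _ hm, uElem_apply a hr (hmaps hm)]
  refine (measure_boundaryValue_mul_le hφ hmaps
    (g := fun w => Ψ.eval (‖uFun a r w‖ₑ / ENNReal.ofReal (1 / D))) (fun w hw => ?_) hK
    (E := {w | ‖w - a‖ ≤ 2 * s}) (measurableSet_le (by fun_prop) measurable_const)
    fun w hwE hw => ?_).trans (by simp)
  · have hc := (Ψ.continuous_eval.comp
      ((ENNReal.continuous_div_const _ hcD).comp continuous_enorm)).continuousAt
      (x := uFun a r w)
    exact ContinuousAt.comp (f := uFun a r) hc ((continuousAt_vFun a hr hw).pow 2)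
  · rw [OrliczFunction.chi]
    refine Ψ.eval_mono ?_
    have hs' : s = 1 - r := by rw [hrdef]; ring
    rw [enorm_div_ofReal_inv hD0, hs', ← ofReal_growth, ← ENNReal.ofReal_coe_nnreal,
      ← ENNReal.ofReal_mul hA'.le, ← ofReal_norm, ← ENNReal.ofReal_mul (norm_nonneg _)]
    refine ENNReal.ofReal_le_ofReal ?_
    have h9 := one_ninth_le_sq_norm_vFun hr hw (a := a) (by rw [← hs']; exact hwE)
    rw [uFun_eq_sq, norm_pow, hD]
    have := mul_le_mul_of_nonneg_right h9 hD0.le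
    calc (A : ℝ) * growth Ψ r = 1 / 9 * D := by rw [hD]; ring
      _ ≤ _ := by rw [← hD]; exact this

/-- Radial projection to the circle moves w by 1 - |w| < s, and rounding the angle down to a
multiple of 2π/N moves it by at most s: hence the radius 2s. There are N + 1 indices because θ = 2π
rounds to j = N. -/
theorem exists_window_of_norm {w : ℂ} {s : ℝ} (hs0 : 0 < s) (hs1 : s < 1) (hw : 1 - ‖w‖ < s)
    (hw1 : ‖w‖ ≤ 1) {N : ℕ} (hN : 2 * Real.pi / s ≤ N) :
    ∃ j ∈ Finset.range (N + 1), ‖w - Circle.exp (2 * Real.pi * j / N)‖ ≤ 2 * s := by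
  have hpi := Real.two_pi_pos
  have hNpos : (0 : ℝ) < N := lt_of_lt_of_le (by positivity) hN
  have hwpos : 0 < ‖w‖ := by linarith
  obtain ⟨θ, hθ, hθw⟩ : ∃ θ ∈ Ioc 0 (2 * Real.pi), circleMap 0 ‖w‖ θ = w := by
    have hmem : w ∈ circleMap 0 ‖w‖ '' Ioc 0 (2 * Real.pi) := by
      rw [image_circleMap_Ioc]; simp
    exact hmem
  set x := θ * N / (2 * Real.pi) with hx
  have hx0 : 0 ≤ x := div_nonneg (mul_nonneg hθ.1.le hNpos.le) hpi.le
  have hxN : x ≤ N := by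
    rw [hx, div_le_iff₀ hpi]
    nlinarith [hθ.2]
  refine ⟨⌊x⌋₊, ?_, ?_⟩
  · rw [Finset.mem_range, Nat.lt_succ_iff]
    exact Nat.floor_le_of_le hxN
  · set β := 2 * Real.pi * ⌊x⌋₊ / N with hβ
    have hβθ : |θ - β| ≤ s := by
      have h1 := Nat.floor_le hx0
      have h2 := (Nat.lt_floor_add_one x).le
      have e : θ - β = (x - ⌊x⌋₊) * (2 * Real.pi / N) := by
        rw [hβ, hx]
        field_simp
      rw [e, abs_of_nonneg (mul_nonneg (by linarith) (by positivity))]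
      calc (x - ⌊x⌋₊) * (2 * Real.pi / N) ≤ 1 * (2 * Real.pi / N) := by
            gcongr
            linarith
        _ ≤ s := by
            rw [one_mul, div_le_iff₀ hNpos]
            rw [div_le_iff₀ hs0] at hN
            linarith
    have hcirc : (Circle.exp β : ℂ) = circleMap 0 1 β := by
      rw [Circle.coe_exp]; simp [circleMap]
    have h3 : ‖circleMap 0 1 θ - circleMap 0 1 β‖ ≤ |θ - β| := by
      have := (lipschitzWith_circleMap 0 1).dist_le_mul θ β
      simpa [dist_eq_norm, Real.dist_eq] using this
    have h4 : ‖w - circleMap 0 1 θ‖ = 1 - ‖w‖ := by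
      have e : w - circleMap 0 1 θ = ((‖w‖ - 1 : ℝ) : ℂ) * circleMap 0 1 θ := by
        conv_lhs => rw [← hθw, ← mul_circleMap_one]
        push_cast
        ring
      rw [e, norm_mul, Complex.norm_real, Real.norm_eq_abs, abs_of_nonpos (by linarith)]
      simp
    rw [hcirc]
    calc ‖w - circleMap 0 1 β‖ ≤ ‖w - circleMap 0 1 θ‖ + ‖circleMap 0 1 θ - circleMap 0 1 β‖ :=
          norm_sub_le_norm_sub_add_norm_sub _ _ _
      _ ≤ 2 * s := by linarith

/-- About x = 1/s windows cover the annulus. With A' ≥ 1 one has x ≤ χ_{A'}(x), so the loss x is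
absorbed by x χ_{A'}(x) ≤ χ_{A'}(x)² ≤ χ_{αA'}(x), for which the window hypothesis holds. -/
theorem ChiWindow.chiTail (hΨ : Ψ.SatisfiesDelta2) (hφ : DifferentiableOn ℂ φ (Metric.ball 0 1))
    (hmaps : MapsTo φ (Metric.ball 0 1) (Metric.ball 0 1)) (h : ChiWindow Ψ φ) :
    ChiTail Ψ φ := by
  intro A hA
  obtain ⟨α, hα, hχ⟩ := hΨ.chi_sq_le
  set A' := max A 1 with hA'
  have hA'0 : 0 < A' := zero_lt_one.trans_le (le_max_right _ _)
  obtain ⟨x₀, hx₀, hsq⟩ := hχ A' hA'0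
  obtain ⟨K, δ, hδ, hK⟩ := h (α * A') (mul_pos (zero_lt_one.trans hα) hA'0)
  -- The last entry of the minimum forces 1/s ≥ x₀, where Δ² applies. The 9 comes from N + 1 ≤ 2π/s
  -- + 2 with s < 1.
  refine ⟨9 * K, min (min δ 1) (1 / (x₀.toReal + 1)), lt_min (lt_min hδ one_pos) ?_,
    fun s hs => ?_⟩
  · have := ENNReal.toReal_nonneg (a := x₀)
    positivity
  have hs0 : 0 < s := hs.1
  have hsδ : s < δ := hs.2.trans_le ((min_le_left _ _).trans (min_le_left _ _))
  have hs1 : s < 1 := hs.2.trans_le ((min_le_left _ _).trans (min_le_right _ _))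
  have hsx : s < 1 / (x₀.toReal + 1) := hs.2.trans_le (min_le_right _ _)
  set x := ENNReal.ofReal (1 / s) with hx
  have hxx : x₀ ≤ x := by
    refine ENNReal.le_ofReal_iff_toReal_le hx₀ (by positivity) |>.2 ?_
    have := ENNReal.toReal_nonneg (a := x₀)
    rw [le_div_iff₀ hs0]
    rw [lt_div_iff₀ (by positivity)] at hsx
    nlinarith
  set N := ⌈2 * Real.pi / s⌉₊ with hN
  have hNle : ((N + 1 : ℕ) : ℝ≥0∞) ≤ 9 * x := by
    have h1 : ((N + 1 : ℕ) : ℝ) ≤ 9 * (1 / s) := by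
      have h2 := (Nat.ceil_lt_add_one (show 0 ≤ 2 * Real.pi / s by
        have := Real.pi_pos; positivity)).le
      have h3 : 2 * Real.pi / s + 2 ≤ 9 * (1 / s) := by
        rw [mul_one_div, div_add' _ _ _ hs0.ne']
        refine div_le_div_of_nonneg_right ?_ hs0.le
        linarith [Real.pi_lt_d2]
      push_cast
      linarith
    rw [hx, ← ENNReal.ofReal_ofNat, ← ENNReal.ofReal_mul (by norm_num), ← ENNReal.ofReal_natCast]
    exact ENNReal.ofReal_le_ofReal h1
  set E : ℕ → Set ℝ := fun j =>
    {t | ‖boundaryValue φ t - Circle.exp (2 * Real.pi * j / N)‖ ≤ 2 * s} with hE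
  have hcover : circleMeasure {t | 1 - ‖boundaryValue φ t‖ < s} ≤
      ∑ j ∈ Finset.range (N + 1), circleMeasure (E j) := by
    refine le_trans (measure_mono_ae ?_) (measure_biUnion_finset_le (Finset.range (N + 1)) E)
    filter_upwards [ae_norm_boundaryValue_le hφ hmaps] with t ht hts
    obtain ⟨j, hj, hj'⟩ := exists_window_of_norm hs0 hs1 hts ht (Nat.le_ceil (2 * Real.pi / s))
    exact mem_biUnion (show j ∈ (Finset.range (N + 1) : Set ℕ) from hj) hj'
  have hχA : Ψ.chi A x ≤ Ψ.chi A' x :=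
    Ψ.chi_mono_left x (ENNReal.coe_le_coe.2 (le_max_left _ _))
  have hxχ : x ≤ Ψ.chi A' x := by
    calc x = Ψ.chi 1 x := (Ψ.chi_one x).symm
      _ ≤ _ := Ψ.chi_mono_left x (by exact_mod_cast le_max_right A 1)
  have hterm : ∀ j, x * (circleMeasure (E j) * Ψ.chi A' x) ≤ K := fun j => by
    calc x * (circleMeasure (E j) * Ψ.chi A' x)
        ≤ Ψ.chi A' x * (circleMeasure (E j) * Ψ.chi A' x) := by gcongr
      _ = circleMeasure (E j) * Ψ.chi A' x ^ 2 := by ring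
      _ ≤ circleMeasure (E j) * Ψ.chi (α * A' : ℝ≥0) x := by gcongr; exact hsq x hxx
      _ ≤ K := hK s ⟨hs0, hsδ⟩ _
  have hx0 : x ≠ 0 := by simpa [hx] using hs0
  have hxt : x ≠ ⊤ := ENNReal.ofReal_ne_top
  calc circleMeasure {t | 1 - ‖boundaryValue φ t‖ < s} * Ψ.chi A x
      ≤ (∑ j ∈ Finset.range (N + 1), circleMeasure (E j)) * Ψ.chi A' x := by gcongr
    _ = ∑ j ∈ Finset.range (N + 1), circleMeasure (E j) * Ψ.chi A' x := Finset.sum_mul _ _ _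
    _ ≤ ∑ j ∈ Finset.range (N + 1), K / x := by
        refine Finset.sum_le_sum fun j _ => ?_
        rw [ENNReal.le_div_iff_mul_le (Or.inl hx0) (Or.inl hxt), mul_comm]
        exact hterm j
    _ = ((N + 1 : ℕ) : ℝ≥0∞) * (K / x) := by simp
    _ ≤ 9 * x * (K / x) := by gcongr
    _ = 9 * K := by rw [mul_assoc, ENNReal.mul_div_cancel hx0 hxt]
    _ = ((9 * K : ℝ≥0) : ℝ≥0∞) := by push_cast; rfl

end Window
end

/-! ### Convergence of slices in L¹ and norms from boundary values. -/

noncomputable section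

namespace OrliczFunction

variable (Ψ : OrliczFunction)

/-- Superlinearity of `Ψ` as a truncation inequality. -/
theorem exists_le_min_add_eval {ε D : ℝ} (hε : 0 < ε) (hD : 0 < D) :
    ∃ M : ℝ≥0∞, M ≠ ⊤ ∧ ∀ x : ℝ≥0∞,
      x ≤ min x M + ENNReal.ofReal ε * Ψ.eval (x / ENNReal.ofReal D) := by
  -- Beyond Y one has Ψ(y) ≥ (D/ε) y, so x is absorbed by the modular term once x/D ≥ Y.
  obtain ⟨Y, hY⟩ := eventually_atTop.1
    (((Ψ.tendsto_div.eventually_ge_atTop (D / ε))).and (eventually_gt_atTop 0))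
  refine ⟨ENNReal.ofReal (D * Y), ENNReal.ofReal_ne_top, fun x => ?_⟩
  rcases le_total x (ENNReal.ofReal (D * Y)) with hx | hx
  · rw [min_eq_left hx]; exact le_self_add
  refine le_trans ?_ le_add_self
  by_cases hxt : x = ⊤
  · rw [hxt, ENNReal.top_div_of_ne_top ENNReal.ofReal_ne_top, Ψ.eval_top, ENNReal.mul_top]
    simpa using hε
  have h1 : D * Y ≤ x.toReal := (ENNReal.ofReal_le_iff_le_toReal hxt).1 hx
  have h2 : Y ≤ x.toReal / D := by rw [le_div_iff₀ hD]; linarith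
  obtain ⟨h3, h4⟩ := hY _ h2
  rw [le_div_iff₀ h4] at h3
  have h5 : x.toReal ≤ ε * Ψ.toFun (x.toReal / D) := by
    calc x.toReal = ε * (D / ε * (x.toReal / D)) := by field_simp
      _ ≤ _ := by gcongr
  conv_lhs => rw [← ENNReal.ofReal_toReal hxt]
  conv_rhs => rw [← ENNReal.ofReal_toReal hxt]
  rw [← ENNReal.ofReal_div_of_pos hD, Ψ.eval_ofReal h4.le, ← ENNReal.ofReal_mul hε.le]
  exact ENNReal.ofReal_le_ofReal h5

theorem eval_enorm_sub_le (x y : ℂ) (c : ℝ) :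
    Ψ.eval (‖x - y‖ₑ / ENNReal.ofReal (2 * c)) ≤
      2⁻¹ * Ψ.eval (‖x‖ₑ / ENNReal.ofReal c) + 2⁻¹ * Ψ.eval (‖y‖ₑ / ENNReal.ofReal c) := by
  refine (Ψ.eval_mono ?_).trans (Ψ.eval_convex ENNReal.inv_two_add_inv_two)
  rw [← mul_add, ← ENNReal.add_div, ENNReal.ofReal_mul (by norm_num), ENNReal.ofReal_ofNat,
    div_eq_mul_inv, div_eq_mul_inv, ENNReal.mul_inv (Or.inl two_ne_zero)
    (Or.inl ENNReal.ofNat_ne_top), mul_left_comm]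
  gcongr
  exact enorm_sub_le

/-- Almost everywhere convergence and a modular bound give convergence in `L¹`. -/
theorem tendsto_lintegral_sub_of_modular {k : ℕ → ℝ → ℂ} {l : ℝ → ℂ} {c : ℝ} (hc : 0 < c)
    (hk : ∀ n, AEStronglyMeasurable (k n) circleMeasure)
    (hl : ∀ᵐ t ∂circleMeasure, Tendsto (fun n => k n t) atTop (𝓝 (l t)))
    (hK : ∀ n, ∫⁻ t, Ψ.eval (‖k n t‖ₑ / ENNReal.ofReal c) ∂circleMeasure ≤ 1) :
    Integrable l circleMeasure ∧
      Tendsto (fun n => ∫⁻ t, ‖k n t - l t‖ₑ ∂circleMeasure) atTop (𝓝 0) := by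
  have hc0 : ENNReal.ofReal c ≠ 0 := by simpa using hc
  have hlm : AEStronglyMeasurable l circleMeasure := aestronglyMeasurable_of_tendsto_ae atTop hk hl
  have hlK := Ψ.lintegral_eval_le_of_tendsto hc0 hk hl hK
  have hevm : ∀ {f : ℝ → ℂ}, AEStronglyMeasurable f circleMeasure → ∀ D : ℝ≥0∞,
      AEMeasurable (fun t => Ψ.eval (‖f t‖ₑ / D)) circleMeasure := fun hf D =>
    Ψ.measurable_eval.comp_aemeasurable (hf.enorm.div_const D)
  refine ⟨⟨hlm, ?_⟩, ?_⟩
  · obtain ⟨M, hM, hMx⟩ := Ψ.exists_le_min_add_eval one_pos hc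
    calc ∫⁻ t, ‖l t‖ₑ ∂circleMeasure
        ≤ ∫⁻ t, (M + Ψ.eval (‖l t‖ₑ / ENNReal.ofReal c)) ∂circleMeasure := by
          refine lintegral_mono fun t => (hMx _).trans ?_
          rw [ENNReal.ofReal_one, one_mul]
          gcongr
          exact min_le_right _ _
      _ = M + ∫⁻ t, Ψ.eval (‖l t‖ₑ / ENNReal.ofReal c) ∂circleMeasure := by
          rw [lintegral_add_left measurable_const]; simp
      _ < ⊤ := ENNReal.add_lt_top.2 ⟨hM.lt_top, hlK.trans_lt ENNReal.one_lt_top⟩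
  · have hd : ∀ n, ∫⁻ t, Ψ.eval (‖k n t - l t‖ₑ / ENNReal.ofReal (2 * c)) ∂circleMeasure ≤ 1 := by
      intro n
      calc _ ≤ ∫⁻ t, (2⁻¹ * Ψ.eval (‖k n t‖ₑ / ENNReal.ofReal c) +
              2⁻¹ * Ψ.eval (‖l t‖ₑ / ENNReal.ofReal c)) ∂circleMeasure :=
            lintegral_mono fun t => Ψ.eval_enorm_sub_le _ _ c
        _ = 2⁻¹ * ∫⁻ t, Ψ.eval (‖k n t‖ₑ / ENNReal.ofReal c) ∂circleMeasure +
              2⁻¹ * ∫⁻ t, Ψ.eval (‖l t‖ₑ / ENNReal.ofReal c) ∂circleMeasure := by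
            rw [lintegral_add_left' ((hevm (hk n) _).const_mul _),
              lintegral_const_mul' _ _ (by simp), lintegral_const_mul' _ _ (by simp)]
        _ ≤ 2⁻¹ * 1 + 2⁻¹ * 1 := by gcongr; exact hK n
        _ = 1 := by rw [mul_one, ENNReal.inv_two_add_inv_two]
    rw [ENNReal.tendsto_nhds_zero]
    intro ε hε
    obtain ⟨e, he0, he⟩ : ∃ e : ℝ, 0 < e ∧ ENNReal.ofReal (2 * e) ≤ ε := by
      obtain ⟨e, he0, he⟩ := ENNReal.lt_iff_exists_real_btwn.1 hε
      refine ⟨e / 2, ?_, ?_⟩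
      · have := ENNReal.ofReal_pos.1 he.1
        linarith
      · rw [mul_div_cancel₀ _ (two_ne_zero)]
        exact he.2.le
    -- The truncated difference tends to 0 by dominated convergence; the excess over M costs at most
    -- e times the modular at scale 2c, whatever n is.
    obtain ⟨M, hM, hMx⟩ := Ψ.exists_le_min_add_eval he0 (show (0 : ℝ) < 2 * c by linarith)
    have hmin : Tendsto (fun n => ∫⁻ t, min ‖k n t - l t‖ₑ M ∂circleMeasure) atTop (𝓝 0) := by
      have h0 : ∫⁻ _, (0 : ℝ≥0∞) ∂circleMeasure = 0 := by simp
      rw [← h0]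
      refine tendsto_lintegral_of_dominated_convergence' (fun _ => M)
        (fun n => ((hk n).sub hlm).enorm.min aemeasurable_const)
        (fun n => ae_of_all _ fun t => min_le_right _ _) (by simpa using hM) ?_
      filter_upwards [hl] with t ht
      have h1 : Tendsto (fun n => ‖k n t - l t‖ₑ) atTop (𝓝 0) := by
        have := (continuous_enorm.tendsto _).comp (ht.sub_const (l t))
        simpa [Function.comp_def] using this
      have h2 := h1.min (tendsto_const_nhds (x := M))
      rwa [min_eq_left zero_le] at h2
    have he' : (0 : ℝ≥0∞) < ENNReal.ofReal e := ENNReal.ofReal_pos.2 he0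
    filter_upwards [ENNReal.tendsto_nhds_zero.1 hmin _ he'] with n hn
    calc ∫⁻ t, ‖k n t - l t‖ₑ ∂circleMeasure
        ≤ ∫⁻ t, (min ‖k n t - l t‖ₑ M +
            ENNReal.ofReal e * Ψ.eval (‖k n t - l t‖ₑ / ENNReal.ofReal (2 * c))) ∂circleMeasure :=
          lintegral_mono fun t => hMx _
      _ = ∫⁻ t, min ‖k n t - l t‖ₑ M ∂circleMeasure + ENNReal.ofReal e *
            ∫⁻ t, Ψ.eval (‖k n t - l t‖ₑ / ENNReal.ofReal (2 * c)) ∂circleMeasure := by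
          have hm : AEMeasurable (fun t => min ‖k n t - l t‖ₑ M) circleMeasure :=
            ((hk n).sub hlm).enorm.min aemeasurable_const
          rw [lintegral_add_left' hm, lintegral_const_mul' _ _ ENNReal.ofReal_ne_top]
      _ ≤ ENNReal.ofReal e + ENNReal.ofReal e * 1 := by gcongr; exact hd n
      _ = ENNReal.ofReal (2 * e) := by
          rw [mul_one, ← ENNReal.ofReal_add he0.le he0.le, two_mul]
      _ ≤ ε := he

end OrliczFunction

namespace HardyOrlicz

variable {Ψ : OrliczFunction} {φ : ℂ → ℂ}

/-- The norm of `g ∈ H^Ψ` is controlled by the modular of its boundary function. -/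
theorem norm_le_of_boundary {g : HardyOrlicz Ψ} {l : ℝ → ℂ}
    (hl : ∀ᵐ t ∂circleMeasure, Tendsto (fun n => g (circleMap 0 (radSeq n) t)) atTop (𝓝 (l t)))
    {c : ℝ} (hc : 0 < c) (h : ∫⁻ t, Ψ.eval (‖l t‖ₑ / ENNReal.ofReal c) ∂circleMeasure ≤ 1) :
    ‖g‖ ≤ c := by
  have hkm : ∀ n, AEStronglyMeasurable (fun t => g (circleMap 0 (radSeq n) t)) circleMeasure :=
    fun n => (g.integrable_slice (radSeq_mem n)).1
  obtain ⟨hli, hL1⟩ := Ψ.tendsto_lintegral_sub_of_modular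
    (show 0 < ‖g‖ + 1 by positivity) hkm hl
    fun n => lintegral_eval_slice_le_one (lt_add_one _) (radSeq_mem n)
  -- Convergence of the slices in L¹ lets Poisson's formula pass to the limit, so g is the Poisson
  -- integral of its boundary function.
  have hrep : ∀ z ∈ Metric.ball (0 : ℂ) 1, ∫ t, discPoisson z t • l t ∂circleMeasure = g z := by
    intro z hz
    have hPm : AEStronglyMeasurable (discPoisson z) circleMeasure :=
      (continuous_discPoisson hz).aestronglyMeasurable
    set Q := (1 + ‖z‖) / (1 - ‖z‖) with hQ
    have hPb : ∀ t, ‖discPoisson z t‖ ≤ Q := fun t => by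
      rw [Real.norm_of_nonneg (discPoisson_nonneg hz t)]
      exact discPoisson_le hz t
    have hint : ∀ {f : ℝ → ℂ}, Integrable f circleMeasure →
        Integrable (fun t => discPoisson z t • f t) circleMeasure := fun hf =>
      hf.bdd_smul Q hPm (ae_of_all _ hPb)
    have h1 : Tendsto (fun n => ∫ t, discPoisson z t • g (circleMap 0 (radSeq n) t)
        ∂circleMeasure) atTop (𝓝 (∫ t, discPoisson z t • l t ∂circleMeasure)) := by
      refine tendsto_integral_of_L1 _ (hint hli).1
        (Eventually.of_forall fun n => hint (g.integrable_slice (radSeq_mem n))) ?_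
      have h2 : Tendsto (fun n => ENNReal.ofReal Q *
          ∫⁻ t, ‖g (circleMap 0 (radSeq n) t) - l t‖ₑ ∂circleMeasure) atTop (𝓝 0) := by
        have := ENNReal.Tendsto.const_mul hL1 (Or.inr (ENNReal.ofReal_ne_top (r := Q)))
        rwa [mul_zero] at this
      refine tendsto_of_tendsto_of_tendsto_of_le_of_le tendsto_const_nhds h2 (fun _ => zero_le)
        fun n => ?_
      rw [← lintegral_const_mul' _ _ ENNReal.ofReal_ne_top]
      refine lintegral_mono fun t => ?_
      rw [← smul_sub, enorm_smul, ← ofReal_norm]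
      exact mul_le_mul_left (ENNReal.ofReal_le_ofReal (hPb t)) _
    simp_rw [integral_discPoisson_smul_slice g.differentiableOn (radSeq_mem _) hz] at h1
    exact tendsto_nhds_unique h1 (g.tendsto_apply_radSeq_mul hz)
  -- Subordination with q = id, whose distortion constant is 1, bounds every slice by the boundary
  -- modular.
  have h3 := norm_le_of_lintegral_le (f := g) hc le_rfl fun r hr => by
    refine (Ψ.lintegral_eval_comp_le hli hrep differentiableOn_id (mapsTo_id _) hr
      (by simpa using hc) ENNReal.ofReal_ne_top).trans ?_
    simpa using h
  simpa using h3

/-- Elements of H^Ψ are set to 0 off the disc and need not be continuous at points of the circle. A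
representative F is therefore allowed, such as u_{a,r}, which is continuous across the circle. -/
theorem tendsto_compCLM_boundary (hφ : DifferentiableOn ℂ φ (Metric.ball 0 1))
    (hmaps : MapsTo φ (Metric.ball 0 1) (Metric.ball 0 1)) (f : HardyOrlicz Ψ) {F : ℂ → ℂ}
    (hF : ∀ z ∈ Metric.ball (0 : ℂ) 1, f z = F z) {t : ℝ}
    (ht : Tendsto (fun r => φ (circleMap 0 r t)) (𝓝[<] 1) (𝓝 (boundaryValue φ t)))
    (hc : ContinuousAt F (boundaryValue φ t)) :
    Tendsto (fun r => compCLM hφ hmaps f (circleMap 0 r t)) (𝓝[<] 1)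
      (𝓝 (F (boundaryValue φ t))) := by
  refine (hc.tendsto.comp ht).congr' ?_
  filter_upwards [Ioo_mem_nhdsLT (zero_lt_one' ℝ)] with r hr
  have hm := circleMap_mem_unitBall ⟨hr.1.le, hr.2⟩ t
  rw [compCLM_apply hφ hmaps f hm, hF _ (hmaps hm)]
  rfl

theorem continuousAt_of_mem_ball (f : HardyOrlicz Ψ) {z : ℂ} (hz : z ∈ Metric.ball (0 : ℂ) 1) :
    ContinuousAt f z :=
  f.differentiableOn.continuousOn.continuousAt (Metric.isOpen_ball.mem_nhds hz)

end HardyOrlicz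

open HardyOrlicz

/-! ### Order boundedness, smallness estimates and the little-o condition. -/

section Equivalences

variable {Ψ : OrliczFunction} {φ : ℂ → ℂ}

theorem ChiFiniteIntegral.orderBounded (hφ : DifferentiableOn ℂ φ (Metric.ball 0 1))
    (hmaps : MapsTo φ (Metric.ball 0 1) (Metric.ball 0 1)) (h : ChiFiniteIntegral Ψ φ) :
    OrderBoundedIntoMorseTransue (compCLM (Ψ := Ψ) hφ hmaps) := by
  -- The real conversion sends ∞ to 0. This only lowers the modular, and the majorant is needed only
  -- where |φ*| < 1, which is almost everywhere.
  refine ⟨fun t => (4 * Ψ.inv (1 / (1 - ‖boundaryValue φ t‖ₑ))).toReal, ⟨?_, fun C hC => ?_⟩,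
    fun f hf => ?_⟩
  · exact ((Ψ.inv_mono.measurable.comp_aemeasurable
      (aemeasurable_one_div hφ hmaps)).const_mul 4).ennreal_toReal.aestronglyMeasurable
  · refine lt_of_le_of_lt (lintegral_mono fun t => ?_) (h (4 * C⁻¹) (by positivity))
    refine Ψ.eval_mono ?_
    rw [← ofReal_norm, Real.norm_of_nonneg ENNReal.toReal_nonneg, ENNReal.coe_mul,
      ENNReal.coe_inv hC.ne', ENNReal.coe_ofNat, div_eq_mul_inv, mul_right_comm]
    gcongr
    exact ENNReal.ofReal_toReal_le
  · filter_upwards [ae_tendsto_boundaryValue hφ hmaps, h.ae_mem_ball hφ hmaps] with t ht hb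
    rw [boundaryValue_eq (tendsto_compCLM_boundary hφ hmaps f (fun _ _ => rfl) ht
      (f.continuousAt_of_mem_ball hb))]
    have h1 := f.enorm_apply_le hb
    have hne : 4 * Ψ.inv (1 / (1 - ‖boundaryValue φ t‖ₑ)) ≠ ⊤ :=
      ENNReal.mul_ne_top (by norm_num) (Ψ.inv_ne_top (one_div_one_sub_enorm_ne_top hb))
    rw [← toReal_enorm]
    refine ENNReal.toReal_mono hne (h1.trans ?_)
    gcongr
    rw [← ENNReal.ofReal_ofNat]
    exact ENNReal.ofReal_le_ofReal (by linarith)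

/-- Test with a in the direction of w and 1 - r comparable to 1 - |w|: then w lies in the window at
a and |u| ≥ 1/9. If |w| = 1, every n is admissible and the growth is unbounded, which contradicts g
being finite. -/
theorem inv_le_of_forall_growth_le {w : ℂ} (hw : ‖w‖ ≤ 1) {g : ℝ}
    (h : ∀ n, ∀ a : Circle, growth Ψ (radSeq n) * ‖uFun a (radSeq n) w‖ ≤ g) :
    Ψ.inv (1 / (1 - ‖w‖ₑ)) ≤ ENNReal.ofReal (9 * g) := by
  have hrad : ∀ n, 1 / (1 - radSeq n) = (n : ℝ) + 1 := fun n => by simp [radSeq]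
  have hrad' : ∀ n : ℕ, 1 - radSeq n = 1 / ((n : ℝ) + 1) := fun n => by simp [radSeq]
  obtain ⟨a, ha⟩ : ∃ a : Circle, ‖w - a‖ = 1 - ‖w‖ := by
    by_cases h0 : w = 0
    · exact ⟨1, by simp [h0]⟩
    have hn : ‖w‖ ≠ 0 := norm_ne_zero_iff.2 h0
    refine ⟨Circle.exp w.arg, ?_⟩
    have e : w - Circle.exp w.arg = ((‖w‖ - 1 : ℝ) : ℂ) * Circle.exp w.arg := by
      have h1 := Complex.norm_mul_exp_arg_mul_I w
      rw [Circle.coe_exp]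
      push_cast
      linear_combination -h1
    rw [e, norm_mul, Circle.norm_coe, mul_one, Complex.norm_real, Real.norm_eq_abs,
      abs_of_nonpos (by linarith)]
    ring
  have key : ∀ n : ℕ, 1 - ‖w‖ ≤ 2 / ((n : ℝ) + 1) →
      Ψ.inv (ENNReal.ofReal (n + 1)) ≤ ENNReal.ofReal (9 * g) := fun n hn => by
    have h1 := h n a
    have h2 := one_ninth_le_sq_norm_vFun (radSeq_mem n) hw (a := a) (by
      rw [ha, hrad', mul_one_div]
      exact hn)
    rw [← hrad n, ← ofReal_growth]
    refine ENNReal.ofReal_le_ofReal ?_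
    rw [uFun_eq_sq, norm_pow] at h1
    have := mul_le_mul_of_nonneg_left h2 (growth_nonneg Ψ (radSeq n))
    linarith
  rcases hw.lt_or_eq with hlt | heq
  · have hpos : 0 < 1 - ‖w‖ := by linarith
    rw [one_div_one_sub_enorm (by simpa using hlt)]
    set x := 1 / (1 - ‖w‖) with hx
    have hx1 : 1 ≤ x := by
      rw [hx, le_div_iff₀ hpos]
      linarith [norm_nonneg w]
    -- With n + 1 = ⌈x⌉ and x ≥ 1 one has x ≤ n + 1 ≤ 2x: large enough for the growth, small enough
    -- for the window.
    have hceil : 0 < ⌈x⌉₊ := Nat.ceil_pos.2 (by linarith)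
    obtain ⟨n, hn⟩ := Nat.exists_eq_succ_of_ne_zero hceil.ne'
    have hn' : (⌈x⌉₊ : ℝ) = n + 1 := by rw [hn]; push_cast; ring
    have h1 : x ≤ n + 1 := hn' ▸ Nat.le_ceil x
    have h2 : (n : ℝ) + 1 ≤ 2 * x := by
      have := Nat.ceil_lt_add_one (show 0 ≤ x by linarith)
      rw [hn'] at this
      linarith
    refine (Ψ.inv_mono (ENNReal.ofReal_le_ofReal h1)).trans (key n ?_)
    rw [le_div_iff₀ (by positivity)]
    have h3 : (1 - ‖w‖) * x = 1 := mul_one_div_cancel hpos.ne'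
    nlinarith
  · exfalso
    obtain ⟨n, hn⟩ := exists_nat_gt (Ψ.eval (ENNReal.ofReal (9 * g))).toReal
    have h1 := key n (by rw [heq, sub_self]; positivity)
    have h2 := Ψ.eval_mono h1
    rw [Ψ.eval_inv, ENNReal.ofReal_le_iff_le_toReal (Ψ.eval_ne_top ENNReal.ofReal_ne_top)] at h2
    linarith

theorem ChiFiniteIntegral.of_orderBounded (hφ : DifferentiableOn ℂ φ (Metric.ball 0 1))
    (hmaps : MapsTo φ (Metric.ball 0 1) (Metric.ball 0 1))
    (h : OrderBoundedIntoMorseTransue (compCLM (Ψ := Ψ) hφ hmaps)) : ChiFiniteIntegral Ψ φ := by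
  obtain ⟨g, ⟨-, hg⟩, hdom⟩ := h
  -- Each test function has its own exceptional null set, so only countably many are used: the radii
  -- `radSeq n` and a dense sequence of a. Continuity in a recovers the rest.
  have hall : ∀ᵐ t ∂circleMeasure, ∀ n k, growth Ψ (radSeq n) *
      ‖uFun (TopologicalSpace.denseSeq Circle k) (radSeq n) (boundaryValue φ t)‖ ≤ g t := by
    rw [ae_all_iff]
    intro n
    rw [ae_all_iff]
    intro k
    set a := TopologicalSpace.denseSeq Circle k
    have hX := growth_pos Ψ (radSeq_mem n).2
    have hnorm : ‖(growth Ψ (radSeq n) : ℂ) • uElem Ψ a (radSeq n)‖ ≤ 1 := by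
      rw [norm_smul, Complex.norm_real, Real.norm_of_nonneg hX.le]
      calc _ ≤ growth Ψ (radSeq n) * (1 / growth Ψ (radSeq n)) :=
            mul_le_mul_of_nonneg_left (norm_uElem_le a (radSeq_mem n)) hX.le
        _ = 1 := mul_one_div_cancel hX.ne'
    filter_upwards [hdom _ hnorm, ae_tendsto_boundaryValue hφ hmaps,
      ae_norm_boundaryValue_le hφ hmaps] with t h1 ht ht1
    rw [boundaryValue_eq (tendsto_compCLM_boundary hφ hmaps _
      (F := fun z => (growth Ψ (radSeq n) : ℂ) * uFun a (radSeq n) z) (fun z hz => by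
        rw [smul_apply, uElem_apply a (radSeq_mem n) hz]) ht
      (continuousAt_const.mul ((continuousAt_vFun a (radSeq_mem n) ht1).pow 2))), norm_mul,
      Complex.norm_real, Real.norm_of_nonneg hX.le] at h1
    exact h1
  have hle : ∀ᵐ t ∂circleMeasure,
      Ψ.inv (1 / (1 - ‖boundaryValue φ t‖ₑ)) ≤ ENNReal.ofReal (9 * g t) := by
    filter_upwards [hall, ae_norm_boundaryValue_le hφ hmaps] with t ht ht1
    refine inv_le_of_forall_growth_le ht1 fun n a => ?_
    refine (TopologicalSpace.denseRange_denseSeq Circle).induction_on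
      (p := fun a => growth Ψ (radSeq n) * ‖uFun a (radSeq n) (boundaryValue φ t)‖ ≤ g t) a ?_
      (ht n)
    refine isClosed_le (continuous_const.mul (Continuous.norm ?_)) continuous_const
    unfold uFun
    refine (Continuous.div continuous_const ?_
      fun a => denom_ne_zero a (radSeq_mem n) ht1).pow 2
    have : Continuous fun a : Circle => (starRingEnd ℂ) (a : ℂ) :=
      Complex.continuous_conj.comp continuous_subtype_val
    fun_prop
  intro B hB
  refine lt_of_le_of_lt (lintegral_mono_ae ?_) (hg (9 * B)⁻¹ (by positivity))
  filter_upwards [hle] with t ht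
  refine Ψ.eval_mono ?_
  have hg' : ENNReal.ofReal (9 * g t) ≤ 9 * ‖g t‖ₑ := by
    rw [ENNReal.ofReal_mul (by norm_num), ENNReal.ofReal_ofNat]
    gcongr
    rw [← ofReal_norm]
    exact ENNReal.ofReal_le_ofReal (le_abs_self _)
  rw [ENNReal.coe_inv (by positivity), ENNReal.div_eq_inv_mul (a := ‖g t‖ₑ), inv_inv,
    ENNReal.coe_mul, ENNReal.coe_ofNat]
  calc (B : ℝ≥0∞) * Ψ.inv (1 / (1 - ‖boundaryValue φ t‖ₑ)) ≤ B * (9 * ‖g t‖ₑ) := by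
        gcongr; exact ht.trans hg'
    _ = _ := by ring

/-- Under `ChiFiniteIntegral`, smallness on a compact part of the disc implies smallness of the
image under `C_φ`, uniformly on the unit ball. -/
theorem ChiFiniteIntegral.norm_compCLM_le (hφ : DifferentiableOn ℂ φ (Metric.ball 0 1))
    (hmaps : MapsTo φ (Metric.ball 0 1) (Metric.ball 0 1)) (h : ChiFiniteIntegral Ψ φ) {ε : ℝ}
    (hε : 0 < ε) : ∃ R ∈ Ico (0 : ℝ) 1, ∃ η > 0, ∀ f : HardyOrlicz Ψ, ‖f‖ ≤ 1 →
      (∀ w, ‖w‖ ≤ R → ‖f w‖ ≤ η) → ‖compCLM hφ hmaps f‖ ≤ ε := by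
  have hε0 : ENNReal.ofReal ε ≠ 0 := by simpa using hε
  -- The 4 of the growth bound divided by the target scale ε, so that Ψ(|f(φ*)|/ε) ≤ χ_B(R) on the
  -- unit ball.
  set B : ℝ≥0 := 4 * (ε.toNNReal)⁻¹ with hB
  have hB0 : 0 < B := by
    have : 0 < ε.toNNReal := Real.toNNReal_pos.2 hε
    positivity
  set Y : ℝ → ℝ≥0∞ := fun t => Ψ.chi B (1 / (1 - ‖boundaryValue φ t‖ₑ)) with hY
  have hYm : AEMeasurable Y circleMeasure :=
    (Ψ.measurable_chi B).comp_aemeasurable (aemeasurable_one_div hφ hmaps)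
  have hbm := (aestronglyMeasurable_boundaryValue hφ hmaps).aemeasurable
  have hnull : ∀ n, NullMeasurableSet {t | radSeq n < ‖boundaryValue φ t‖} circleMeasure :=
    fun n => nullMeasurableSet_lt aemeasurable_const hbm.norm
  have hlim : Tendsto (fun n => ∫⁻ t, {t | radSeq n < ‖boundaryValue φ t‖}.indicator Y t
      ∂circleMeasure) atTop (𝓝 0) := by
    have h0 : ∫⁻ _, (0 : ℝ≥0∞) ∂circleMeasure = 0 := by simp
    rw [← h0]
    refine tendsto_lintegral_of_dominated_convergence' Y (fun n => hYm.indicator₀ (hnull n))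
      (fun n => ae_of_all _ fun t => indicator_le_self _ _ t) (h B hB0).ne ?_
    filter_upwards [h.ae_mem_ball hφ hmaps] with t ht
    have ht1 : ‖boundaryValue φ t‖ < 1 := by simpa using ht
    refine tendsto_const_nhds.congr' ?_
    have h1 := (tendsto_nhds_of_tendsto_nhdsWithin tendsto_radSeq).eventually (eventually_gt_nhds ht1)
    filter_upwards [h1] with n hn
    rw [indicator_of_notMem]
    simpa using hn.le
  obtain ⟨n, hn⟩ := (ENNReal.tendsto_nhds_zero.1 hlim 2⁻¹ (by simp)).exists
  have hi0 : Ψ.inv 2⁻¹ ≠ 0 := Ψ.inv_ne_zero (by simp)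
  have hit : Ψ.inv 2⁻¹ ≠ ⊤ := Ψ.inv_ne_top (by simp)
  -- This η makes Ψ(η/ε) = 1/2, so the parts of the circle with |φ*| ≤ R and |φ*| > R each
  -- contribute at most 1/2.
  refine ⟨radSeq n, radSeq_mem n, ε * (Ψ.inv 2⁻¹).toReal,
    mul_pos hε (ENNReal.toReal_pos hi0 hit), fun f hf hsmall => ?_⟩
  refine norm_le_of_boundary (l := fun t => f (boundaryValue φ t)) ?_ hε ?_
  · filter_upwards [ae_tendsto_boundaryValue hφ hmaps, h.ae_mem_ball hφ hmaps] with t ht hb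
    exact (tendsto_compCLM_boundary hφ hmaps f (fun _ _ => rfl) ht
      (f.continuousAt_of_mem_ball hb)).comp tendsto_radSeq
  calc ∫⁻ t, Ψ.eval (‖f (boundaryValue φ t)‖ₑ / ENNReal.ofReal ε) ∂circleMeasure
      ≤ ∫⁻ t, (2⁻¹ + {t | radSeq n < ‖boundaryValue φ t‖}.indicator Y t) ∂circleMeasure := by
        refine lintegral_mono_ae ?_
        filter_upwards [h.ae_mem_ball hφ hmaps] with t hb
        by_cases ht : t ∈ {t | radSeq n < ‖boundaryValue φ t‖}
        · rw [indicator_of_mem ht]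
          refine le_trans ?_ le_add_self
          refine Ψ.eval_mono ?_
          have h1 := f.enorm_apply_le hb
          have h2 : ENNReal.ofReal (4 * ‖f‖) ≤ 4 := by
            rw [← ENNReal.ofReal_ofNat]
            exact ENNReal.ofReal_le_ofReal (by linarith)
          have hB' : (B : ℝ≥0∞) = 4 / ENNReal.ofReal ε := by
            rw [hB, ENNReal.coe_mul, ENNReal.coe_inv (Real.toNNReal_pos.2 hε).ne',
              ENNReal.coe_ofNat, div_eq_mul_inv]
            rfl
          rw [hB', ENNReal.div_eq_inv_mul, ENNReal.div_eq_inv_mul, mul_assoc]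
          gcongr
          exact h1.trans (by gcongr)
        · rw [indicator_of_notMem ht, add_zero, Ψ.eval_le_iff_le_inv]
          have h1 := hsmall _ (not_lt.1 ht)
          rw [ENNReal.div_le_iff' hε0 ENNReal.ofReal_ne_top, ← ENNReal.ofReal_toReal hit,
            ← ENNReal.ofReal_mul hε.le, ← ofReal_norm]
          exact ENNReal.ofReal_le_ofReal h1
    _ = 2⁻¹ + ∫⁻ t, {t | radSeq n < ‖boundaryValue φ t‖}.indicator Y t ∂circleMeasure := by
        rw [lintegral_add_left measurable_const]; simp
    _ ≤ 2⁻¹ + 2⁻¹ := by gcongr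
    _ = 1 := ENNReal.inv_two_add_inv_two

/-- Concavity of Ψ⁻¹ gives Ψ⁻¹(c) ≤ c Ψ⁻¹(1). Thus the normalized u_{a,r}, of order (1 - r)² times
the growth on compact discs, tend to 0 there. -/
theorem growth_mul_le {r : ℝ} (hr : r ∈ Ico (0 : ℝ) 1) :
    growth Ψ r * (1 - r) ≤ (Ψ.inv 1).toReal := by
  have h1r : (0 : ℝ) < 1 - r := by linarith [hr.2]
  have h1 : (1 : ℝ≥0∞) ≤ ENNReal.ofReal (1 / (1 - r)) := by
    rw [ENNReal.one_le_ofReal, le_div_iff₀ h1r]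
    linarith [hr.1]
  have h2 := Ψ.inv_mul_le h1 ENNReal.ofReal_ne_top 1
  rw [mul_one, ← ofReal_growth] at h2
  have hit : Ψ.inv 1 ≠ ⊤ := Ψ.inv_ne_top (by simp)
  rw [← ENNReal.ofReal_toReal hit, ← ENNReal.ofReal_mul (by positivity),
    ENNReal.ofReal_le_ofReal_iff (by positivity)] at h2
  calc growth Ψ r * (1 - r) ≤ 1 / (1 - r) * (Ψ.inv 1).toReal * (1 - r) := by gcongr
    _ = _ := by field_simp

theorem ChiFiniteIntegral.isLittleO (hφ : DifferentiableOn ℂ φ (Metric.ball 0 1))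
    (hmaps : MapsTo φ (Metric.ball 0 1) (Metric.ball 0 1)) (h : ChiFiniteIntegral Ψ φ) :
    (fun r : ℝ => ⨆ a : Circle, ‖compCLM (Ψ := Ψ) hφ hmaps (uElem Ψ a r)‖) =o[𝓝[<] 1]
      fun r : ℝ => 1 / (Ψ.inv (ENNReal.ofReal (1 / (1 - r)))).toReal := by
  refine IsLittleO.of_bound fun ε hε => ?_
  obtain ⟨R, hR, η, hη, hsmall⟩ := h.norm_compCLM_le hφ hmaps hε
  set I := (Ψ.inv 1).toReal with hI
  have hI0 : 0 ≤ I := ENNReal.toReal_nonneg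
  have h1R : (0 : ℝ) < 1 - R := by linarith [hR.2]
  set δ := η * (1 - R) ^ 2 / (I + 1) with hδ
  have hδ0 : 0 < δ := by positivity
  have hev : ∀ᶠ r : ℝ in 𝓝[<] 1, 1 - δ < r :=
    nhdsWithin_le_nhds (eventually_gt_nhds (by linarith))
  filter_upwards [hev, Ioo_mem_nhdsLT (zero_lt_one' ℝ)] with r hrδ hr01
  have hr : r ∈ Ico (0 : ℝ) 1 := ⟨hr01.1.le, hr01.2⟩
  have h1r : (0 : ℝ) < 1 - r := by linarith [hr.2]
  have hX := growth_pos Ψ hr.2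
  change ‖_‖ ≤ ε * ‖1 / growth Ψ r‖
  rw [Real.norm_of_nonneg (Real.iSup_nonneg fun _ => norm_nonneg _),
    Real.norm_of_nonneg (by positivity), mul_one_div]
  refine ciSup_le fun a => ?_
  rw [le_div_iff₀ hX]
  have hnorm : ‖(growth Ψ r : ℂ) • uElem Ψ a r‖ ≤ 1 := by
    rw [norm_smul, Complex.norm_real, Real.norm_of_nonneg hX.le]
    calc _ ≤ growth Ψ r * (1 / growth Ψ r) :=
          mul_le_mul_of_nonneg_left (norm_uElem_le a hr) hX.le
      _ = 1 := mul_one_div_cancel hX.ne'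
  have h1 := hsmall _ hnorm fun w hw => by
    have hwb : w ∈ Metric.ball (0 : ℂ) 1 := by simpa using hw.trans_lt hR.2
    rw [smul_apply, uElem_apply a hr hwb, norm_mul, Complex.norm_real, Real.norm_of_nonneg hX.le,
      uFun_eq_sq, norm_pow]
    have h2 := norm_vFun_le a hr hR.2 hw
    calc growth Ψ r * ‖vFun a r w‖ ^ 2 ≤ growth Ψ r * ((1 - r) / (1 - R)) ^ 2 := by gcongr
      _ = growth Ψ r * (1 - r) * (1 - r) / (1 - R) ^ 2 := by rw [div_pow]; ring
      _ ≤ I * δ / (1 - R) ^ 2 := by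
          have h3 := growth_mul_le (Ψ := Ψ) hr
          gcongr
          linarith
      _ = η * (I / (I + 1)) := by rw [hδ]; field_simp
      _ ≤ η * 1 := by
          gcongr
          rw [div_le_one (by positivity)]
          linarith
      _ = η := mul_one η
  rw [map_smul, norm_smul, Complex.norm_real, Real.norm_of_nonneg hX.le] at h1
  linarith

end Equivalences
end

/-! ### Completeness, finite nets and compactness. -/

noncomputable section

namespace HardyOrlicz

variable {Ψ : OrliczFunction}

/-- Growth bounds turn norm-Cauchy into uniformly Cauchy on compact discs, so the pointwise limit is
analytic. Fatou's lemma on slices bounds its norm and that of the remainders. -/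
theorem exists_tendsto_of_cauchySeq {u : ℕ → HardyOrlicz Ψ} (hu : CauchySeq u) :
    ∃ f, Tendsto u atTop (𝓝 f) := by
  have hpt : ∀ z ∈ Metric.ball (0 : ℂ) 1, ∃ l, Tendsto (fun n => u n z) atTop (𝓝 l) :=
    fun z hz => cauchySeq_tendsto_of_complete
      ((evalCLM Ψ z hz).uniformContinuous.comp_cauchySeq hu)
  choose! F hF using hpt
  have hdiff : DifferentiableOn ℂ F (Metric.ball 0 1) := by
    have hloc : TendstoLocallyUniformlyOn (fun n => (u n : ℂ → ℂ)) F atTop (Metric.ball 0 1) := by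
      have huni : ∀ R < (1 : ℝ),
          TendstoUniformlyOn (fun n => (u n : ℂ → ℂ)) F atTop (Metric.closedBall 0 R) := by
        intro R hR
        refine UniformCauchySeqOn.tendstoUniformlyOn_of_tendsto ?_ fun z hz => hF z ?_
        · rw [Metric.uniformCauchySeqOn_iff]
          intro ε hε
          have hg := growth_nonneg Ψ R
          obtain ⟨N, hN⟩ := Metric.cauchySeq_iff.1 hu (ε / (4 * growth Ψ R + 1)) (by positivity)
          refine ⟨N, fun m hm n hn z hz => ?_⟩
          have h1 := (u m - u n).norm_apply_le hR (z := z) (by simpa using hz)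
          have h2 := hN m hm n hn
          rw [dist_eq_norm, lt_div_iff₀ (by positivity)] at h2
          rw [dist_eq_norm, ← sub_apply]
          nlinarith [norm_nonneg (u m - u n)]
        · exact Metric.closedBall_subset_ball hR hz
      intro s hs z hz
      have hz1 : ‖z‖ < 1 := by simpa using hz
      refine ⟨Metric.closedBall 0 ((1 + ‖z‖) / 2), mem_nhdsWithin_of_mem_nhds ?_,
        huni _ (by linarith) s hs⟩
      refine Filter.mem_of_superset (Metric.isOpen_ball.mem_nhds ?_) Metric.ball_subset_closedBall
      rw [mem_ball_zero_iff]
      linarith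
    exact hloc.differentiableOn (Eventually.of_forall fun n => (u n).differentiableOn)
      Metric.isOpen_ball
  obtain ⟨b, hb0, hb⟩ : ∃ b : ℝ, 0 < b ∧ ∀ n, ‖u n‖ < b := by
    obtain ⟨b, hb0, hb⟩ := cauchySeq_bdd hu
    refine ⟨‖u 0‖ + b, by positivity, fun n => ?_⟩
    have h1 := hb n 0
    rw [dist_eq_norm] at h1
    have h2 := norm_le_norm_add_norm_sub' (u n) (u 0)
    linarith
  have hslice : ∀ (f : HardyOrlicz Ψ) r, r ∈ Ico (0 : ℝ) 1 →
      AEStronglyMeasurable (fun t => f (circleMap 0 r t)) circleMeasure :=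
    fun f r hr => (f.integrable_slice hr).1
  have hmod : ∀ r ∈ Ico (0 : ℝ) 1,
      ∫⁻ t, Ψ.eval (‖F (circleMap 0 r t)‖ₑ / ENNReal.ofReal b) ∂circleMeasure ≤
        ENNReal.ofReal 1 := fun r hr => by
    rw [ENNReal.ofReal_one]
    exact Ψ.lintegral_eval_le_of_tendsto (by simpa using hb0) (fun n => hslice (u n) r hr)
      (ae_of_all _ fun t => hF _ (circleMap_mem_unitBall hr t))
      fun n => lintegral_eval_slice_le_one (hb n) hr
  refine ⟨ofModular Ψ F hdiff hb0 le_rfl hmod, Metric.tendsto_atTop.2 fun ε hε => ?_⟩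
  obtain ⟨N, hN⟩ := Metric.cauchySeq_iff.1 hu (ε / 2) (by positivity)
  refine ⟨N, fun n hn => ?_⟩
  rw [dist_eq_norm]
  have h1 := norm_le_of_lintegral_le (f := u n - ofModular Ψ F hdiff hb0 le_rfl hmod)
    (c := ε / 2) (by positivity) le_rfl fun r hr => by
      rw [ENNReal.ofReal_one]
      refine Ψ.lintegral_eval_le_of_tendsto (k := fun m t => (u n - u (m + N)) (circleMap 0 r t))
        (by simpa using hε) (fun m => hslice _ r hr) (ae_of_all _ fun t => ?_) fun m => ?_
      · have hm := circleMap_mem_unitBall hr t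
        simp only [sub_apply]
        rw [ofModular_apply hdiff hb0 le_rfl hmod hm]
        exact ((hF _ hm).comp (tendsto_add_atTop_nat N)).const_sub _
      · refine lintegral_eval_slice_le_one ?_ hr
        rw [← dist_eq_norm]
        exact hN n hn _ (Nat.le_add_left _ _)
  linarith

instance : CompleteSpace (HardyOrlicz Ψ) :=
  Metric.complete_of_cauchySeq_tendsto fun _ hu => exists_tendsto_of_cauchySeq hu

/-- The unit ball of `H^Ψ` is equi-Lipschitz on compact discs. -/
theorem exists_lipschitz_bound (Ψ : OrliczFunction) {R : ℝ} (hR : R ∈ Ico (0 : ℝ) 1) :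
    ∃ K : ℝ, 0 ≤ K ∧ ∀ f : HardyOrlicz Ψ, ‖f‖ ≤ 1 → ∀ z w : ℂ, ‖z‖ ≤ R → ‖w‖ ≤ R →
      ‖f z - f w‖ ≤ K * ‖z - w‖ := by
  set R' := (1 + R) / 2 with hR'
  have hR1 : R' < 1 := by linarith [hR.2]
  have hRR : R < R' := by linarith [hR.2]
  set M := 4 * growth Ψ R' with hM
  have hM0 : 0 ≤ M := mul_nonneg (by norm_num) (growth_nonneg _ _)
  refine ⟨M / (R' - R), div_nonneg hM0 (by linarith), fun f hf z w hz hw => ?_⟩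
  have hb : ∀ z, ‖z‖ ≤ R' → ‖f z‖ ≤ M := fun z hz => by
    have h1 := f.norm_apply_le hR1 hz
    rw [← hM] at h1
    nlinarith
  have hball : ∀ z ∈ Metric.closedBall (0 : ℂ) R, DifferentiableAt ℂ f z := fun z hz => by
    have hz' : ‖z‖ ≤ R := by simpa using hz
    exact f.differentiableOn.differentiableAt
      (Metric.isOpen_ball.mem_nhds (by simpa using hz'.trans_lt hR.2))
  refine (convex_closedBall (0 : ℂ) R).norm_image_sub_le_of_norm_deriv_le hball
    (fun x hx => ?_) (by simpa using hw) (by simpa using hz)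
  have hx' : ‖x‖ ≤ R := by simpa using hx
  have hsub : ∀ y ∈ Metric.closedBall x (R' - R), ‖y‖ ≤ R' := fun y hy => by
    have h1 : ‖y - x‖ ≤ R' - R := by simpa [dist_eq_norm] using hy
    have h2 := norm_le_norm_add_norm_sub' y x
    linarith
  -- Cauchy's estimate on a circle of radius R' - R about x, which stays inside |y| ≤ R'.
  refine Complex.norm_deriv_le_of_forall_mem_sphere_norm_le (by linarith) ?_
    fun y hy => hb y (hsub y (Metric.sphere_subset_closedBall hy))
  refine (f.differentiableOn.mono fun y hy => ?_).diffContOnCl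
  rw [closure_ball _ (by linarith)] at hy
  simpa using (hsub y hy).trans_lt hR1

/-- The unit ball of `H^Ψ` is totally bounded for uniform convergence on compact discs. -/
theorem exists_finite_net (Ψ : OrliczFunction) {R η : ℝ} (hR : R ∈ Ico (0 : ℝ) 1) (hη : 0 < η) :
    ∃ S : Set (HardyOrlicz Ψ), S.Finite ∧ S ⊆ Metric.closedBall 0 1 ∧
      ∀ f : HardyOrlicz Ψ, ‖f‖ ≤ 1 → ∃ g ∈ S, ∀ w, ‖w‖ ≤ R → ‖f w - g w‖ ≤ η := by
  obtain ⟨K, hK0, hK⟩ := exists_lipschitz_bound Ψ hR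
  set d := η / (4 * (K + 1)) with hd
  have hd0 : 0 < d := by positivity
  obtain ⟨t, htsub, htfin, htcov⟩ := Metric.finite_approx_of_totallyBounded
    (isCompact_closedBall (0 : ℂ) R).totallyBounded d hd0
  have : Finite t := htfin
  have : Fintype t := Fintype.ofFinite t
  -- Evaluation on a finite d-net maps the unit ball to a bounded, hence totally bounded, set of a
  -- finite-dimensional space. The Lipschitz bound then costs η/4 for each of f and g, and the net
  -- of values costs η/2.
  set Φ : HardyOrlicz Ψ → (t → ℂ) := fun f x => f x with hΦ
  have htb : TotallyBounded (Φ '' Metric.closedBall 0 1) := by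
    refine (isCompact_closedBall (0 : t → ℂ) (4 * growth Ψ R)).totallyBounded.subset ?_
    rintro _ ⟨f, hf, rfl⟩
    have hf' : ‖f‖ ≤ 1 := by simpa using hf
    have hg := growth_nonneg Ψ R
    rw [mem_closedBall_zero_iff, pi_norm_le_iff_of_nonneg (by positivity)]
    intro x
    have h1 := f.norm_apply_le hR.2 (z := x) (by simpa using htsub x.2)
    have h2 : 4 * growth Ψ R * ‖f‖ ≤ 4 * growth Ψ R * 1 := by gcongr
    simp only [hΦ]
    linarith
  obtain ⟨S, hS, hSfin, hcov⟩ := exists_subset_image_finite_and.1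
    (Metric.finite_approx_of_totallyBounded htb (η / 2) (by positivity))
  refine ⟨S, hSfin, hS, fun f hf => ?_⟩
  have hfm : Φ f ∈ Φ '' Metric.closedBall 0 1 := ⟨f, by simpa using hf, rfl⟩
  obtain ⟨_, ⟨g, hgS, rfl⟩, hg⟩ := mem_iUnion₂.1 (hcov hfm)
  have hg1 : ‖g‖ ≤ 1 := by simpa using hS hgS
  refine ⟨g, hgS, fun w hw => ?_⟩
  obtain ⟨x, hxt, hx⟩ := mem_iUnion₂.1 (htcov (show w ∈ Metric.closedBall (0 : ℂ) R by simpa using hw))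
  have hxR : ‖x‖ ≤ R := by simpa using htsub hxt
  have hwx : ‖w - x‖ ≤ d := by
    have : dist w x < d := hx
    rw [dist_eq_norm] at this
    exact this.le
  have h1 : ‖f x - g x‖ ≤ η / 2 := by
    have h2 : dist (Φ f) (Φ g) < η / 2 := hg
    have h3 := dist_le_pi_dist (Φ f) (Φ g) ⟨x, hxt⟩
    rw [dist_eq_norm] at h3
    exact h3.trans h2.le
  have h4 := hK f hf w x hw hxR
  have h5 := hK g hg1 w x hw hxR
  have h6 : K * ‖w - x‖ ≤ η / 4 := by
    calc K * ‖w - x‖ ≤ K * d := by gcongr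
      _ ≤ (K + 1) * d := by gcongr; linarith
      _ = η / 4 := by rw [hd]; field_simp
  have e : f w - g w = (f w - f x) - (g w - g x) + (f x - g x) := by ring
  rw [e]
  refine (norm_add_le _ _).trans ?_
  have h7 := norm_sub_le (f w - f x) (g w - g x)
  linarith

end HardyOrlicz

open HardyOrlicz

/-- A net for uniform convergence on |w| ≤ R is carried by C_φ to a norm net. Differences are halved
to return to the unit ball, which explains the tolerances 2η and ε/3. -/
theorem ChiFiniteIntegral.isCompactOperator {Ψ : OrliczFunction} {φ : ℂ → ℂ}
    (hφ : DifferentiableOn ℂ φ (Metric.ball 0 1))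
    (hmaps : MapsTo φ (Metric.ball 0 1) (Metric.ball 0 1)) (h : ChiFiniteIntegral Ψ φ) :
    IsCompactOperator (compCLM (Ψ := Ψ) hφ hmaps) := by
  have htb : TotallyBounded (compCLM (Ψ := Ψ) hφ hmaps '' Metric.closedBall 0 1) := by
    rw [Metric.totallyBounded_iff]
    intro ε hε
    obtain ⟨R, hR, η, hη, hsmall⟩ := h.norm_compCLM_le hφ hmaps (show 0 < ε / 3 by positivity)
    obtain ⟨S, hSfin, hS1, hS⟩ := exists_finite_net Ψ hR (show 0 < 2 * η by positivity)
    refine ⟨compCLM hφ hmaps '' S, hSfin.image _, ?_⟩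
    rintro _ ⟨f, hf, rfl⟩
    have hf1 : ‖f‖ ≤ 1 := by simpa using hf
    obtain ⟨g, hgS, hg⟩ := hS f hf1
    have hg1 : ‖g‖ ≤ 1 := by simpa using hS1 hgS
    refine mem_iUnion₂.2 ⟨_, ⟨g, hgS, rfl⟩, ?_⟩
    have h2 : ‖(2⁻¹ : ℂ)‖ = 2⁻¹ := by simp
    have h1 := hsmall ((2⁻¹ : ℂ) • (f - g)) (by
      rw [norm_smul, h2]
      have := norm_sub_le f g
      linarith) fun w hw => by
        rw [smul_apply, sub_apply, norm_mul, h2]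
        have := hg w hw
        linarith
    rw [map_smul, map_sub, norm_smul, h2] at h1
    rw [Metric.mem_ball, dist_eq_norm]
    linarith
  have hcl : IsCompact (closure (compCLM (Ψ := Ψ) hφ hmaps '' Metric.closedBall 0 1)) :=
    htb.closure.isCompact_of_isClosed isClosed_closure
  exact (isCompactOperator_iff_isCompact_closure_image_closedBall
    (compCLM (Ψ := Ψ) hφ hmaps).toLinearMap one_pos).2 hcl

theorem IsCompactOperator.isWeaklyCompactOperator {E F : Type*} [NormedAddCommGroup E]
    [NormedSpace ℂ E] [NormedAddCommGroup F] [NormedSpace ℂ F] {T : E →L[ℂ] F}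
    (h : IsCompactOperator T) : IsWeaklyCompactOperator T := by
  have hcl : IsCompact (closure (T '' Metric.closedBall 0 1)) :=
    (isCompactOperator_iff_isCompact_closure_image_closedBall T.toLinearMap one_pos).1 h
  have him : IsCompact (toWeakSpace ℂ F '' closure (T '' Metric.closedBall 0 1)) :=
    hcl.image (toWeakSpaceCLM ℂ F).continuous
  exact him.closure_of_subset (image_mono subset_closure)

end

/-! ### Bounded sums of sparse bumps. -/

noncomputable section

open HardyOrlicz

variable {Ψ : OrliczFunction}

/-- Young-type splitting used to pass from the `L²` bound on `v_{a,r}` to a modular bound. -/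
theorem ENNReal.mul_le_inv_add_pow_three_mul_sq (p x : ℝ≥0∞) :
    x * p ≤ p⁻¹ + p ^ 3 * x ^ 2 := by
  rcases le_total (x * p ^ 2) 1 with h | h
  · refine le_trans ?_ le_self_add
    rw [ENNReal.le_inv_iff_mul_le]
    calc x * p * p = x * p ^ 2 := by ring
      _ ≤ 1 := h
  · refine le_trans ?_ le_add_self
    calc x * p = x * p * 1 := (mul_one _).symm
      _ ≤ x * p * (x * p ^ 2) := by gcongr
      _ = _ := by ring

/-- The modulars of the normalized functions `v_{a,r}` tend to `0` as `r → 1`, uniformly. -/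
theorem OrliczFunction.SatisfiesDelta2.exists_modular_vFun_le (hΨ : Ψ.SatisfiesDelta2) :
    ∃ β : ℝ≥0, 0 < β ∧ ∀ τ : ℝ≥0∞, τ ≠ 0 → ∃ r₀ < (1 : ℝ), ∀ r ∈ Ico (0 : ℝ) 1, r₀ < r →
      ∀ a : Circle, ∀ ρ ∈ Ico (0 : ℝ) 1,
        ∫⁻ t, Ψ.eval (ENNReal.ofReal (growth Ψ r) * ‖vFun a r (circleMap 0 ρ t)‖ₑ / β)
          ∂circleMeasure ≤ τ := by
  obtain ⟨α, hα, x₀, hx₀, hsq⟩ := hΨ.eval_sq_le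
  have hα0 : (α : ℝ≥0∞) ≠ 0 := by simpa using (zero_lt_one.trans hα).ne'
  have hα1 : (1 : ℝ≥0∞) ≤ α := by exact_mod_cast hα.le
  have hβ0 : ((α ^ 2 : ℝ≥0) : ℝ≥0∞) ≠ 0 := by simpa using hα0
  refine ⟨α ^ 2, pow_pos (zero_lt_one.trans hα) 2, fun τ hτ => ?_⟩
  -- The entries ensure in turn that Δ² applies at d, that d ≠ 0, and that the final bound 2/p is at
  -- most τ.
  set X := max (max x₀ 1) (Ψ.inv (2 / τ)) with hX
  have hXt : X ≠ ⊤ := by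
    refine (max_lt (max_lt hx₀.lt_top ENNReal.one_lt_top) ?_).ne
    exact (Ψ.inv_ne_top (ENNReal.div_ne_top ENNReal.ofNat_ne_top hτ)).lt_top
  set y := Ψ.eval ((α ^ 2 : ℝ≥0) * X) with hy
  have hyt : y ≠ ⊤ := Ψ.eval_ne_top (ENNReal.mul_ne_top ENNReal.coe_ne_top hXt)
  refine ⟨1 - 1 / (y.toReal + 1), ?_, fun r hr hr₀ a ρ hρ => ?_⟩
  · have : 0 < 1 / (y.toReal + 1) := by
      have := ENNReal.toReal_nonneg (a := y)
      positivity
    linarith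
  have h1r : (0 : ℝ) < 1 - r := by linarith [hr.2]
  have hyr : y ≤ ENNReal.ofReal (1 / (1 - r)) := by
    rw [ENNReal.le_ofReal_iff_toReal_le hyt (by positivity)]
    have hy0 := ENNReal.toReal_nonneg (a := y)
    have h1 : 1 - r < 1 / (y.toReal + 1) := by linarith
    rw [lt_div_iff₀ (by positivity)] at h1
    rw [le_div_iff₀ h1r]
    nlinarith
  set c := ENNReal.ofReal (growth Ψ r) with hc
  have hcΨ : Ψ.eval c = ENNReal.ofReal (1 / (1 - r)) := by rw [hc, ofReal_growth, Ψ.eval_inv]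
  have hcX : (α ^ 2 : ℝ≥0) * X ≤ c := by
    rw [← Ψ.eval_strictMono.le_iff_le, hcΨ]
    exact hyr
  set d := c / (α ^ 2 : ℝ≥0) with hd
  have hdX : X ≤ d := by
    rw [hd, ENNReal.le_div_iff_mul_le (Or.inl hβ0) (Or.inl ENNReal.coe_ne_top), mul_comm]
    exact hcX
  have hdt : d ≠ ⊤ := ENNReal.div_ne_top ENNReal.ofReal_ne_top hβ0
  have hxd : x₀ ≤ d := ((le_max_left _ _).trans (le_max_left _ _)).trans hdX
  have hαd : α * (α * d) = c := by
    rw [hd, ← mul_assoc, ← sq, ← ENNReal.coe_pow, ENNReal.mul_div_cancel hβ0 ENNReal.coe_ne_top]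
  set p := Ψ.eval d with hp
  have hpt : p ≠ ⊤ := Ψ.eval_ne_top hdt
  have hd0 : d ≠ 0 := by
    have : (1 : ℝ≥0∞) ≤ d := ((le_max_right _ _).trans (le_max_left _ _)).trans hdX
    exact (zero_lt_one.trans_le this).ne'
  have hp0 : p ≠ 0 := Ψ.eval_ne_zero hd0
  -- Two uses of Δ², whence β = α²: p⁴ ≤ Ψ(α² d) = 1/(1 - r). The fourth power balances p³(1 - r)
  -- against 1/p after the splitting.
  have hp4 : p ^ 4 ≤ ENNReal.ofReal (1 / (1 - r)) := by
    have h1 : p ^ 2 ≤ Ψ.eval (α * d) := hsq d hxd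
    have h2 : Ψ.eval (α * d) ^ 2 ≤ Ψ.eval (α * (α * d)) :=
      hsq _ (hxd.trans (le_mul_of_one_le_left' hα1))
    rw [hαd, hcΨ] at h2
    calc p ^ 4 = (p ^ 2) ^ 2 := by ring
      _ ≤ Ψ.eval (α * d) ^ 2 := by gcongr
      _ ≤ _ := h2
  have hτp : 2 / τ ≤ p := by
    have h1 : Ψ.inv (2 / τ) ≤ d := (le_max_right _ _).trans hdX
    rw [← Ψ.eval_strictMono.le_iff_le, Ψ.eval_inv] at h1
    exact h1
  calc ∫⁻ t, Ψ.eval (c * ‖vFun a r (circleMap 0 ρ t)‖ₑ / (α ^ 2 : ℝ≥0)) ∂circleMeasure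
      ≤ ∫⁻ t, (p⁻¹ + p ^ 3 * ‖vFun a r (circleMap 0 ρ t)‖ₑ ^ 2) ∂circleMeasure := by
        refine lintegral_mono fun t => ?_
        have hn : ‖circleMap 0 ρ t‖ ≤ 1 := by simpa [abs_of_nonneg hρ.1] using hρ.2.le
        have hv : ‖vFun a r (circleMap 0 ρ t)‖ₑ ≤ 1 := by
          rw [← ofReal_norm]
          exact ENNReal.ofReal_le_one.2 (norm_vFun_le_one a hr hn)
        have e : c * ‖vFun a r (circleMap 0 ρ t)‖ₑ / (α ^ 2 : ℝ≥0) =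
            ‖vFun a r (circleMap 0 ρ t)‖ₑ * d := by
          rw [hd, mul_comm, mul_div_assoc]
        rw [e]
        exact (Ψ.eval_mul_le hv d).trans (ENNReal.mul_le_inv_add_pow_three_mul_sq _ _)
    _ = p⁻¹ + p ^ 3 * ∫⁻ t, ‖vFun a r (circleMap 0 ρ t)‖ₑ ^ 2 ∂circleMeasure := by
        rw [lintegral_add_left measurable_const, lintegral_const_mul' _ _ (ENNReal.pow_ne_top hpt)]
        simp
    _ ≤ p⁻¹ + p ^ 3 * ENNReal.ofReal (1 - r) := by
        gcongr
        exact lintegral_sq_enorm_vFun_le a hr hρ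
    _ ≤ p⁻¹ + p⁻¹ := by
        gcongr
        rw [ENNReal.le_inv_iff_mul_le]
        calc p ^ 3 * ENNReal.ofReal (1 - r) * p = p ^ 4 * ENNReal.ofReal (1 - r) := by ring
          _ ≤ ENNReal.ofReal (1 / (1 - r)) * ENNReal.ofReal (1 - r) := by gcongr
          _ = 1 := by
              rw [← ENNReal.ofReal_mul (by positivity), one_div_mul_cancel h1r.ne',
                ENNReal.ofReal_one]
    _ = 2 / p := by rw [← two_mul, div_eq_mul_inv]
    _ ≤ τ := by
        rw [ENNReal.div_le_iff hp0 hpt]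
        rcases eq_or_ne τ ⊤ with rfl | hτt
        · simp [ENNReal.top_mul hp0]
        · rwa [ENNReal.div_le_iff hτ hτt, mul_comm] at hτp

/-- The pointwise induction bounding the modular of a sparse sum of bumps. -/
theorem OrliczFunction.eval_sum_le {β : ℝ≥0∞} (hβ0 : β ≠ 0) (hβt : β ≠ ⊤) {x c B : ℕ → ℝ≥0∞}
    (hxc : ∀ k, x k ≤ c k) (hB0 : B 0 = 1) (hB : ∀ k, B (k + 1) = B k + c k) (K : ℕ) :
    Ψ.eval ((∑ k ∈ Finset.range K, x k + 2⁻¹ ^ K) / (2 * β)) ≤ Ψ.eval (1 / (2 * β)) +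
      ∑ k ∈ Finset.range K, Ψ.eval (x k / β) *
        (Ψ.eval (B k / β) / Ψ.eval (2⁻¹ ^ (k + 1) / β) + 1) := by
  have hhalf : ∀ k, (2⁻¹ : ℝ≥0∞) ^ (k + 1) + 2⁻¹ ^ (k + 1) = 2⁻¹ ^ k := fun k => by
    rw [pow_succ, ← mul_add, ENNReal.inv_two_add_inv_two, mul_one]
  have hσB : ∀ k, ∑ j ∈ Finset.range k, x j + 2⁻¹ ^ k ≤ B k := by
    intro k
    induction k with
    | zero => simp [hB0]
    | succ k ih =>
      rw [Finset.sum_range_succ, hB]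
      calc ∑ j ∈ Finset.range k, x j + x k + 2⁻¹ ^ (k + 1)
          ≤ ∑ j ∈ Finset.range k, x j + c k + 2⁻¹ ^ k := by
            refine add_le_add (add_le_add le_rfl (hxc k)) ?_
            rw [← hhalf k]; exact le_self_add
        _ = ∑ j ∈ Finset.range k, x j + 2⁻¹ ^ k + c k := by ring
        _ ≤ _ := by gcongr
  induction K with
  | zero => simp
  | succ K ih =>
    rw [Finset.sum_range_succ, Finset.sum_range_succ]
    -- A bump below 2^{-(K+1)} is paid for by the slack 2^{-K}. A larger one has Ψ(x_K/β) bounded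
    -- below, so the whole earlier contribution Ψ(B_K/β) can be charged to it through the ratio.
    rcases le_total (x K) (2⁻¹ ^ (K + 1)) with h | h
    · refine le_trans (Ψ.eval_mono ?_) (ih.trans ?_)
      · refine ENNReal.div_le_div_right ?_ _
        rw [add_assoc, ← hhalf K]
        gcongr
      · rw [← add_assoc]; exact le_self_add
    · rw [← add_assoc]
      refine le_trans ?_ le_add_self
      have hy0 : Ψ.eval (2⁻¹ ^ (K + 1) / β) ≠ 0 :=
        Ψ.eval_ne_zero (ENNReal.div_ne_zero.2 ⟨pow_ne_zero _ (by simp), hβt⟩)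
      have hyt : Ψ.eval (2⁻¹ ^ (K + 1) / β) ≠ ⊤ :=
        Ψ.eval_ne_top (ENNReal.div_ne_top (ENNReal.pow_ne_top (by simp)) hβ0)
      have hG : Ψ.eval (2⁻¹ ^ (K + 1) / β) ≤ Ψ.eval (x K / β) :=
        Ψ.eval_mono (ENNReal.div_le_div_right h _)
      have hsplit : Ψ.eval ((∑ j ∈ Finset.range K, x j + x K + 2⁻¹ ^ (K + 1)) / (2 * β)) ≤
          Ψ.eval (B K / β) + Ψ.eval (x K / β) := by
        have h2 : ∀ z : ℝ≥0∞, 2 * (z / (2 * β)) = z / β := fun z => by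
          rw [← mul_div_assoc, ENNReal.mul_div_mul_left _ _ two_ne_zero ENNReal.ofNat_ne_top]
        rw [← h2 (B K), ← h2 (x K)]
        refine le_trans (Ψ.eval_mono ?_) (Ψ.eval_add_le _ _)
        rw [← ENNReal.add_div]
        refine ENNReal.div_le_div_right ?_ _
        calc ∑ j ∈ Finset.range K, x j + x K + 2⁻¹ ^ (K + 1)
            ≤ ∑ j ∈ Finset.range K, x j + x K + 2⁻¹ ^ K := by
              refine add_le_add le_rfl ?_
              rw [← hhalf K]; exact le_self_add
          _ = ∑ j ∈ Finset.range K, x j + 2⁻¹ ^ K + x K := by ring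
          _ ≤ _ := by gcongr; exact hσB K
      refine hsplit.trans ?_
      rw [mul_add, mul_one]
      gcongr
      calc Ψ.eval (B K / β) = Ψ.eval (2⁻¹ ^ (K + 1) / β) *
            (Ψ.eval (B K / β) / Ψ.eval (2⁻¹ ^ (K + 1) / β)) :=
          (ENNReal.mul_div_cancel hy0 hyt).symm
        _ ≤ _ := by gcongr

/-- The sum of a sparse sequence of normalized bumps. -/
def bumpSum (Ψ : OrliczFunction) (r : ℕ → ℝ) (a : ℕ → Circle) (K : ℕ) (z : ℂ) : ℂ :=
  ∑ k ∈ Finset.range K, (growth Ψ (r k) : ℂ) * vFun (a k) (r k) z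

section BumpSum

variable {r : ℕ → ℝ} {a : ℕ → Circle}

theorem differentiableOn_bumpSum (hr : ∀ k, r k ∈ Ico (0 : ℝ) 1) (K : ℕ) :
    DifferentiableOn ℂ (bumpSum Ψ r a K) (Metric.ball 0 1) := by
  unfold bumpSum
  exact DifferentiableOn.fun_sum fun k _ => (differentiableOn_vFun (a k) (hr k)).const_mul _

theorem norm_bumpSum_le (hr : ∀ k, r k ∈ Ico (0 : ℝ) 1) (K : ℕ) {z : ℂ} (hz : ‖z‖ ≤ 1) :
    ‖bumpSum Ψ r a K z‖ ≤ ∑ k ∈ Finset.range K, growth Ψ (r k) := by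
  refine norm_sum_le_of_le _ fun k _ => ?_
  rw [norm_mul, Complex.norm_real, Real.norm_of_nonneg (growth_nonneg _ _)]
  exact mul_le_of_le_one_right (growth_nonneg _ _) (norm_vFun_le_one (a k) (hr k) hz)

/-- All summands have nonnegative real part, so each single bump is dominated by the real part of
the sum. -/
theorem le_re_bumpSum (hr : ∀ k, r k ∈ Ico (0 : ℝ) 1) {k K : ℕ} (hk : k < K) {z : ℂ}
    (hz : ‖z‖ ≤ 1) : growth Ψ (r k) * (vFun (a k) (r k) z).re ≤ (bumpSum Ψ r a K z).re := by
  rw [bumpSum, Complex.re_sum]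
  have h := Finset.single_le_sum (s := Finset.range K)
    (f := fun k => ((growth Ψ (r k) : ℂ) * vFun (a k) (r k) z).re) (fun j _ => by
      rw [Complex.re_ofReal_mul]
      exact mul_nonneg (growth_nonneg _ _) (re_vFun_nonneg (a j) (hr j) hz))
    (Finset.mem_range.2 hk)
  simpa [Complex.re_ofReal_mul] using h

/-- The pointwise induction is integrated; the sparsity hypothesis makes the k-th term at most
2^{-(k+1)}, so the bound does not depend on K. -/
theorem lintegral_eval_bumpSum_le (hr : ∀ k, r k ∈ Ico (0 : ℝ) 1) {β : ℝ≥0} (hβ : 0 < β)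
    {B : ℕ → ℝ≥0∞} (hB0 : B 0 = 1)
    (hB : ∀ k, B (k + 1) = B k + ENNReal.ofReal (growth Ψ (r k)))
    (hsmall : ∀ k, ∀ ρ ∈ Ico (0 : ℝ) 1,
      (∫⁻ t, Ψ.eval (ENNReal.ofReal (growth Ψ (r k)) * ‖vFun (a k) (r k) (circleMap 0 ρ t)‖ₑ / β)
        ∂circleMeasure) * (Ψ.eval (B k / β) / Ψ.eval (2⁻¹ ^ (k + 1) / β) + 1) ≤ 2⁻¹ ^ (k + 1))
    (K : ℕ) {ρ : ℝ} (hρ : ρ ∈ Ico (0 : ℝ) 1) :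
    ∫⁻ t, Ψ.eval (‖bumpSum Ψ r a K (circleMap 0 ρ t)‖ₑ / (2 * β)) ∂circleMeasure ≤
      Ψ.eval (1 / (2 * β)) + 1 := by
  have hβ0 : (β : ℝ≥0∞) ≠ 0 := by simpa using hβ.ne'
  set x : ℕ → ℝ → ℝ≥0∞ := fun k t =>
    ENNReal.ofReal (growth Ψ (r k)) * ‖vFun (a k) (r k) (circleMap 0 ρ t)‖ₑ with hx
  set W : ℕ → ℝ≥0∞ := fun k => Ψ.eval (B k / β) / Ψ.eval (2⁻¹ ^ (k + 1) / β) + 1 with hW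
  have hn : ∀ t, ‖circleMap 0 ρ t‖ ≤ 1 := fun t => by simpa [abs_of_nonneg hρ.1] using hρ.2.le
  have hxm : ∀ k, Measurable (x k) := fun k =>
    (continuous_circle_slice (differentiableOn_vFun (a k) (hr k)) hρ).measurable.enorm.const_mul _
  have hGm : ∀ k, Measurable fun t => Ψ.eval (x k t / β) * W k := fun k =>
    (Ψ.measurable_eval.comp ((hxm k).div_const _)).mul_const _
  calc ∫⁻ t, Ψ.eval (‖bumpSum Ψ r a K (circleMap 0 ρ t)‖ₑ / (2 * β)) ∂circleMeasure
      ≤ ∫⁻ t, (Ψ.eval (1 / (2 * β)) + ∑ k ∈ Finset.range K, Ψ.eval (x k t / β) * W k)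
          ∂circleMeasure := by
        refine lintegral_mono fun t => le_trans (Ψ.eval_mono ?_)
          (Ψ.eval_sum_le (x := fun k => x k t) hβ0 ENNReal.coe_ne_top (fun k => ?_) hB0 hB K)
        · refine ENNReal.div_le_div_right (le_trans ?_ le_self_add) _
          refine (enorm_sum_le _ _).trans (Finset.sum_le_sum fun k _ => ?_)
          rw [enorm_mul, ← ofReal_norm (growth Ψ (r k) : ℂ), Complex.norm_real,
            Real.norm_of_nonneg (growth_nonneg _ _)]
        · refine mul_le_of_le_one_right' ?_
          rw [← ofReal_norm]
          exact ENNReal.ofReal_le_one.2 (norm_vFun_le_one (a k) (hr k) (hn t))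
    _ = Ψ.eval (1 / (2 * β)) +
          ∑ k ∈ Finset.range K, (∫⁻ t, Ψ.eval (x k t / β) ∂circleMeasure) * W k := by
        rw [lintegral_add_left measurable_const, lintegral_finsetSum _ fun k _ => hGm k]
        congr 1
        · simp
        · refine Finset.sum_congr rfl fun k _ => ?_
          have hm : Measurable fun t => Ψ.eval (x k t / β) :=
            Ψ.measurable_eval.comp ((hxm k).div_const _)
          rw [lintegral_mul_const _ hm]
    _ ≤ Ψ.eval (1 / (2 * β)) + ∑ k ∈ Finset.range K, 2⁻¹ ^ (k + 1) := by
        gcongr with k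
        exact hsmall k ρ hρ
    _ ≤ Ψ.eval (1 / (2 * β)) + 1 := by
        gcongr
        refine (ENNReal.sum_le_tsum _).trans (le_of_eq ?_)
        simp_rw [pow_succ]
        rw [ENNReal.tsum_mul_right, ENNReal.tsum_geometric, ENNReal.one_sub_inv_two, inv_inv,
          ENNReal.mul_inv_cancel two_ne_zero ENNReal.ofNat_ne_top]

end BumpSum
end

/-! ### Weak compactness forces the window condition. -/

noncomputable section

open HardyOrlicz

/-- A bounded sequence has a weak cluster point of its image under a weakly compact operator, and
this point lies in every closed convex set that eventually contains the image sequence. -/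
theorem IsWeaklyCompactOperator.exists_mem_of_convex {E F : Type*} [NormedAddCommGroup E]
    [NormedSpace ℂ E] [NormedAddCommGroup F] [NormedSpace ℂ F] {T : E →L[ℂ] F}
    (hT : IsWeaklyCompactOperator T) {x : ℕ → E} (hx : ∀ n, ‖x n‖ ≤ 1) :
    ∃ g : F, ∀ s : Set F, Convex ℝ s → IsClosed s → (∀ᶠ n in atTop, T (x n) ∈ s) → g ∈ s := by
  have hmem : ∀ n, toWeakSpace ℂ F (T (x n)) ∈
      closure (toWeakSpace ℂ F '' (T '' Metric.closedBall 0 1)) := fun n =>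
    subset_closure ⟨_, ⟨_, by simpa using hx n, rfl⟩, rfl⟩
  obtain ⟨y, -, hy⟩ := IsCompact.exists_mapClusterPt (f := atTop) hT
    (u := fun n => toWeakSpace ℂ F (T (x n))) (by
      rw [le_principal_iff]
      exact mem_map.2 (Eventually.of_forall hmem))
  refine ⟨(toWeakSpace ℂ F).symm y, fun s hs hsc hev => ?_⟩
  -- Mazur: a norm-closed convex set is weakly closed, so it keeps weak cluster points.
  have hcl : IsClosed (toWeakSpace ℂ F '' s) := by
    have h := hs.toWeakSpace_closure ℂ
    rw [hsc.closure_eq] at h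
    rw [h]
    exact isClosed_closure
  obtain ⟨g, hg, rfl⟩ := hcl.mem_of_mapClusterPt hy (hev.mono fun n hn => ⟨_, hn, rfl⟩)
  simpa using hg

variable {Ψ : OrliczFunction} {φ : ℂ → ℂ}

/-- If `φ` fails the window condition, there is a sparse sequence of bumps that detects it. -/
theorem exists_sparse_bumps (hΨ : Ψ.SatisfiesDelta2) (h : ¬ ChiWindow Ψ φ) :
    ∃ A : ℝ≥0, 0 < A ∧ ∃ β : ℝ≥0, 0 < β ∧ ∃ (r : ℕ → ℝ) (a : ℕ → Circle) (B : ℕ → ℝ≥0∞),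
      (∀ k, r k ∈ Ico (0 : ℝ) 1) ∧ B 0 = 1 ∧
      (∀ k, B (k + 1) = B k + ENNReal.ofReal (growth Ψ (r k))) ∧
      (∀ k, ∀ ρ ∈ Ico (0 : ℝ) 1,
        (∫⁻ t, Ψ.eval
            (ENNReal.ofReal (growth Ψ (r k)) * ‖vFun (a k) (r k) (circleMap 0 ρ t)‖ₑ / β)
          ∂circleMeasure) * (Ψ.eval (B k / β) / Ψ.eval (2⁻¹ ^ (k + 1) / β) + 1) ≤
            2⁻¹ ^ (k + 1)) ∧
      ∀ k : ℕ, (k : ℝ≥0∞) < circleMeasure {t | ‖boundaryValue φ t - a k‖ ≤ 2 * (1 - r k)} *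
        Ψ.chi A (ENNReal.ofReal (1 / (1 - r k))) := by
  simp only [ChiWindow] at h
  push Not at h
  obtain ⟨A, hA, hbad⟩ := h
  obtain ⟨β, hβ, hmod⟩ := hΨ.exists_modular_vFun_le
  have hβ0 : (β : ℝ≥0∞) ≠ 0 := by simpa using hβ.ne'
  have hstep : ∀ (k : ℕ) (b : ℝ≥0), ∃ p : ℝ × Circle, p.1 ∈ Ico (0 : ℝ) 1 ∧
      (∀ ρ ∈ Ico (0 : ℝ) 1,
        (∫⁻ t, Ψ.eval (ENNReal.ofReal (growth Ψ p.1) * ‖vFun p.2 p.1 (circleMap 0 ρ t)‖ₑ / β)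
          ∂circleMeasure) * (Ψ.eval (b / β) / Ψ.eval (2⁻¹ ^ (k + 1) / β) + 1) ≤
            2⁻¹ ^ (k + 1)) ∧
      (k : ℝ≥0∞) < circleMeasure {t | ‖boundaryValue φ t - p.2‖ ≤ 2 * (1 - p.1)} *
        Ψ.chi A (ENNReal.ofReal (1 / (1 - p.1))) := by
    intro k b
    set W := Ψ.eval (b / β) / Ψ.eval (2⁻¹ ^ (k + 1) / β) + 1 with hW
    have hWt : W ≠ ⊤ := by
      refine ENNReal.add_ne_top.2 ⟨ENNReal.div_ne_top (Ψ.eval_ne_top ?_) (Ψ.eval_ne_zero ?_),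
        ENNReal.one_ne_top⟩
      · exact ENNReal.div_ne_top ENNReal.coe_ne_top hβ0
      · exact ENNReal.div_ne_zero.2 ⟨pow_ne_zero _ (by simp), ENNReal.coe_ne_top⟩
    have hW0 : W ≠ 0 := by simp [hW]
    -- The modular of v tends to 0 uniformly in a, so r₀ is fixed before the failing window supplies
    -- s and its centre.
    obtain ⟨r₀, hr₀, hr⟩ := hmod (2⁻¹ ^ (k + 1) / W)
      (ENNReal.div_ne_zero.2 ⟨pow_ne_zero _ (by simp), hWt⟩)
    obtain ⟨s, hs, a, ha⟩ := hbad k (min 1 (1 - r₀)) (lt_min one_pos (by linarith))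
    have hs1 := hs.2.trans_le (min_le_left _ _)
    have hs2 := hs.2.trans_le (min_le_right _ _)
    have hmem : 1 - s ∈ Ico (0 : ℝ) 1 := ⟨by linarith, by linarith [hs.1]⟩
    refine ⟨(1 - s, a), hmem, fun ρ hρ => ?_, ?_⟩
    · exact (ENNReal.le_div_iff_mul_le (Or.inl hW0) (Or.inl hWt)).1
        (hr (1 - s) hmem (by linarith) a ρ hρ)
    · simpa only [sub_sub_cancel, ENNReal.coe_natCast] using ha
  choose p hp1 hp2 hp3 using hstep
  -- The past enters the choice of a new bump only through the running total B_k, so the recursion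
  -- is on B alone.
  obtain ⟨B, hB0, hB⟩ : ∃ B : ℕ → ℝ≥0, B 0 = 1 ∧
      ∀ k, B (k + 1) = B k + (growth Ψ (p k (B k)).1).toNNReal :=
    ⟨fun n => Nat.rec 1 (fun k b => b + (growth Ψ (p k b).1).toNNReal) n, rfl, fun _ => rfl⟩
  refine ⟨A, hA, β, hβ, fun k => (p k (B k)).1, fun k => (p k (B k)).2, fun k => B k,
    fun k => hp1 k (B k), ?_, fun k => ?_, fun k => hp2 k (B k), fun k => hp3 k (B k)⟩
  · beta_reduce
    rw [hB0, ENNReal.coe_one]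
  · beta_reduce
    rw [hB, ENNReal.coe_add, ENNReal.ofReal]

/-- The sparse sums of bumps form a bounded sequence in `H^Ψ`. -/
theorem exists_bounded_bumpSum {r : ℕ → ℝ} {a : ℕ → Circle} (hr : ∀ k, r k ∈ Ico (0 : ℝ) 1)
    {β : ℝ≥0} (hβ : 0 < β) {B : ℕ → ℝ≥0∞} (hB0 : B 0 = 1)
    (hB : ∀ k, B (k + 1) = B k + ENNReal.ofReal (growth Ψ (r k)))
    (hsmall : ∀ k, ∀ ρ ∈ Ico (0 : ℝ) 1,
      (∫⁻ t, Ψ.eval (ENNReal.ofReal (growth Ψ (r k)) * ‖vFun (a k) (r k) (circleMap 0 ρ t)‖ₑ / β)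
        ∂circleMeasure) * (Ψ.eval (B k / β) / Ψ.eval (2⁻¹ ^ (k + 1) / β) + 1) ≤ 2⁻¹ ^ (k + 1)) :
    ∃ D : ℝ, 0 < D ∧ ∃ s : ℕ → HardyOrlicz Ψ, (∀ K, ‖s K‖ ≤ D) ∧
      ∀ K, ∀ z ∈ Metric.ball (0 : ℂ) 1, s K z = bumpSum Ψ r a K z := by
  have hβ0 : (β : ℝ≥0∞) ≠ 0 := by simpa using hβ.ne'
  have hc : (0 : ℝ) < 2 * β := by positivity
  have hfin : Ψ.eval (1 / (2 * β)) + 1 ≠ ⊤ := by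
    refine ENNReal.add_ne_top.2 ⟨Ψ.eval_ne_top ?_, ENNReal.one_ne_top⟩
    exact ENNReal.div_ne_top ENNReal.one_ne_top (mul_ne_zero two_ne_zero hβ0)
  set K₀ := (Ψ.eval (1 / (2 * β)) + 1).toReal with hK₀
  have hK1 : 1 ≤ K₀ := by
    rw [hK₀, ← ENNReal.toReal_one]
    exact ENNReal.toReal_mono hfin le_add_self
  have hmod : ∀ K, ∀ ρ ∈ Ico (0 : ℝ) 1,
      ∫⁻ t, Ψ.eval (‖bumpSum Ψ r a K (circleMap 0 ρ t)‖ₑ / ENNReal.ofReal (2 * β))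
        ∂circleMeasure ≤ ENNReal.ofReal K₀ := by
    intro K ρ hρ
    have e : ENNReal.ofReal (2 * β) = 2 * β := by
      rw [ENNReal.ofReal_mul zero_le_two, ENNReal.ofReal_ofNat, ENNReal.ofReal_coe_nnreal]
    rw [e, hK₀, ENNReal.ofReal_toReal hfin]
    exact lintegral_eval_bumpSum_le hr hβ hB0 hB hsmall K hρ
  have happ : ∀ K, ∀ z ∈ Metric.ball (0 : ℂ) 1,
      ofModular Ψ _ (differentiableOn_bumpSum hr K) hc hK1 (hmod K) z = bumpSum Ψ r a K z :=
    fun K z hz => ofModular_apply _ _ _ _ hz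
  refine ⟨K₀ * (2 * β), by positivity, fun K => ofModular Ψ _ (differentiableOn_bumpSum hr K) hc hK1
    (hmod K), fun K => norm_le_of_lintegral_le hc hK1 fun ρ hρ => ?_, happ⟩
  refine le_trans (le_of_eq (lintegral_congr fun t => ?_)) (hmod K ρ hρ)
  rw [happ K _ (circleMap_mem_unitBall hρ t)]

theorem ChiWindow.of_isWeaklyCompactOperator (hΨ : Ψ.SatisfiesDelta2)
    (hφ : DifferentiableOn ℂ φ (Metric.ball 0 1))
    (hmaps : MapsTo φ (Metric.ball 0 1) (Metric.ball 0 1))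
    (hC : IsWeaklyCompactOperator (compCLM (Ψ := Ψ) hφ hmaps)) : ChiWindow Ψ φ := by
  by_contra hW
  obtain ⟨A, hA, β, hβ, r, a, B, hr, hB0, hB, hsmall, hbig⟩ := exists_sparse_bumps hΨ hW
  obtain ⟨D, hD, s, hsD, hs⟩ := exists_bounded_bumpSum hr hβ hB0 hB hsmall
  have hD' : ‖((D⁻¹ : ℝ) : ℂ)‖ = D⁻¹ := by
    rw [Complex.norm_real, Real.norm_of_nonneg (by positivity)]
  obtain ⟨g, hg⟩ := hC.exists_mem_of_convex (x := fun K => ((D⁻¹ : ℝ) : ℂ) • s K) fun K => by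
    rw [norm_smul, hD', inv_mul_le_iff₀ hD, mul_one]
    exact hsD K
  have hval : ∀ K, ∀ z ∈ Metric.ball (0 : ℂ) 1,
      compCLM hφ hmaps (((D⁻¹ : ℝ) : ℂ) • s K) z = ((D⁻¹ : ℝ) : ℂ) * bumpSum Ψ r a K (φ z) := by
    intro K z hz
    rw [compCLM_apply _ _ _ hz, smul_apply, hs K _ (hmaps hz)]
  have hle : ∀ z ∈ Metric.ball (0 : ℂ) 1, ‖φ z‖ ≤ 1 := fun z hz => by
    simpa using (mem_ball_zero_iff.1 (hmaps hz)).le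
  -- Evaluating the real part at z cuts out a closed half-space containing all images with index K >
  -- k.
  have hre : ∀ k, ∀ z ∈ Metric.ball (0 : ℂ) 1,
      D⁻¹ * (growth Ψ (r k) * (vFun (a k) (r k) (φ z)).re) ≤ (g z).re := by
    intro k z hz
    let ℓ : HardyOrlicz Ψ →L[ℝ] ℝ := Complex.reCLM.comp ((evalCLM Ψ z hz).restrictScalars ℝ)
    refine hg {f | D⁻¹ * (growth Ψ (r k) * (vFun (a k) (r k) (φ z)).re) ≤ ℓ f}
      (convex_halfSpace_ge ℓ.isLinear _) (isClosed_le continuous_const ℓ.continuous) ?_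
    filter_upwards [eventually_gt_atTop k] with K hK
    change _ ≤ (compCLM hφ hmaps (((D⁻¹ : ℝ) : ℂ) • s K) z).re
    rw [hval K z hz, Complex.re_ofReal_mul]
    gcongr
    exact le_re_bumpSum hr hK (hle z hz)
  -- Each partial sum is bounded, and the bounded functions form a convex set; its norm closure
  -- therefore contains g.
  have hcl : g ∈ closure {f : HardyOrlicz Ψ | ∃ M, ∀ z ∈ Metric.ball (0 : ℂ) 1, ‖f z‖ ≤ M} := by
    refine hg _ (Convex.closure ?_) isClosed_closure (Eventually.of_forall fun K =>
      subset_closure ⟨D⁻¹ * ∑ k ∈ Finset.range K, growth Ψ (r k), fun z hz => ?_⟩)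
    · rintro f ⟨M, hM⟩ f' ⟨M', hM'⟩ x y hx hy -
      refine ⟨x * M + y * M', fun z hz => ?_⟩
      change ‖(x : ℂ) * f z + (y : ℂ) * f' z‖ ≤ _
      refine (norm_add_le _ _).trans ?_
      rw [norm_mul, norm_mul, Complex.norm_real, Complex.norm_real, Real.norm_of_nonneg hx,
        Real.norm_of_nonneg hy]
      gcongr
      · exact hM z hz
      · exact hM' z hz
    · rw [hval K z hz, norm_mul, hD']
      gcongr
      exact norm_bumpSum_le hr K (hle z hz)
  have hA' : (0 : ℝ) < A := hA
  -- Chosen so that D⁻¹ · (1/9)/(2ε) = A: on a window, Re g at scale 2ε then reaches A Ψ⁻¹(1/(1 -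
  -- r_k)).
  set ε : ℝ := 1 / (18 * D * A) with hε
  have hε0 : 0 < ε := by positivity
  obtain ⟨b, ⟨M, hM⟩, hb⟩ := Metric.mem_closure_iff.1 hcl ε hε0
  rw [dist_eq_norm] at hb
  -- The bound from g = (g - b) + b and midpoint convexity at scale 2ε. It is finite and independent
  -- of k, so the window bounds k < K₁ fail for large k.
  set K₁ : ℝ≥0∞ := 2⁻¹ + 2⁻¹ * Ψ.eval (ENNReal.ofReal M / ENNReal.ofReal ε) with hK₁
  have hK₁t : K₁ ≠ ⊤ := by
    refine ENNReal.add_ne_top.2 ⟨by simp, ENNReal.mul_ne_top (by simp) (Ψ.eval_ne_top ?_)⟩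
    exact ENNReal.div_ne_top ENNReal.ofReal_ne_top (by simpa using hε0)
  have hmod : ∀ ρ ∈ Ico (0 : ℝ) 1,
      ∫⁻ t, Ψ.eval (‖g (circleMap 0 ρ t)‖ₑ / ENNReal.ofReal (2 * ε)) ∂circleMeasure ≤ K₁ := by
    intro ρ hρ
    calc ∫⁻ t, Ψ.eval (‖g (circleMap 0 ρ t)‖ₑ / ENNReal.ofReal (2 * ε)) ∂circleMeasure
        ≤ ∫⁻ t, (2⁻¹ * Ψ.eval (‖(g - b) (circleMap 0 ρ t)‖ₑ / ENNReal.ofReal ε) +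
            2⁻¹ * Ψ.eval (ENNReal.ofReal M / ENNReal.ofReal ε)) ∂circleMeasure := by
          refine lintegral_mono fun t => ?_
          have h1 := Ψ.eval_enorm_sub_le ((g - b) (circleMap 0 ρ t))
            (-(b (circleMap 0 ρ t))) ε
          rw [sub_apply, sub_neg_eq_add, sub_add_cancel, enorm_neg] at h1
          refine h1.trans ?_
          rw [sub_apply]
          gcongr
          refine Ψ.eval_mono (ENNReal.div_le_div_right ?_ _)
          rw [← ofReal_norm]
          exact ENNReal.ofReal_le_ofReal (hM _ (circleMap_mem_unitBall hρ t))
      _ = 2⁻¹ * ∫⁻ t, Ψ.eval (‖(g - b) (circleMap 0 ρ t)‖ₑ / ENNReal.ofReal ε) ∂circleMeasure +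
            2⁻¹ * Ψ.eval (ENNReal.ofReal M / ENNReal.ofReal ε) := by
          rw [lintegral_add_right _ measurable_const, lintegral_const_mul' _ _ (by simp)]
          simp
      _ ≤ 2⁻¹ * 1 + 2⁻¹ * Ψ.eval (ENNReal.ofReal M / ENNReal.ofReal ε) := by
          gcongr
          exact lintegral_eval_slice_le_one hb hρ
      _ = K₁ := by rw [mul_one]
  have hcheb : ∀ k, circleMeasure {t | ‖boundaryValue φ t - a k‖ ≤ 2 * (1 - r k)} *
      Ψ.chi A (ENNReal.ofReal (1 / (1 - r k))) ≤ K₁ := by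
    intro k
    refine measure_boundaryValue_mul_le hφ hmaps (E := {w | ‖w - a k‖ ≤ 2 * (1 - r k)})
      (g := fun w => Ψ.eval (ENNReal.ofReal (D⁻¹ * (growth Ψ (r k) * (vFun (a k) (r k) w).re)) /
        ENNReal.ofReal (2 * ε))) (fun w hw => ?_) (fun n => ?_) ?_ fun w hwE hw => ?_
    · have h1 : ContinuousAt (fun w => ENNReal.ofReal
          (D⁻¹ * (growth Ψ (r k) * (vFun (a k) (r k) w).re)) / ENNReal.ofReal (2 * ε)) w := by
        refine (ENNReal.continuous_div_const _ (by simpa using hε0)).continuousAt.comp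
          (ENNReal.continuous_ofReal.continuousAt.comp ?_)
        exact continuousAt_const.mul (continuousAt_const.mul
          (Complex.continuous_re.continuousAt.comp (continuousAt_vFun (a k) (hr k) hw)))
      exact Ψ.continuous_eval.continuousAt.comp h1
    · refine le_trans (lintegral_mono fun t => ?_) (hmod _ (radSeq_mem n))
      refine Ψ.eval_mono (ENNReal.div_le_div_right ?_ _)
      rw [← ofReal_norm]
      exact ENNReal.ofReal_le_ofReal ((hre k _ (circleMap_mem_unitBall (radSeq_mem n) t)).trans
        (Complex.re_le_norm _))
    · exact (isClosed_le (by fun_prop) continuous_const).measurableSet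
    · rw [OrliczFunction.chi, ← ofReal_growth, ← ENNReal.ofReal_coe_nnreal,
        ← ENNReal.ofReal_mul hA'.le, ← ENNReal.ofReal_div_of_pos (by positivity)]
      refine Ψ.eval_mono (ENNReal.ofReal_le_ofReal ?_)
      have h9 := (one_ninth_le_sq_norm_vFun (hr k) hw hwE).trans (sq_norm_vFun_le_re (a k) (hr k) hw)
      have hgr := growth_nonneg Ψ (r k)
      calc (A : ℝ) * growth Ψ (r k) = D⁻¹ * (growth Ψ (r k) * (1 / 9)) / (2 * ε) := by
            rw [hε]; field_simp; ring
        _ ≤ _ := by gcongr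
  obtain ⟨k, hk⟩ := ENNReal.exists_nat_gt hK₁t
  exact absurd ((hbig k).trans_le (hcheb k)) (not_lt.2 hk.le)

end

/-! ### Assembly of the equivalences. -/

theorem mainTheorem1 (Ψ : OrliczFunction) (hΨ : Ψ.SatisfiesDelta2) (φ : ℂ → ℂ)
    (hφ : DifferentiableOn ℂ φ (Metric.ball 0 1))
    (hmaps : MapsTo φ (Metric.ball 0 1) (Metric.ball 0 1)) :
    ∃ C : HardyOrlicz Ψ →L[ℂ] HardyOrlicz Ψ,
      (∀ f : HardyOrlicz Ψ, ∀ z ∈ Metric.ball (0 : ℂ) 1, C f z = f (φ z)) ∧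
      List.TFAE [
        OrderBoundedIntoMorseTransue C,
        IsCompactOperator C,
        IsWeaklyCompactOperator C,
        MemMorseTransue Ψ (fun t => Ψ.inv (1 / (1 - ‖boundaryValue φ t‖ₑ))),
        ∀ B : ℝ≥0, 0 < B →
          Integrable (fun t => Ψ.chi B (1 / (1 - ‖boundaryValue φ t‖ₑ))) circleMeasure,
        ∀ A : ℝ≥0, 0 < A →
          (fun s : ℝ => circleMeasure.real {t | 1 - ‖boundaryValue φ t‖ < s}) =O[𝓝[>] 0]
            fun s : ℝ => 1 / (Ψ.chi A (ENNReal.ofReal (1 / s))).toReal,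
        (fun r : ℝ => ⨆ a : Circle, ‖C (uElem Ψ a r)‖) =o[𝓝[<] 1]
          fun r : ℝ => 1 / (Ψ.inv (ENNReal.ofReal (1 / (1 - r)))).toReal] := by
  refine ⟨HardyOrlicz.compCLM hφ hmaps, fun f z hz => HardyOrlicz.compCLM_apply _ _ _ hz, ?_⟩
  have htail := ChiTail.chiFiniteIntegral hΨ hφ hmaps
  -- Weak compactness and the little-o condition both return to integrability through the window
  -- condition.
  have hwin : ChiWindow Ψ φ → ChiFiniteIntegral Ψ φ := fun h => htail (h.chiTail hΨ hφ hmaps)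
  tfae_have 1 ↔ 4 := by
    rw [memMorseTransue_iff hφ hmaps]
    exact ⟨ChiFiniteIntegral.of_orderBounded hφ hmaps, ChiFiniteIntegral.orderBounded hφ hmaps⟩
  tfae_have 4 ↔ 5 := by
    rw [memMorseTransue_iff hφ hmaps, integrable_chi_iff hφ hmaps]
  tfae_have 4 ↔ 6 := by
    rw [memMorseTransue_iff hφ hmaps, isBigO_tail_iff]
    exact ⟨ChiFiniteIntegral.chiTail hφ hmaps, htail⟩
  tfae_have 4 → 2 := by
    rw [memMorseTransue_iff hφ hmaps]
    exact ChiFiniteIntegral.isCompactOperator hφ hmaps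
  tfae_have 2 → 3 := IsCompactOperator.isWeaklyCompactOperator
  tfae_have 3 → 4 := by
    rw [memMorseTransue_iff hφ hmaps]
    exact fun h => hwin (ChiWindow.of_isWeaklyCompactOperator hΨ hφ hmaps h)
  tfae_have 4 → 7 := by
    rw [memMorseTransue_iff hφ hmaps]
    exact ChiFiniteIntegral.isLittleO hφ hmaps
  tfae_have 7 → 4 := by
    rw [memMorseTransue_iff hφ hmaps]
    exact fun h => hwin (ChiWindow.of_isLittleO hφ hmaps h)
  tfae_finish
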